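/- Let $\mathcal{X},\mathcal{Y}$ be finite alphabets, let $p_{XY}$ be a probability mass function on $\mathcal{X}\times\mathcal{Y}$, and let $(X_1,Y_1),(X_2,Y_2),\ldots$ be i.i.d. with law $p_{XY}$. For $R=(R_0,\ldots,R_4)\in\mathbb{R}^5$, a code of block length $n$ for the extended Gray--Wyner system with noncausal complementary side information consists of an encoder mapping $(X^n,Y^n)$ to five indices $M_i\in[1,2^{nR_i}]\cap\mathbb{Z}$, $i=0,\ldots,4$, and of four decoders: decoder 1 estimates $X^n$ from $(M_0,M_1)$, decoder 2 estimates $Y^n$ from $(M_0,M_2)$, decoder 3 estimates $X^n$ from $(M_0,M_3,Y^n)$, and decoder 4 estimates $Y^n$ from $(M_0,M_4,X^n)$. The tuple $R$ is achievable if there is a sequence of such codes, one for each $n$, for which the probability that at least one of the four estimates is wrong tends to $0$ as $n\to\infty$. The rate region $\mathscr{R}'$ is the closure of the set of achievable tuples. All logarithms are to base 2. **Theorem.** $\mathscr{R}'$ is the set of tuples $(R_0,R_1,R_2,R_3,R_4)$ of nonnegative reals such that \begin{align*} R_{0} & \ge I(X,Y;U), & R_{1} & \ge H(X|U), & R_{2}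 & \ge H(Y|U),\\ R_{3} & \ge H(X|U)-H(Y), & R_{4} & \ge H(Y|U)-H(X),\\ R_{0}+R_{3} & \ge H(X|Y), & R_{0}+R_{4} & \ge H(Y|X),\\ R_{2}+R_{3} & \ge H(X|U), & R_{1}+R_{4} & \ge H(Y|U),\\ R_{0}+R_{2}+R_{3} & \ge H(X,Y), & R_{0}+R_{1}+R_{4} & \ge H(X,Y) \end{align*} for some conditional probability mass function $p_{U|XY}$ of a random variable $U$ on a finite alphabet $\mathcal{U}$ with $|\mathcal{U}|\le|\mathcal{X}|\cdot|\mathcal{Y}|+2$, where $(X,Y)\sim p_{XY}$. -/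

import Mathlib

namespace EGW

/-! ### Information quantities (in bits) of probability mass functions on finite alphabets -/

section Info

variable {α β : Type*}

/-- Marginal of the first component of a joint pmf. -/
def fstLaw [Fintype β] (p : α × β → ℝ) : α → ℝ := fun a => ∑ b, p (a, b)

/-- Marginal of the second component of a joint pmf. -/
def sndLaw [Fintype α] (p : α × β → ℝ) : β → ℝ := fun b => ∑ a, p (a, b)

/-- Entropy `H(A)` in bits of the pmf `p` of `A`. -/
noncomputable def entropy [Fintype α] (p : α → ℝ) : ℝ :=
  -∑ a, p a * Real.logb 2 (p a)

/-- Conditional entropy `H(A|B)` in bits, where `p` is the joint pmf of `(A, B)`.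
Terms with `p (a, b) = 0` vanish. -/
noncomputable def condEntropy [Fintype α] [Fintype β] (p : α × β → ℝ) : ℝ :=
  -∑ a, ∑ b, p (a, b) * Real.logb 2 (p (a, b) / sndLaw p b)

/-- Mutual information `I(A;B)` in bits, where `p` is the joint pmf of `(A, B)`.
Terms with `p (a, b) = 0` vanish. -/
noncomputable def mutualInfo [Fintype α] [Fintype β] (p : α × β → ℝ) : ℝ :=
  ∑ a, ∑ b, p (a, b) * Real.logb 2 (p (a, b) / (fstLaw p a * sndLaw p b))

end Info

/-! ### The joint law of `(X, Y, U)` given `p_{XY}` and `p_{U|XY}` -/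

section Aux

variable {𝒳 𝒴 𝒰 : Type*}

/-- Joint pmf of `((X, Y), U)` when `(X, Y) ∼ p` and `q (x, y)` is the conditional pmf of `U`
given `(X, Y) = (x, y)`. -/
def lawXYU (p : 𝒳 × 𝒴 → ℝ) (q : 𝒳 × 𝒴 → 𝒰 → ℝ) : (𝒳 × 𝒴) × 𝒰 → ℝ :=
  fun z => p z.1 * q z.1 z.2

/-- Joint pmf of `(X, U)`. -/
def lawXU [Fintype 𝒴] (p : 𝒳 × 𝒴 → ℝ) (q : 𝒳 × 𝒴 → 𝒰 → ℝ) : 𝒳 × 𝒰 → ℝ :=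
  fun z => ∑ y, lawXYU p q ((z.1, y), z.2)

/-- Joint pmf of `(Y, U)`. -/
def lawYU [Fintype 𝒳] (p : 𝒳 × 𝒴 → ℝ) (q : 𝒳 × 𝒴 → 𝒰 → ℝ) : 𝒴 × 𝒰 → ℝ :=
  fun z => ∑ x, lawXYU p q ((x, z.1), z.2)

end Aux

/-! ### The coding problem -/

/-- The index set `[1 : 2^{nr}] = [1, 2^{nr}] ∩ ℤ`, which has `⌊2^{nr}⌋` elements (numbered here
from `0`). It is empty when `n ≥ 1` and `r < 0`. -/
abbrev Index (n : ℕ) (r : ℝ) : Type := Fin ⌊(2 : ℝ) ^ ((n : ℝ) * r)⌋₊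

/-- A code of block length `n` and rates `R = (R₀, …, R₄)` for the extended Gray–Wyner system with
noncausal complementary side information: the encoder maps `(xⁿ, yⁿ)` to five indices;
decoder 1 sees `(m₀, m₁)`, decoder 2 sees `(m₀, m₂)`, decoder 3 sees `(m₀, m₃, yⁿ)`, decoder 4 sees
`(m₀, m₄, xⁿ)`; decoders 1 and 3 estimate `xⁿ`, decoders 2 and 4 estimate `yⁿ`. -/
structure Code (𝒳 𝒴 : Type*) (n : ℕ) (R : Fin 5 → ℝ) where
  enc : (Fin n → 𝒳) → (Fin n → 𝒴) → (i : Fin 5) → Index n (R i)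
  dec1 : Index n (R 0) → Index n (R 1) → (Fin n → 𝒳)
  dec2 : Index n (R 0) → Index n (R 2) → (Fin n → 𝒴)
  dec3 : Index n (R 0) → Index n (R 3) → (Fin n → 𝒴) → (Fin n → 𝒳)
  dec4 : Index n (R 0) → Index n (R 4) → (Fin n → 𝒳) → (Fin n → 𝒴)

section Coding

variable {𝒳 𝒴 : Type*}

/-- All four decoders recover their sequences when the source emits `(xⁿ, yⁿ)`. -/
def Code.Correct {n : ℕ} {R : Fin 5 → ℝ} (c : Code 𝒳 𝒴 n R)
    (x : Fin n → 𝒳) (y : Fin n → 𝒴) : Prop :=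
  c.dec1 (c.enc x y 0) (c.enc x y 1) = x ∧
  c.dec2 (c.enc x y 0) (c.enc x y 2) = y ∧
  c.dec3 (c.enc x y 0) (c.enc x y 3) y = x ∧
  c.dec4 (c.enc x y 0) (c.enc x y 4) x = y

open Classical in
/-- Probability that some decoder errs, when `(Xⁿ, Yⁿ)` is i.i.d. with `(X₁, Y₁) ∼ p`. -/
noncomputable def Code.errorProb [Fintype 𝒳] [Fintype 𝒴] (p : 𝒳 × 𝒴 → ℝ)
    {n : ℕ} {R : Fin 5 → ℝ} (c : Code 𝒳 𝒴 n R) : ℝ :=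
  ∑ x : Fin n → 𝒳, ∑ y : Fin n → 𝒴,
    if c.Correct x y then 0 else ∏ i, p (x i, y i)

/-- `R` is achievable: there are codes of rates `R` and of every block length whose probability of
error vanishes as the block length tends to infinity. -/
def Achievable [Fintype 𝒳] [Fintype 𝒴] (p : 𝒳 × 𝒴 → ℝ) (R : Fin 5 → ℝ) : Prop :=
  ∃ c : (n : ℕ) → Code 𝒳 𝒴 n R,
    Filter.Tendsto (fun n => (c n).errorProb p) Filter.atTop (nhds 0)

/-- The rate region: the closure of the set of achievable rate tuples. -/
def rateRegion [Fintype 𝒳] [Fintype 𝒴] (p : 𝒳 × 𝒴 → ℝ) : Set (Fin 5 → ℝ) :=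
  closure {R | Achievable p R}

end Coding

end EGW

/-! Converse. Let M be the common message of a code of block length n. A Fano-type bound
(`condEntropy_le_of_decoder`) controls H(Xⁿ|M) and H(Yⁿ|M) by the private rates. The side sequence
of decoder 3 or 4 is either charged at its own entropy, or produced by decoder 2 or 1, or
conditioned upon; these three treatments give the various sum constraints. With S = (X,Y) and a
uniform time index i, the variable U = (i, M, S₁, …, Sᵢ₋₁) satisfies n I(X,Y;U) ≤ log |M|, n H(X|U)
≤ H(Xⁿ|M) and n H(Y|U) ≤ H(Yⁿ|M) (`exists_single_letter`). Linear programming then shrinks its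
alphabet (`exists_small_alphabet`). Up to a slack that vanishes with n the rates lie in the
single-letter region, which is closed by compactness.

Achievability. A covering argument (`eventually_exists_quantizer`) attaches to all but an improbable
set of pairs (x,y) of blocks an index l = φ(x,y), one of about 2^(nI) with I = I(X,Y;U), so that few
sequences share an index. The common message consists of independent random hashes of l, (l,x),
(l,y), (x,y) with rates s₀, s₁, s₂, s₃ of sum R₀; each private message is a hash of the sequence to
be recovered. A decoder can fail only if a wrong candidate agrees in all hashes that it sees. By the
union bound, up to ε, it suffices that s₀+s₁+R₁ ≥ I+H(X|U), s₁+R₁ ≥ H(X|U), R₀+R₃ ≥ H(X|Y), s₁+s₃+R₃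
≥ min(H(X|Y,U), H(X|Y)), together with the same conditions with X and Y exchanged
(`exists_oneShot_code`). If R₁ exceeds H(X|U), decoder 1 needs fewer common bits about l, and the
saved rate can serve decoder 4; likewise for R₂ and decoder 3. The split in
`achievable_add_of_constraints` realizes this from seven of the eleven constraints. -/

namespace EGW

/-! ### Entropy identities, Gibbs' inequality and the chain rule -/

section InfoBasics

variable {α β γ : Type*}

lemma logb_two_le_sub_one {x : ℝ} (hx : 0 < x) : Real.logb 2 x ≤ (x - 1) / Real.log 2 := by
  have h2 : 0 < Real.log 2 := Real.log_pos (by norm_num)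
  rw [Real.logb]
  gcongr
  exact Real.log_le_sub_one_of_pos hx

lemma le_sndLaw [Fintype α] {p : α × β → ℝ} (hp : ∀ z, 0 ≤ p z) (a : α) (b : β) :
    p (a, b) ≤ sndLaw p b :=
  Finset.single_le_sum (f := fun a => p (a, b)) (fun a _ => hp (a, b)) (Finset.mem_univ a)

lemma le_fstLaw [Fintype β] {p : α × β → ℝ} (hp : ∀ z, 0 ≤ p z) (a : α) (b : β) :
    p (a, b) ≤ fstLaw p a :=
  Finset.single_le_sum (f := fun b => p (a, b)) (fun b _ => hp (a, b)) (Finset.mem_univ b)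

lemma sndLaw_nonneg [Fintype α] {p : α × β → ℝ} (hp : ∀ z, 0 ≤ p z) (b : β) : 0 ≤ sndLaw p b :=
  Finset.sum_nonneg fun a _ => hp (a, b)

lemma fstLaw_nonneg [Fintype β] {p : α × β → ℝ} (hp : ∀ z, 0 ≤ p z) (a : α) : 0 ≤ fstLaw p a :=
  Finset.sum_nonneg fun b _ => hp (a, b)

lemma condEntropy_eq_sub [Fintype α] [Fintype β] {p : α × β → ℝ} (hp : ∀ z, 0 ≤ p z) :
    condEntropy p = entropy p - entropy (sndLaw p) := by
  have h1 : ∀ a b, p (a, b) * Real.logb 2 (p (a, b) / sndLaw p b) =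
      p (a, b) * Real.logb 2 (p (a, b)) - p (a, b) * Real.logb 2 (sndLaw p b) := by
    intro a b
    rcases eq_or_lt_of_le (hp (a, b)) with h | h
    · simp [← h]
    · rw [Real.logb_div h.ne' (h.trans_le (le_sndLaw hp a b)).ne']; ring
  have h2 : ∑ a, ∑ b, p (a, b) * Real.logb 2 (sndLaw p b) =
      ∑ b, sndLaw p b * Real.logb 2 (sndLaw p b) := by
    rw [Finset.sum_comm]
    exact Finset.sum_congr rfl fun b _ => by rw [← Finset.sum_mul]; rfl
  simp only [condEntropy, entropy, h1, Finset.sum_sub_distrib, Fintype.sum_prod_type, h2]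
  ring

lemma mutualInfo_eq [Fintype α] [Fintype β] {p : α × β → ℝ} (hp : ∀ z, 0 ≤ p z) :
    mutualInfo p = entropy (fstLaw p) + entropy (sndLaw p) - entropy p := by
  have h1 : ∀ a b, p (a, b) * Real.logb 2 (p (a, b) / (fstLaw p a * sndLaw p b)) =
      p (a, b) * Real.logb 2 (p (a, b)) - p (a, b) * Real.logb 2 (fstLaw p a)
        - p (a, b) * Real.logb 2 (sndLaw p b) := by
    intro a b
    rcases eq_or_lt_of_le (hp (a, b)) with h | h
    · simp [← h]
    · have h3 := (h.trans_le (le_sndLaw hp a b)).ne'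
      have h4 := (h.trans_le (le_fstLaw hp a b)).ne'
      rw [Real.logb_div h.ne' (mul_ne_zero h4 h3), Real.logb_mul h4 h3]; ring
  have h2 : ∑ a, ∑ b, p (a, b) * Real.logb 2 (sndLaw p b) =
      ∑ b, sndLaw p b * Real.logb 2 (sndLaw p b) := by
    rw [Finset.sum_comm]
    exact Finset.sum_congr rfl fun b _ => by rw [← Finset.sum_mul]; rfl
  have h3 : ∑ a, ∑ b, p (a, b) * Real.logb 2 (fstLaw p a) =
      ∑ a, fstLaw p a * Real.logb 2 (fstLaw p a) :=
    Finset.sum_congr rfl fun b _ => by rw [← Finset.sum_mul]; rfl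
  simp only [mutualInfo, entropy, h1, Finset.sum_sub_distrib, Fintype.sum_prod_type, h2, h3]
  ring

lemma condEntropy_nonneg [Fintype α] [Fintype β] {p : α × β → ℝ} (hp : ∀ z, 0 ≤ p z) :
    0 ≤ condEntropy p := by
  rw [condEntropy, neg_nonneg]
  refine Finset.sum_nonpos fun a _ => Finset.sum_nonpos fun b _ => ?_
  refine mul_nonpos_of_nonneg_of_nonpos (hp _) ?_
  exact Real.logb_nonpos (by norm_num) (div_nonneg (hp _) (sndLaw_nonneg hp b))
    (div_le_one_of_le₀ (le_sndLaw hp a b) (sndLaw_nonneg hp b))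

/-- Gibbs' inequality for conditional entropies. -/
lemma condEntropy_le_cross [Fintype α] [Fintype β] {p : α × β → ℝ} (hp : ∀ z, 0 ≤ p z)
    (Q : α → β → ℝ) (hQ : ∀ a b, 0 ≤ Q a b) (hpos : ∀ a b, 0 < p (a, b) → 0 < Q a b)
    (hsum : ∀ b, ∑ a, Q a b ≤ 1) :
    condEntropy p ≤ -∑ a, ∑ b, p (a, b) * Real.logb 2 (Q a b) := by
  have h2 : 0 < Real.log 2 := Real.log_pos (by norm_num)
  -- Termwise log t ≤ (t - 1)/ln 2 with t = Q(a|b) p(b) / p(a,b); the right-hand sides sum to at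
  -- most 0 because each Q(·|b) has mass at most 1.
  have key : ∀ a b, p (a, b) * Real.logb 2 (Q a b)
      - p (a, b) * Real.logb 2 (p (a, b) / sndLaw p b) ≤
      (Q a b * sndLaw p b - p (a, b)) / Real.log 2 := by
    intro a b
    rcases eq_or_lt_of_le (hp (a, b)) with h | h
    · rw [← h]
      simp only [zero_mul, sub_zero]
      exact div_nonneg (mul_nonneg (hQ a b) (sndLaw_nonneg hp b)) h2.le
    · have hs := h.trans_le (le_sndLaw hp a b)
      have hq := hpos a b h
      have h3 := logb_two_le_sub_one (x := Q a b * sndLaw p b / p (a, b)) (by positivity)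
      rw [Real.logb_div (by positivity) h.ne', Real.logb_mul hq.ne' hs.ne'] at h3
      rw [Real.logb_div h.ne' hs.ne']
      have h4 := mul_le_mul_of_nonneg_left h3 h.le
      have h5 : p (a, b) * ((Q a b * sndLaw p b / p (a, b) - 1) / Real.log 2) =
          (Q a b * sndLaw p b - p (a, b)) / Real.log 2 := by field_simp
      linarith
  have h6 : ∑ a, ∑ b, (p (a, b) * Real.logb 2 (Q a b)
      - p (a, b) * Real.logb 2 (p (a, b) / sndLaw p b)) ≤ 0 := by
    refine (Finset.sum_le_sum fun a _ => Finset.sum_le_sum fun b _ => key a b).trans ?_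
    rw [Finset.sum_comm]
    refine Finset.sum_nonpos fun b _ => ?_
    rw [← Finset.sum_div, Finset.sum_sub_distrib, ← Finset.sum_mul]
    refine div_nonpos_of_nonpos_of_nonneg ?_ h2.le
    have := mul_le_mul_of_nonneg_right (hsum b) (sndLaw_nonneg hp b)
    have h7 : ∑ a, p (a, b) = sndLaw p b := rfl
    linarith
  simp only [Finset.sum_sub_distrib] at h6
  rw [condEntropy]
  linarith

open Classical in
/-- Conditioning on more reduces entropy. -/
lemma condEntropy_le_of_map [Fintype α] [Fintype β] [Fintype γ] {p : α × β → ℝ}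
    (hp : ∀ z, 0 ≤ p z) (g : β → γ) :
    condEntropy p ≤ condEntropy (fun z : α × γ => ∑ b, if g b = z.2 then p (z.1, b) else 0) := by
  set r : α × γ → ℝ := fun z => ∑ b, if g b = z.2 then p (z.1, b) else 0 with hr
  have hr0 : ∀ z, 0 ≤ r z := fun z => Finset.sum_nonneg fun b _ => by
    split_ifs
    exacts [hp _, le_rfl]
  have hle : ∀ a b, p (a, b) ≤ r (a, g b) := fun a b => by
    have := Finset.single_le_sum (f := fun b' => if g b' = g b then p (a, b') else 0)
      (fun b' _ => by split_ifs; exacts [hp _, le_rfl]) (Finset.mem_univ b)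
    simpa [hr] using this
  -- Gibbs' inequality against the conditional law of the first component given g(b), whose cross
  -- entropy is exactly the coarser conditional entropy.
  refine (condEntropy_le_cross hp (fun a b => r (a, g b) / sndLaw r (g b))
    (fun a z => div_nonneg (hr0 _) (sndLaw_nonneg hr0 _)) ?_ ?_).trans_eq ?_
  · intro a b h
    have h1 := h.trans_le (hle a b)
    exact div_pos h1 (h1.trans_le (le_sndLaw hr0 a _))
  · intro b
    rw [← Finset.sum_div]
    exact div_self_le_one _
  · rw [condEntropy]
    congr 1
    refine Finset.sum_congr rfl fun a _ => ?_
    have : ∀ c, r (a, c) * Real.logb 2 (r (a, c) / sndLaw r c) =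
        ∑ b, if g b = c then p (a, b) * Real.logb 2 (r (a, c) / sndLaw r c) else 0 := by
      intro c
      conv_lhs => rw [hr]
      rw [Finset.sum_mul]
      exact Finset.sum_congr rfl fun b _ => by split_ifs <;> simp [hr]
    simp only [this]
    rw [Finset.sum_comm]
    simp

lemma entropy_comp_equiv [Fintype α] [Fintype β] (e : α ≃ β) (p : β → ℝ) :
    entropy (fun a => p (e a)) = entropy p := by
  simp only [entropy]
  congr 1
  exact Fintype.sum_equiv e _ _ fun _ => rfl

/-- The chain rule for conditional entropies. -/
lemma condEntropy_chain [Fintype α] [Fintype β] [Fintype γ] {p : (α × β) × γ → ℝ}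
    (hp : ∀ z, 0 ≤ p z) :
    condEntropy p = condEntropy (fun z : α × γ => ∑ b, p ((z.1, b), z.2)) +
      condEntropy (fun z : β × (γ × α) => p ((z.2.2, z.1), z.2.1)) := by
  rw [condEntropy_eq_sub hp, condEntropy_eq_sub fun z => Finset.sum_nonneg fun b _ => hp _,
    condEntropy_eq_sub fun z => hp _]
  have h1 : sndLaw p = sndLaw (fun z : α × γ => ∑ b, p ((z.1, b), z.2)) := by
    funext c
    simp only [sndLaw, Fintype.sum_prod_type]
  have h2 : entropy p = entropy (fun z : β × (γ × α) => p ((z.2.2, z.1), z.2.1)) :=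
    (entropy_comp_equiv
      ⟨fun z : β × (γ × α) => ((z.2.2, z.1), z.2.1), fun w => (w.1.2, (w.2, w.1.1)),
        fun _ => rfl, fun _ => rfl⟩ p).symm
  have h3 : entropy (sndLaw (fun z : β × (γ × α) => p ((z.2.2, z.1), z.2.1))) =
      entropy (fun z : α × γ => ∑ b, p ((z.1, b), z.2)) :=
    entropy_comp_equiv (Equiv.prodComm γ α) (fun z : α × γ => ∑ b, p ((z.1, b), z.2))
  rw [h1, h2, h3]
  ring

lemma entropy_le_logb_card [Fintype α] {p : α → ℝ} (hp : p ∈ stdSimplex ℝ α) {M : ℝ}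
    (hM : (Fintype.card α : ℝ) ≤ M) : entropy p ≤ Real.logb 2 M := by
  have hne : Nonempty α := by
    by_contra h
    rw [not_nonempty_iff] at h
    simpa using hp.2
  have hc : (0 : ℝ) < Fintype.card α := by exact_mod_cast Fintype.card_pos
  have hM0 := hc.trans_le hM
  -- Gibbs' inequality against constant weights 1/M, with trivial conditioning.
  have := condEntropy_le_cross (p := fun z : α × Unit => p z.1) (fun z => hp.1 z.1)
    (fun _ _ => 1 / M) (fun _ _ => by positivity) (fun _ _ _ => by positivity)
    (fun _ => by
      simp only [Finset.sum_const, Finset.card_univ, nsmul_eq_mul, mul_one_div]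
      exact div_le_one_of_le₀ hM (by positivity))
  simp only [condEntropy, sndLaw, hp.2, div_one, Finset.univ_unique, Finset.sum_singleton] at this
  rw [← Finset.sum_mul, hp.2] at this
  simpa [entropy] using this

lemma condEntropy_comp_equiv [Fintype α] [Fintype β] [Fintype γ] (e : γ ≃ β) (p : α × β → ℝ) :
    condEntropy (fun z : α × γ => p (z.1, e z.2)) = condEntropy p := by
  simp only [condEntropy]
  congr 1
  refine Finset.sum_congr rfl fun a _ => ?_
  exact Fintype.sum_equiv e _ _ fun c => rfl

lemma condEntropy_smul [Fintype α] [Fintype β] (c : ℝ) (p : α × β → ℝ) :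
    condEntropy (fun z => c * p z) = c * condEntropy p := by
  rcases eq_or_ne c 0 with rfl | hc
  · simp [condEntropy]
  simp only [condEntropy, sndLaw, ← Finset.mul_sum]
  rw [mul_neg, Finset.mul_sum]
  congr 1
  refine Finset.sum_congr rfl fun a _ => ?_
  rw [Finset.mul_sum]
  refine Finset.sum_congr rfl fun b _ => ?_
  rw [mul_div_mul_left _ _ hc, mul_assoc]

lemma condEntropy_eq_sum [Fintype α] [Fintype β] (p : α × β → ℝ) :
    condEntropy p = ∑ b, condEntropy (fun z : α × Unit => p (z.1, b)) := by
  simp only [condEntropy, sndLaw, Finset.univ_unique, Finset.sum_singleton,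
    Finset.sum_neg_distrib]
  rw [Finset.sum_comm]

/-- Conditional entropy is a sum over the slices b and homogeneous on each of them, also without
normalization. This linearity in the weights of the slices makes shrinking the alphabet of U a
linear programming problem. -/
lemma condEntropy_weighted [Fintype α] [Fintype β] (w : β → ℝ) (p : α × β → ℝ) :
    condEntropy (fun z : α × β => w z.2 * p z) =
      ∑ b, w b * condEntropy (fun z : α × Unit => p (z.1, b)) := by
  rw [condEntropy_eq_sum]
  refine Finset.sum_congr rfl fun b _ => ?_
  exact condEntropy_smul (w b) (fun z : α × Unit => p (z.1, b))

end InfoBasics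

/-! ### Basic solutions in linear programming -/

section Support

/-- A basic-solution argument from linear programming: a nonnegative combination of vectors can be
replaced by one that is supported on at most as many vectors as there are coordinates, without
increasing a nonnegative linear cost. -/
lemma exists_small_support {ι D : Type*} [Fintype ι] [Fintype D] (φ : ι → D → ℝ) (c : ι → ℝ)
    (hc : ∀ i, 0 ≤ c i) (N : ℕ) (w : ι → ℝ) (hw : ∀ i, 0 ≤ w i)
    (hN : (Finset.univ.filter fun i => w i ≠ 0).card ≤ N) :
    ∃ w' : ι → ℝ, (∀ i, 0 ≤ w' i) ∧ ∑ i, w' i • φ i = ∑ i, w i • φ i ∧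
      ∑ i, w' i * c i ≤ ∑ i, w i * c i ∧
      (Finset.univ.filter fun i => w' i ≠ 0).card ≤ Fintype.card D := by
  classical
  induction N generalizing w with
  | zero => exact ⟨w, hw, rfl, le_rfl, hN.trans (Nat.zero_le _)⟩
  | succ N ih =>
    by_cases hD : (Finset.univ.filter fun i => w i ≠ 0).card ≤ Fintype.card D
    · exact ⟨w, hw, rfl, le_rfl, hD⟩
    set J := Finset.univ.filter fun i => w i ≠ 0 with hJ
    have hcard : Module.finrank ℝ (D → ℝ) < Fintype.card J := by
      rw [Module.finrank_fintype_fun_eq_card, Fintype.card_coe]; omega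
    have hdep : ¬ LinearIndependent ℝ (fun j : J => φ j) := fun h =>
      absurd h.fintype_card_le_finrank (by omega)
    rw [Fintype.not_linearIndependent_iff] at hdep
    obtain ⟨g, hg, i0, hi0⟩ := hdep
    -- a direction in the kernel
    obtain ⟨v, hvJ, hvφ, hvc, i1, hi1⟩ : ∃ v : ι → ℝ, (∀ i, i ∉ J → v i = 0) ∧
        ∑ i, v i • φ i = 0 ∧ ∑ i, v i * c i ≤ 0 ∧ ∃ i, v i < 0 := by
      set u : ι → ℝ := fun i => if h : i ∈ J then g ⟨i, h⟩ else 0 with hu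
      have huJ : ∀ i, i ∉ J → u i = 0 := fun i hi => by simp [hu, hi]
      have huφ : ∑ i, u i • φ i = 0 := by
        rw [← hg, ← Finset.sum_subset (Finset.subset_univ J)
          (fun i _ hi => by rw [huJ i hi, zero_smul]), ← Finset.sum_coe_sort J]
        exact Finset.sum_congr rfl fun j _ => by simp [hu]
      have hu0 : u i0 ≠ 0 := by simpa [hu] using hi0
      have hneg : ∑ i, (-u) i • φ i = 0 := by
        simp only [Pi.neg_apply, neg_smul, Finset.sum_neg_distrib, huφ, neg_zero]
      -- One of u and -u does not increase the cost. If that one has no negative coordinate, its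
      -- opposite has one, and c ≥ 0 makes the cost of the opposite nonpositive too.
      rcases le_total (∑ i, u i * c i) 0 with h | h
      · by_cases hex : ∃ i, u i < 0
        · exact ⟨u, huJ, huφ, h, hex⟩
        · push Not at hex
          refine ⟨-u, fun i hi => by simp [huJ i hi], hneg, ?_, i0, ?_⟩
          · refine Finset.sum_nonpos fun i _ => ?_
            have := mul_nonneg (hex i) (hc i)
            simp only [Pi.neg_apply]; linarith
          · simpa using lt_of_le_of_ne (hex i0) hu0.symm
      · by_cases hex : ∃ i, 0 < u i
        · refine ⟨-u, fun i hi => by simp [huJ i hi], hneg, ?_, ?_⟩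
          · simpa [Finset.sum_neg_distrib] using h
          · obtain ⟨i, hi⟩ := hex; exact ⟨i, by simpa using hi⟩
        · push Not at hex
          refine ⟨u, huJ, huφ, ?_, i0, lt_of_le_of_ne (hex i0) hu0⟩
          exact Finset.sum_nonpos fun i _ => mul_nonpos_of_nonpos_of_nonneg (hex i) (hc i)
    -- move until a coordinate vanishes
    have hne : (Finset.univ.filter fun i => v i < 0).Nonempty := ⟨i1, by simpa using hi1⟩
    obtain ⟨i2, hi2, hmin⟩ := Finset.exists_min_image _ (fun i => w i / -v i) hne
    have hv2 : v i2 < 0 := by simpa using hi2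
    set t := w i2 / -v i2 with ht
    have ht0 : 0 ≤ t := div_nonneg (hw _) (by linarith)
    have hJ2 : i2 ∈ J := by
      by_contra h; exact hv2.ne (hvJ _ h)
    have hz : w i2 + t * v i2 = 0 := by
      have := hv2.ne
      rw [ht, div_neg, neg_mul, div_mul_cancel₀ _ this]; ring
    have hw' : ∀ i, 0 ≤ w i + t * v i := by
      intro i
      rcases le_or_gt 0 (v i) with h | h
      · exact add_nonneg (hw i) (mul_nonneg ht0 h)
      · have h3 := hmin i (by simpa using h)
        rw [le_div_iff₀ (by linarith)] at h3
        linarith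
    obtain ⟨w', h1, h2, h3, h4⟩ := ih (fun i => w i + t * v i) hw' (by
      have hsub : (Finset.univ.filter fun i => w i + t * v i ≠ 0) ⊆ J.erase i2 := by
        intro i hi
        simp only [Finset.mem_filter, Finset.mem_univ, true_and] at hi
        rw [Finset.mem_erase]
        refine ⟨fun h => hi (h ▸ hz), ?_⟩
        by_contra h
        have h5 : w i = 0 := by simpa [hJ] using h
        exact hi (by rw [h5, hvJ i h]; ring)
      have := Finset.card_le_card hsub
      rw [Finset.card_erase_of_mem hJ2] at this
      omega)
    refine ⟨w', h1, ?_, ?_, h4⟩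
    · rw [h2]
      simp only [add_smul, Finset.sum_add_distrib, mul_smul, ← Finset.smul_sum, hvφ, smul_zero,
        add_zero]
    · refine h3.trans ?_
      simp only [add_mul, Finset.sum_add_distrib, mul_assoc, ← Finset.mul_sum]
      have := mul_nonpos_of_nonneg_of_nonpos ht0 hvc
      linarith

end Support

/-! ### Bounding the auxiliary alphabet -/

section Reduction

variable {𝒳 𝒴 ι : Type*}

/-- Joint mass function of `(X, U)` from that of `((X, Y), U)`. -/
def margXU [Fintype 𝒴] (μ : (𝒳 × 𝒴) × ι → ℝ) : 𝒳 × ι → ℝ := fun z => ∑ y, μ ((z.1, y), z.2)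

/-- Joint mass function of `(Y, U)` from that of `((X, Y), U)`. -/
def margYU [Fintype 𝒳] (μ : (𝒳 × 𝒴) × ι → ℝ) : 𝒴 × ι → ℝ := fun z => ∑ x, μ ((x, z.1), z.2)

lemma exists_kernel_of_joint {S : Type*} [Fintype S] [Fintype ι] [Nonempty ι]
    (p : S → ℝ) (μ : S × ι → ℝ) (hμ : ∀ z, 0 ≤ μ z) (hfst : fstLaw μ = p) :
    ∃ q : S → ι → ℝ, (∀ s, q s ∈ stdSimplex ℝ ι) ∧ ∀ z, p z.1 * q z.1 z.2 = μ z := by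
  classical
  have hp : ∀ s, p s = ∑ u, μ (s, u) := fun s => by rw [← hfst]; rfl
  -- Off the support of p any conditional law will do; a point mass is taken.
  refine ⟨fun s u => if p s = 0 then (if u = Classical.arbitrary ι then 1 else 0)
    else μ (s, u) / p s, fun s => ?_, ?_⟩
  · by_cases h : p s = 0
    · simp only [h, if_true]
      exact ⟨fun u => by positivity, by simp⟩
    · simp only [h, if_false]
      refine ⟨fun u => div_nonneg (hμ _) (hp s ▸ Finset.sum_nonneg fun _ _ => hμ _), ?_⟩
      rw [← Finset.sum_div, ← hp, div_self h]
  · rintro ⟨s, u⟩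
    by_cases h : p s = 0
    · have h2 := h
      rw [hp, Finset.sum_eq_zero_iff_of_nonneg fun u _ => hμ _] at h2
      simp [h, h2 u]
    · simp only [h, if_false]
      field_simp

/-- The auxiliary alphabet can be taken of size `|𝒳| |𝒴| + 2`. -/
lemma exists_small_alphabet [Fintype 𝒳] [Fintype 𝒴] [Fintype ι]
    {p : 𝒳 × 𝒴 → ℝ} (hp : p ∈ stdSimplex ℝ (𝒳 × 𝒴)) (μ : (𝒳 × 𝒴) × ι → ℝ)
    (hμ : ∀ z, 0 ≤ μ z) (hfst : fstLaw μ = p) :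
    ∃ (k : ℕ) (q : 𝒳 × 𝒴 → Fin k → ℝ), k ≤ Fintype.card 𝒳 * Fintype.card 𝒴 + 2 ∧
      (∀ s, q s ∈ stdSimplex ℝ (Fin k)) ∧
      condEntropy (lawXYU p q) = condEntropy μ ∧
      condEntropy (lawXU p q) ≤ condEntropy (margXU μ) ∧
      condEntropy (lawYU p q) = condEntropy (margYU μ) := by
  classical
  -- The preserved coordinates are the |𝒳||𝒴| masses of p, which already fix the total mass, and the
  -- two numbers H(X,Y|U) and H(Y|U): this is the bound |𝒳||𝒴| + 2. H(X|U) serves as the cost; it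
  -- may drop, since it enters the region only as a lower bound on rates.
  let φ : ι → ((𝒳 × 𝒴) ⊕ Bool) → ℝ := fun i => Sum.elim (fun s => μ (s, i))
    (fun b => if b then condEntropy (fun z : (𝒳 × 𝒴) × Unit => μ (z.1, i))
      else condEntropy (fun z : 𝒴 × Unit => margYU μ (z.1, i)))
  have hX : ∀ z, 0 ≤ margXU μ z := fun z => Finset.sum_nonneg fun _ _ => hμ _
  obtain ⟨w, hw, hwφ, hwc, hcard⟩ := exists_small_support φ
    (fun i => condEntropy (fun z : 𝒳 × Unit => margXU μ (z.1, i)))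
    (fun i => condEntropy_nonneg fun z => hX _) _ 1 (fun _ => zero_le_one) le_rfl
  set J := Finset.univ.filter fun i => w i ≠ 0 with hJ
  let e : Fin J.card ≃ J := J.equivFin.symm
  let ν : (𝒳 × 𝒴) × Fin J.card → ℝ := fun z => w (e z.2) * μ (z.1, e z.2)
  have hsum : ∀ f : ι → ℝ, ∑ u, w (e u) * f (e u) = ∑ i, w i * f i := by
    intro f
    rw [← Finset.sum_subset (Finset.subset_univ J)
      (fun i _ hi => by simp [show w i = 0 by simpa [hJ] using hi]), ← Finset.sum_coe_sort J]
    exact Fintype.sum_equiv e _ _ fun _ => rfl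
  have hν : ∀ z, 0 ≤ ν z := fun z => mul_nonneg (hw _) (hμ _)
  have hcoord : ∀ d, ∑ i, w i * φ i d = ∑ i, φ i d := by
    intro d
    have := congrFun hwφ d
    simpa [Finset.sum_apply] using this
  have hνp : fstLaw ν = p := by
    funext s
    have h1 := hcoord (Sum.inl s)
    rw [← hsum] at h1
    rw [← hfst]
    exact h1
  have hne : Nonempty (Fin J.card) := by
    by_contra h
    rw [not_nonempty_iff] at h
    have : ∑ s, p s = 0 := by
      rw [← hνp]
      exact Finset.sum_eq_zero fun s _ => by simp [fstLaw]
    rw [hp.2] at this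
    exact one_ne_zero this
  obtain ⟨q, hq, hqν⟩ := exists_kernel_of_joint p ν hν hνp
  have hlaw : lawXYU p q = ν := funext hqν
  have hlawX : lawXU p q = fun z => w (e z.2) * margXU μ (z.1, e z.2) := by
    funext z; simp only [lawXU, hlaw, ν, margXU, Finset.mul_sum]
  have hlawY : lawYU p q = fun z => w (e z.2) * margYU μ (z.1, e z.2) := by
    funext z; simp only [lawYU, hlaw, ν, margYU, Finset.mul_sum]
  have hcond : condEntropy (lawXYU p q) =
        ∑ i, w i * condEntropy (fun z : (𝒳 × 𝒴) × Unit => μ (z.1, i)) := by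
    rw [hlaw, ← hsum]
    exact condEntropy_weighted (fun u => w (e u)) fun z : (𝒳 × 𝒴) × Fin J.card => μ (z.1, e z.2)
  have hcondY : condEntropy (lawYU p q) =
        ∑ i, w i * condEntropy (fun z : 𝒴 × Unit => margYU μ (z.1, i)) := by
    rw [hlawY, ← hsum]
    exact condEntropy_weighted (fun u => w (e u)) fun z : 𝒴 × Fin J.card => margYU μ (z.1, e z.2)
  have hcondX : condEntropy (lawXU p q) =
        ∑ i, w i * condEntropy (fun z : 𝒳 × Unit => margXU μ (z.1, i)) := by
    rw [hlawX, ← hsum]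
    exact condEntropy_weighted (fun u => w (e u)) fun z : 𝒳 × Fin J.card => margXU μ (z.1, e z.2)
  refine ⟨J.card, q, hcard.trans (by simp [Fintype.card_prod]), hq, ?_, ?_, ?_⟩
  · rw [hcond, condEntropy_eq_sum μ]
    exact hcoord (Sum.inr true)
  · rw [hcondX, condEntropy_eq_sum (margXU μ)]
    simpa using hwc
  · rw [hcondY, condEntropy_eq_sum (margYU μ)]
    exact hcoord (Sum.inr false)

end Reduction

/-! ### Single-letterization -/

section SingleLetter

open Classical in
/-- Joint mass function of `(f(A), V)` from that of `(A, V)`. -/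
noncomputable def push {Ω A V : Type*} [Fintype Ω] (f : Ω → A) (P : Ω × V → ℝ) : A × V → ℝ :=
  fun z => ∑ ω, if f ω = z.1 then P (ω, z.2) else 0

lemma push_nonneg {Ω A V : Type*} [Fintype Ω] (f : Ω → A) {P : Ω × V → ℝ}
    (hP : ∀ z, 0 ≤ P z) (z : A × V) : 0 ≤ push f P z :=
  Finset.sum_nonneg fun ω _ => by split_ifs; exacts [hP _, le_rfl]

lemma condEntropy_comp_equiv_left {α β γ : Type*} [Fintype α] [Fintype β] [Fintype γ] (e : γ ≃ α)
    (p : α × β → ℝ) : condEntropy (fun z : γ × β => p (e z.1, z.2)) = condEntropy p := by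
  have h : sndLaw (fun z : γ × β => p (e z.1, z.2)) = sndLaw p := by
    funext b
    exact Fintype.sum_equiv e _ _ fun _ => rfl
  simp only [condEntropy, h]
  congr 1
  exact Fintype.sum_equiv e _ _ fun _ => rfl

variable {S A V : Type*} [Fintype S] [Fintype A] [Fintype V] {n : ℕ}

/-- The joint law of the first letter and `V`. -/
def headLaw (P : (Fin (n + 1) → S) × V → ℝ) : S × V → ℝ :=
  fun z => ∑ s : Fin n → S, P (Fin.cons z.1 s, z.2)

/-- The joint law of the remaining letters and `V` extended by the first letter. -/
def tailLaw (P : (Fin (n + 1) → S) × V → ℝ) : (Fin n → S) × (V × S) → ℝ :=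
  fun z => P (Fin.cons z.2.2 z.1, z.2.1)

lemma condEntropy_head_add_tail {P : (Fin (n + 1) → S) × V → ℝ} (hP : ∀ z, 0 ≤ P z) :
    condEntropy P = condEntropy (headLaw P) + condEntropy (tailLaw P) := by
  rw [← condEntropy_comp_equiv_left (Fin.consEquiv fun _ => S) P,
    condEntropy_chain fun z => hP _]
  rfl

lemma sum_cons_eq (F : (Fin (n + 1) → S) → ℝ) :
    ∑ s, F s = ∑ a, ∑ s : Fin n → S, F (Fin.cons a s) := by
  rw [← Fintype.sum_prod_type']
  exact (Fintype.sum_equiv (Fin.consEquiv fun _ => S) _ _ fun _ => rfl).symm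

/-- By the chain rule the right-hand side is a head term plus a tail term conditioned on f of the
first letter. Conditioning the tail on the whole first letter can only lower it. -/
lemma condEntropy_push_head_add_tail_le {P : (Fin (n + 1) → S) × V → ℝ} (hP : ∀ z, 0 ≤ P z)
    (f : S → A) :
    condEntropy (push f (headLaw P)) + condEntropy (push (fun s i => f (s i)) (tailLaw P)) ≤
      condEntropy (push (fun (s : Fin (n + 1) → S) i => f (s i)) P) := by
  classical
  have hcons : ∀ a (s : Fin n → S) b (t : Fin n → A),
      ((fun i => f ((Fin.cons a s : Fin (n + 1) → S) i)) = (Fin.cons b t : Fin (n + 1) → A)) ↔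
        f a = b ∧ (fun i => f (s i)) = t := by
    intro a s b t
    have : (fun i => f ((Fin.cons a s : Fin (n + 1) → S) i)) =
        (Fin.cons (f a) fun i => f (s i) : Fin (n + 1) → A) := by
      funext i
      refine Fin.cases ?_ (fun j => ?_) i <;> simp
    rw [this, Fin.cons_inj]
  have hpush : ∀ b t v, push (fun (s : Fin (n + 1) → S) i => f (s i)) P (Fin.cons b t, v) =
      ∑ a, ∑ s : Fin n → S,
        if f a = b ∧ (fun i => f (s i)) = t then P (Fin.cons a s, v) else 0 := by
    intro b t v
    rw [push, sum_cons_eq]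
    simp only [hcons]
  rw [condEntropy_head_add_tail (push_nonneg _ hP)]
  refine add_le_add (le_of_eq ?_) ?_
  · congr 1
    funext ⟨b, v⟩
    refine Eq.trans ?_ (Finset.sum_congr rfl fun t _ => (hpush b t v).symm)
    simp only [push, headLaw]
    rw [Finset.sum_comm]
    refine Finset.sum_congr rfl fun a _ => ?_
    rw [Finset.sum_comm]
    by_cases h : f a = b <;> simp [h]
  · refine (condEntropy_le_of_map (push_nonneg _ fun z => hP _)
      (fun z : V × S => (z.1, f z.2))).trans_eq ?_
    congr 1
    funext ⟨t, v, b⟩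
    refine Eq.trans ?_ (hpush b t v).symm
    simp only [push, Fintype.sum_prod_type, Prod.mk.injEq]
    rw [Finset.sum_eq_single v (fun v' _ hv' => by simp [hv']) (by simp)]
    refine Finset.sum_congr rfl fun a _ => ?_
    by_cases h : f a = b <;> simp [h]

end SingleLetter

section

universe u v

variable {S : Type u} [Fintype S]

/-- Time sharing: a disjoint union of conditioning alphabets reveals which part is active, so the
entropies add. -/
lemma condEntropy_sumElim {A B C : Type*} [Fintype A] [Fintype B] [Fintype C]
    (p : A × (B ⊕ C) → ℝ) :
    condEntropy p = condEntropy (fun z : A × B => p (z.1, Sum.inl z.2)) +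
      condEntropy (fun z : A × C => p (z.1, Sum.inr z.2)) := by
  rw [condEntropy_eq_sum, Fintype.sum_sum_type,
    condEntropy_eq_sum (fun z : A × B => p (z.1, Sum.inl z.2)),
    condEntropy_eq_sum (fun z : A × C => p (z.1, Sum.inr z.2))]

lemma sum_prod_eq_one {S : Type*} [Fintype S] {p : S → ℝ} (hp : p ∈ stdSimplex ℝ S) {n : ℕ} :
    ∑ s : Fin n → S, ∏ i, p (s i) = 1 := by
  rw [← Fintype.sum_pow, hp.2, one_pow]

/-- Single-letterization: an auxiliary variable for a block of `n` independent letters is traded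
for one for a single letter (with mass functions of total mass `n`). -/
lemma exists_single_letter {A B : Type*} [Fintype A] [Fintype B] (f : S → A) (g : S → B)
    {p : S → ℝ} (hp : p ∈ stdSimplex ℝ S) (n : ℕ) :
    ∀ (V : Type u) [Fintype V] (P : (Fin n → S) × V → ℝ), (∀ z, 0 ≤ P z) →
      (∀ s, fstLaw P s = ∏ i, p (s i)) →
      ∃ (ι : Type u) (_ : Fintype ι) (μ : S × ι → ℝ), (∀ z, 0 ≤ μ z) ∧
        (∀ s, fstLaw μ s = n * p s) ∧ condEntropy P ≤ condEntropy μ ∧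
        condEntropy (push f μ) ≤ condEntropy (push (fun (s : Fin n → S) i => f (s i)) P) ∧
        condEntropy (push g μ) ≤ condEntropy (push (fun (s : Fin n → S) i => g (s i)) P) := by
  induction n with
  | zero =>
    intro V _ P hP _
    -- A block of length 0 takes a single value and has entropy 0, so the empty alphabet, of total
    -- mass 0, suffices.
    refine ⟨PEmpty, inferInstance, fun z => z.2.elim, fun z => z.2.elim, fun s => by simp [fstLaw],
      ?_, ?_, ?_⟩
    · rw [condEntropy_eq_sum (fun z : S × PEmpty => _), Finset.univ_eq_empty, Finset.sum_empty,
        condEntropy, neg_nonpos]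
      refine Finset.sum_nonneg fun s _ => Finset.sum_nonneg fun v _ => ?_
      have h : sndLaw P v = P (s, v) := by
        rw [sndLaw, Fintype.sum_unique]
        congr 2
        exact Subsingleton.elim _ _
      rw [h]
      rcases eq_or_ne (P (s, v)) 0 with h0 | h0
      · simp [h0]
      · simp [div_self h0]
    · rw [condEntropy_eq_sum (push f _), Fintype.sum_empty]
      exact condEntropy_nonneg (push_nonneg _ hP)
    · rw [condEntropy_eq_sum (push g _), Fintype.sum_empty]
      exact condEntropy_nonneg (push_nonneg _ hP)
  | succ n ih =>
    intro V _ P hP hmarg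
    have hhead : ∀ s, fstLaw (headLaw P) s = p s := by
      intro s
      simp only [fstLaw, headLaw]
      rw [Finset.sum_comm]
      have : ∀ t : Fin n → S, ∑ v, P (Fin.cons s t, v) = p s * ∏ i, p (t i) := by
        intro t
        have := hmarg (Fin.cons s t)
        rw [Fin.prod_univ_succ] at this
        simpa [fstLaw] using this
      simp only [this, ← Finset.mul_sum]
      rw [sum_prod_eq_one hp, mul_one]
    have htail : ∀ t, fstLaw (tailLaw P) t = ∏ i, p (t i) := by
      intro t
      simp only [fstLaw, tailLaw, Fintype.sum_prod_type]
      rw [Finset.sum_comm]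
      have : ∀ s, ∑ v, P (Fin.cons s t, v) = p s * ∏ i, p (t i) := by
        intro s
        have := hmarg (Fin.cons s t)
        rw [Fin.prod_univ_succ] at this
        simpa [fstLaw] using this
      simp only [this, ← Finset.sum_mul, hp.2, one_mul]
    -- The first letter joins the conditioning variable. Unrolled, the auxiliary variable at time i
    -- is V together with all earlier letters.
    obtain ⟨ι, _, μ, hμ, hμp, h1, h2, h3⟩ := ih (V × S) (tailLaw P) (fun z => hP _) htail
    have hh : ∀ z, 0 ≤ headLaw P z := fun z => Finset.sum_nonneg fun _ _ => hP _
    -- The summand `V` serves the first letter and `ι` the later ones; the tag of the sum acts as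
    -- time index, each time having mass 1.
    refine ⟨V ⊕ ι, inferInstance,
      fun z => Sum.elim (fun v => headLaw P (z.1, v)) (fun i => μ (z.1, i)) z.2, ?_, ?_, ?_, ?_, ?_⟩
    · rintro ⟨s, v | i⟩
      exacts [hh _, hμ _]
    · intro s
      have h4 := hμp s
      have h5 := hhead s
      simp only [fstLaw] at h4 h5 ⊢
      rw [Fintype.sum_sum_type]
      simp only [Sum.elim_inl, Sum.elim_inr, h4, h5]
      push_cast; ring
    · rw [condEntropy_head_add_tail hP, condEntropy_sumElim]
      exact add_le_add le_rfl h1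
    · refine le_trans ?_ (condEntropy_push_head_add_tail_le hP f)
      rw [condEntropy_sumElim]
      exact add_le_add le_rfl h2
    · refine le_trans ?_ (condEntropy_push_head_add_tail_le hP g)
      rw [condEntropy_sumElim]
      exact add_le_add le_rfl h3

end

/-! ### Fano-type bounds -/

section DecodingBound

/-- Joint mass function of `(ω, G ω)`. -/
noncomputable def graphLaw {Ω B : Type*} [DecidableEq B] (G : Ω → B) (P : Ω → ℝ) : Ω × B → ℝ :=
  fun z => if G z.1 = z.2 then P z.1 else 0

lemma graphLaw_nonneg {Ω B : Type*} [DecidableEq B] (G : Ω → B) {P : Ω → ℝ} (hP : ∀ ω, 0 ≤ P ω) (z : Ω × B) :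
    0 ≤ graphLaw G P z := by
  rw [graphLaw]; split_ifs; exacts [hP _, le_rfl]

lemma fstLaw_graphLaw {Ω B : Type*} [Fintype B] [DecidableEq B] (G : Ω → B) (P : Ω → ℝ) : fstLaw (graphLaw G P) = P := by
  funext ω
  simp [fstLaw, graphLaw]

variable {Ω A B W : Type*} [Fintype Ω] [Fintype A] [Fintype B] [Fintype W] [DecidableEq B]

lemma sum_push_graphLaw_mul (F : Ω → A) (G : Ω → B) (P : Ω → ℝ) (Q : A → B → ℝ) :
    ∑ a, ∑ b, push F (graphLaw G P) (a, b) * Q a b = ∑ ω, P ω * Q (F ω) (G ω) := by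
  classical
  simp only [push, graphLaw, Finset.sum_mul, ite_mul, zero_mul]
  calc _ = ∑ a, ∑ ω, ∑ b, (if F ω = a then if G ω = b then P ω * Q a b else 0 else 0) :=
        Finset.sum_congr rfl fun a _ => Finset.sum_comm
    _ = ∑ ω, ∑ a, ∑ b, (if F ω = a then if G ω = b then P ω * Q a b else 0 else 0) :=
        Finset.sum_comm
    _ = _ := by
        refine Finset.sum_congr rfl fun ω _ => ?_
        rw [Finset.sum_eq_single (F ω) (fun a _ ha => by simp [ha.symm]) (by simp)]
        simp

open Classical in
/-- If `F` can be recovered on the event `good` from `G` and a variable `w` with weights `r`, then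
`H(F|G)` is at most the expected description length of `w`, up to a Fano-type correction. -/
lemma condEntropy_le_of_decoder [Nonempty A] (F : Ω → A) (G : Ω → B) {P : Ω → ℝ}
    (hP : P ∈ stdSimplex ℝ Ω) (r : W → ℝ) (hr : ∀ w, 0 ≤ r w) (hr1 : ∑ w, r w ≤ 1)
    (w : Ω → W) (hpos : ∀ ω, 0 < P ω → 0 < r (w ω)) (dec : B → W → A) (good : Ω → Prop)
    (hdec : ∀ ω, good ω → dec (G ω) (w ω) = F ω) :
    condEntropy (push F (graphLaw G P)) ≤ 1 - ∑ ω, P ω * Real.logb 2 (r (w ω)) +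
      (∑ ω, if good ω then 0 else P ω) * Real.logb 2 (Fintype.card A) := by
  have hA : (0 : ℝ) < Fintype.card A := by exact_mod_cast Fintype.card_pos
  -- Comparison law: with probability 1/2 a uniform guess, with probability 1/2 the output of the
  -- decoder on w drawn with weights r. It gives F at least r(w)/2 on the good event and 1/(2|A|)
  -- always; the factor 1/2 is the summand 1 of the bound.
  let Q : A → B → ℝ := fun a b =>
    1 / (2 * Fintype.card A) + 1 / 2 * ∑ u, if dec b u = a then r u else 0
  have hQ0 : ∀ a b, 0 ≤ ∑ u, if dec b u = a then r u else 0 := fun a b =>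
    Finset.sum_nonneg fun u _ => by split_ifs; exacts [hr u, le_rfl]
  have hQpos : ∀ a b, 0 < Q a b := fun a b =>
    add_pos_of_pos_of_nonneg (by positivity) (mul_nonneg (by norm_num) (hQ0 a b))
  have hr_le : ∀ u, r u ≤ 1 := fun u =>
    (Finset.single_le_sum (fun u _ => hr u) (Finset.mem_univ u)).trans hr1
  refine (condEntropy_le_cross (push_nonneg _ (graphLaw_nonneg G hP.1)) Q
    (fun a b => (hQpos a b).le) (fun a b _ => hQpos a b) (fun b => ?_)).trans ?_
  · simp only [Q, Finset.sum_add_distrib, ← Finset.mul_sum]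
    rw [Finset.sum_comm]
    simp only [Finset.sum_ite_eq, Finset.mem_univ, if_true, Finset.sum_const, Finset.card_univ,
      nsmul_eq_mul]
    have : (Fintype.card A : ℝ) * (1 / (2 * Fintype.card A)) = 1 / 2 := by field_simp
    linarith
  · rw [sum_push_graphLaw_mul F G P (fun a b => Real.logb 2 (Q a b))]
    have key : ∀ ω, -(P ω * Real.logb 2 (Q (F ω) (G ω))) ≤
        P ω - P ω * Real.logb 2 (r (w ω)) +
          (if good ω then 0 else P ω) * Real.logb 2 (Fintype.card A) := by
      intro ω
      rcases eq_or_lt_of_le (hP.1 ω) with h | h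
      · simp [← h]
      have hrw := hpos ω h
      by_cases hg : good ω
      · have h1 : r (w ω) / 2 ≤ Q (F ω) (G ω) := by
          have := Finset.single_le_sum (f := fun u => if dec (G ω) u = F ω then r u else 0)
            (fun u _ => by split_ifs; exacts [hr u, le_rfl]) (Finset.mem_univ (w ω))
          simp only [hdec ω hg, if_true] at this
          have h2 : 0 ≤ 1 / (2 * (Fintype.card A : ℝ)) := by positivity
          simp only [Q]; linarith
        have h2 := Real.logb_le_logb_of_le (b := 2) (by norm_num) (by positivity) h1
        rw [Real.logb_div hrw.ne' (by norm_num), Real.logb_self_eq_one (by norm_num)] at h2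
        simp only [hg, if_true, zero_mul, add_zero]
        nlinarith
      · have h1 : 1 / (2 * (Fintype.card A : ℝ)) ≤ Q (F ω) (G ω) :=
          le_add_of_nonneg_right (mul_nonneg (by norm_num) (hQ0 _ _))
        have h2 := Real.logb_le_logb_of_le (b := 2) (by norm_num) (by positivity) h1
        rw [one_div, Real.logb_inv, Real.logb_mul (by norm_num) hA.ne',
          Real.logb_self_eq_one (by norm_num)] at h2
        have h3 : Real.logb 2 (r (w ω)) ≤ 0 := Real.logb_nonpos (by norm_num) (hr _) (hr_le _)
        simp only [hg, if_false]
        nlinarith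
    have := Finset.sum_le_sum fun ω (_ : ω ∈ Finset.univ) => key ω
    rw [Finset.sum_neg_distrib, Finset.sum_add_distrib, Finset.sum_sub_distrib, hP.2,
      ← Finset.sum_mul] at this
    exact this

/-- H(ω,G) = H(ω), as G is a function of ω, and H(G) ≤ log |B|. In the converse G is the common
message, and this becomes R₀ ≥ I(X,Y;U). -/
lemma sub_logb_card_le_condEntropy_graphLaw (G : Ω → B) {P : Ω → ℝ} (hP : P ∈ stdSimplex ℝ Ω) :
    entropy P - Real.logb 2 (Fintype.card B) ≤ condEntropy (graphLaw G P) := by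
  rw [condEntropy_eq_sub (graphLaw_nonneg G hP.1)]
  have h1 : entropy (graphLaw G P) = entropy P := by
    simp only [entropy, Fintype.sum_prod_type]
    congr 1
    refine Finset.sum_congr rfl fun ω _ => ?_
    rw [Finset.sum_eq_single (G ω) (fun b _ hb => by simp [graphLaw, hb.symm]) (by simp)]
    simp [graphLaw]
  have h2 : sndLaw (graphLaw G P) ∈ stdSimplex ℝ B := by
    refine ⟨fun b => sndLaw_nonneg (graphLaw_nonneg G hP.1) b, ?_⟩
    simp only [sndLaw]
    rw [Finset.sum_comm, ← hP.2]
    exact Finset.sum_congr rfl fun ω _ => congrFun (fstLaw_graphLaw G P) ω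
  have := entropy_le_logb_card h2 le_rfl
  linarith

end DecodingBound

/-! ### Entropies of i.i.d. blocks -/

section IID

variable {S A B : Type*} [Fintype S] [Fintype A] [Fintype B]

lemma prod_mem_stdSimplex {p : S → ℝ} (hp : p ∈ stdSimplex ℝ S) (n : ℕ) :
    (fun s : Fin n → S => ∏ i, p (s i)) ∈ stdSimplex ℝ (Fin n → S) :=
  ⟨fun _ => Finset.prod_nonneg fun _ _ => hp.1 _, sum_prod_eq_one hp⟩

lemma sum_prod_mul_sum {p : S → ℝ} (hp : p ∈ stdSimplex ℝ S) (g : S → ℝ) (n : ℕ) :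
    ∑ s : Fin n → S, (∏ i, p (s i)) * ∑ i, g (s i) = n * ∑ a, p a * g a := by
  induction n with
  | zero => simp
  | succ n ih =>
    rw [sum_cons_eq]
    simp only [Fin.prod_univ_succ, Fin.sum_univ_succ, Fin.cons_zero, Fin.cons_succ]
    have h : ∀ a, ∑ s : Fin n → S, (p a * ∏ i, p (s i)) * (g a + ∑ i, g (s i)) =
        p a * g a + p a * (n * ∑ a, p a * g a) := by
      intro a
      rw [← ih, ← mul_one (p a * g a), ← sum_prod_eq_one hp (n := n), Finset.mul_sum,
        Finset.mul_sum, ← Finset.sum_add_distrib]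
      exact Finset.sum_congr rfl fun s _ => by ring
    simp only [h, Finset.sum_add_distrib, ← Finset.sum_mul, hp.2]
    push_cast; ring

lemma sum_prod_mul_logb_prod {p : S → ℝ} (hp : p ∈ stdSimplex ℝ S) (g : S → ℝ)
    (hg : ∀ a, 0 < p a → g a ≠ 0) (n : ℕ) :
    ∑ s : Fin n → S, (∏ i, p (s i)) * Real.logb 2 (∏ i, g (s i)) =
      n * ∑ a, p a * Real.logb 2 (g a) := by
  rw [← sum_prod_mul_sum hp]
  refine Finset.sum_congr rfl fun s _ => ?_
  by_cases h : ∃ i, p (s i) = 0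
  · obtain ⟨i, hi⟩ := h
    rw [Finset.prod_eq_zero (Finset.mem_univ i) hi, zero_mul, zero_mul]
  · push Not at h
    rw [Real.logb_prod Finset.univ _ fun i _ => hg _ (lt_of_le_of_ne (hp.1 _) (h i).symm)]

lemma sum_arrow_prod {n : ℕ} (F : (Fin n → A × B) → ℝ) :
    ∑ s, F s = ∑ a : Fin n → A, ∑ b : Fin n → B, F fun i => (a i, b i) := by
  rw [← Fintype.sum_prod_type']
  exact Fintype.sum_equiv (Equiv.arrowProdEquivProdArrow (Fin n) _ _) _ _ fun _ => rfl

lemma condEntropy_iid {p : A × B → ℝ} (hp : p ∈ stdSimplex ℝ (A × B)) (n : ℕ) :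
    condEntropy (fun z : (Fin n → A) × (Fin n → B) => ∏ i, p (z.1 i, z.2 i)) =
      n * condEntropy p := by
  have hsnd : ∀ b : Fin n → B,
      sndLaw (fun z : (Fin n → A) × (Fin n → B) => ∏ i, p (z.1 i, z.2 i)) b =
        ∏ i, sndLaw p (b i) := by
    intro b
    simp only [sndLaw]
    rw [Fintype.prod_sum]
  have h := sum_prod_mul_logb_prod hp (fun s => p s / sndLaw p s.2)
    (fun s hs => (div_pos hs (hs.trans_le (le_sndLaw hp.1 s.1 s.2))).ne') n
  rw [sum_arrow_prod, Fintype.sum_prod_type (f := fun a => p a * _)] at h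
  simp only [condEntropy, hsnd, ← Finset.prod_div_distrib] 
  rw [mul_neg, ← h]

lemma push_fst_graphLaw_snd [DecidableEq B] (p : A × B → ℝ) (n : ℕ) :
    push (fun (s : Fin n → A × B) i => (s i).1)
      (graphLaw (fun s i => (s i).2) fun s => ∏ i, p (s i)) =
      fun z => ∏ i, p (z.1 i, z.2 i) := by
  classical
  funext ⟨a, b⟩
  simp only [push, graphLaw]
  rw [sum_arrow_prod]
  rw [Finset.sum_eq_single a (fun a' _ ha => by simp [ha]) (by simp)]
  simp

lemma push_snd_graphLaw_fst [DecidableEq A] (p : A × B → ℝ) (n : ℕ) :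
    push (fun (s : Fin n → A × B) i => (s i).2)
      (graphLaw (fun s i => (s i).1) fun s => ∏ i, p (s i)) =
      fun z => ∏ i, (p ∘ Prod.swap) (z.1 i, z.2 i) := by
  classical
  funext ⟨b, a⟩
  simp only [push, graphLaw]
  rw [sum_arrow_prod]
  rw [Finset.sum_eq_single a (fun a' _ ha => by simp [ha]) (by simp)]
  simp

lemma entropy_iid {p : S → ℝ} (hp : p ∈ stdSimplex ℝ S) (n : ℕ) :
    entropy (fun s : Fin n → S => ∏ i, p (s i)) = n * entropy p := by
  have h := sum_prod_mul_logb_prod hp p (fun s hs => hs.ne') n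
  simp only [entropy]
  rw [mul_neg, ← h]

/-- Conditioning on a constant lets the bounds on H(X,Y) come from the same decoder lemma as the
conditional ones. -/
lemma condEntropy_push_id_const [DecidableEq B] {P : S → ℝ}
    (hP : P ∈ stdSimplex ℝ S) (b : B) :
    condEntropy (push id (graphLaw (fun _ => b) P)) = entropy P := by
  have h1 : push id (graphLaw (fun _ => b) P) = graphLaw (fun _ => b) P := by
    classical
    funext ⟨s, c⟩
    simp only [push, id]
    rw [Finset.sum_eq_single s (fun t _ ht => by simp [ht]) (by simp)]
    simp
  have h2 : ∀ c, sndLaw (graphLaw (fun _ : S => b) P) c = if b = c then 1 else 0 := by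
    intro c
    rw [← hP.2]
    simp only [sndLaw, graphLaw]
    split_ifs <;> simp
  simp only [h1, condEntropy, h2, entropy]
  congr 1
  refine Finset.sum_congr rfl fun s _ => ?_
  rw [Finset.sum_eq_single b (fun c _ hc => by simp [graphLaw, hc.symm]) (by simp)]
  simp [graphLaw]

end IID

/-! ### The single-letter region and its closedness -/

section Region

variable {𝒳 𝒴 : Type*} [Fintype 𝒳] [Fintype 𝒴]

/-- The constraints on the rates for an auxiliary variable `U` with `I(X,Y;U) = i`, `H(X|U) = a`
and `H(Y|U) = b`. -/
def RateConstraints (p : 𝒳 × 𝒴 → ℝ) (i a b : ℝ) (R : Fin 5 → ℝ) : Prop :=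
  R 0 ≥ i ∧ R 1 ≥ a ∧ R 2 ≥ b ∧ R 3 ≥ a - entropy (sndLaw p) ∧ R 4 ≥ b - entropy (fstLaw p) ∧
  R 0 + R 3 ≥ condEntropy p ∧ R 0 + R 4 ≥ condEntropy (p ∘ Prod.swap) ∧
  R 2 + R 3 ≥ a ∧ R 1 + R 4 ≥ b ∧ R 0 + R 2 + R 3 ≥ entropy p ∧ R 0 + R 1 + R 4 ≥ entropy p

/-- The single-letter rate region. -/
def singleLetterRegion (p : 𝒳 × 𝒴 → ℝ) : Set (Fin 5 → ℝ) :=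
  {R | (∀ i, 0 ≤ R i) ∧ ∃ (k : ℕ) (q : 𝒳 × 𝒴 → Fin k → ℝ),
    k ≤ Fintype.card 𝒳 * Fintype.card 𝒴 + 2 ∧ (∀ s, q s ∈ stdSimplex ℝ (Fin k)) ∧
    RateConstraints p (mutualInfo (lawXYU p q)) (condEntropy (lawXU p q))
      (condEntropy (lawYU p q)) R}

lemma lawXYU_nonneg {𝒳 𝒴 ι : Type*} [Fintype ι] {p : 𝒳 × 𝒴 → ℝ} {q : 𝒳 × 𝒴 → ι → ℝ}
    (hp : ∀ s, 0 ≤ p s) (hq : ∀ s, q s ∈ stdSimplex ℝ ι) (z) :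
    0 ≤ lawXYU p q z := mul_nonneg (hp _) ((hq _).1 _)

lemma lawXU_nonneg {𝒳 𝒴 ι : Type*} [Fintype 𝒴] [Fintype ι] {p : 𝒳 × 𝒴 → ℝ}
    {q : 𝒳 × 𝒴 → ι → ℝ} (hp : ∀ s, 0 ≤ p s) (hq : ∀ s, q s ∈ stdSimplex ℝ ι) (z) :
    0 ≤ lawXU p q z := Finset.sum_nonneg fun _ _ => lawXYU_nonneg hp hq _

lemma lawYU_nonneg {𝒳 𝒴 ι : Type*} [Fintype 𝒳] [Fintype ι] {p : 𝒳 × 𝒴 → ℝ}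
    {q : 𝒳 × 𝒴 → ι → ℝ} (hp : ∀ s, 0 ≤ p s) (hq : ∀ s, q s ∈ stdSimplex ℝ ι) (z) :
    0 ≤ lawYU p q z := Finset.sum_nonneg fun _ _ => lawXYU_nonneg hp hq _

lemma fstLaw_lawXYU {𝒳 𝒴 ι : Type*} [Fintype ι] {p : 𝒳 × 𝒴 → ℝ} {q : 𝒳 × 𝒴 → ι → ℝ}
    (hq : ∀ s, q s ∈ stdSimplex ℝ ι) : fstLaw (lawXYU p q) = p := by
  funext s
  simp only [fstLaw, lawXYU]
  rw [← Finset.mul_sum, (hq s).2, mul_one]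

variable {ι : Type*} [Fintype ι] {p : 𝒳 × 𝒴 → ℝ} {q : 𝒳 × 𝒴 → ι → ℝ}

lemma mutualInfo_lawXYU (hp : ∀ s, 0 ≤ p s) (hq : ∀ s, q s ∈ stdSimplex ℝ ι) :
    mutualInfo (lawXYU p q) = entropy p - condEntropy (lawXYU p q) := by
  have h := lawXYU_nonneg hp hq
  rw [mutualInfo_eq h, condEntropy_eq_sub h, fstLaw_lawXYU hq]
  ring

lemma continuous_entropy {α : Type*} [Fintype α] : Continuous (entropy : (α → ℝ) → ℝ) := by
  have h : Continuous fun x : ℝ => x * Real.logb 2 x := by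
    have : (fun x : ℝ => x * Real.logb 2 x) = fun x => x * Real.log x / Real.log 2 := by
      funext x; rw [Real.logb]; ring
    rw [this]
    exact Real.continuous_mul_log.div_const _
  exact (continuous_finsetSum _ fun a _ => h.comp (continuous_apply a)).neg

/-- The quotient in `condEntropy` hides continuity at the zeros of the marginal; as a difference of
entropies it reduces to continuity of t log t. -/
lemma continuous_condEntropy {T α β : Type*} [TopologicalSpace T] [Fintype α] [Fintype β]
    {f : T → α × β → ℝ} (hf : Continuous f) (h0 : ∀ t z, 0 ≤ f t z) :
    Continuous fun t => condEntropy (f t) := by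
  have : (fun t => condEntropy (f t)) = fun t => entropy (f t) - entropy (sndLaw (f t)) :=
    funext fun t => condEntropy_eq_sub (h0 t)
  rw [this]
  refine (continuous_entropy.comp hf).sub (continuous_entropy.comp ?_)
  refine continuous_pi fun b => ?_
  exact continuous_finsetSum _ fun a _ => (continuous_apply (a, b)).comp hf

/-- For each k the constraints are closed in rates and kernels jointly, and projecting away the
compact space of kernels keeps them closed. The bound on the alphabet makes the union over k finite.
-/
lemma isClosed_singleLetterRegion {p : 𝒳 × 𝒴 → ℝ} (hp : p ∈ stdSimplex ℝ (𝒳 × 𝒴)) :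
    IsClosed (singleLetterRegion p) := by
  let C : ℕ → Type _ := fun k => {q : 𝒳 × 𝒴 → Fin k → ℝ // ∀ s, q s ∈ stdSimplex ℝ (Fin k)}
  have hC : ∀ k, CompactSpace (C k) := fun k => by
    have : IsCompact {q : 𝒳 × 𝒴 → Fin k → ℝ | ∀ s, q s ∈ stdSimplex ℝ (Fin k)} := by
      have h := isCompact_univ_pi fun _ : 𝒳 × 𝒴 => isCompact_stdSimplex ℝ (Fin k)
      simpa [Set.pi] using h
    exact isCompact_iff_compactSpace.mp this
  have hclosed : ∀ k, IsClosed {x : (Fin 5 → ℝ) × C k |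
      RateConstraints p (mutualInfo (lawXYU p x.2.1)) (condEntropy (lawXU p x.2.1))
        (condEntropy (lawYU p x.2.1)) x.1} := by
    intro k
    have hq : Continuous fun q : C k => lawXYU p q.1 := by
      refine continuous_pi fun z => ?_
      exact continuous_const.mul
        ((continuous_apply z.2).comp ((continuous_apply z.1).comp continuous_subtype_val))
    have h1 : Continuous fun x : (Fin 5 → ℝ) × C k => mutualInfo (lawXYU p x.2.1) := by
      have : (fun x : (Fin 5 → ℝ) × C k => mutualInfo (lawXYU p x.2.1)) =
          fun x => entropy p - condEntropy (lawXYU p x.2.1) :=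
        funext fun x => mutualInfo_lawXYU hp.1 x.2.2
      rw [this]
      exact continuous_const.sub
        ((continuous_condEntropy hq fun q => lawXYU_nonneg hp.1 q.2).comp continuous_snd)
    have h2 : Continuous fun x : (Fin 5 → ℝ) × C k => condEntropy (lawXU p x.2.1) := by
      refine (continuous_condEntropy (f := fun q : C k => lawXU p q.1) ?_
        fun q => lawXU_nonneg hp.1 q.2).comp continuous_snd
      exact continuous_pi fun z => continuous_finsetSum _ fun y _ => (continuous_apply _).comp hq
    have h3 : Continuous fun x : (Fin 5 → ℝ) × C k => condEntropy (lawYU p x.2.1) := by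
      refine (continuous_condEntropy (f := fun q : C k => lawYU p q.1) ?_
        fun q => lawYU_nonneg hp.1 q.2).comp continuous_snd
      exact continuous_pi fun z => continuous_finsetSum _ fun y _ => (continuous_apply _).comp hq
    have hR : ∀ i : Fin 5, Continuous fun x : (Fin 5 → ℝ) × C k => x.1 i := fun i =>
      (continuous_apply i).comp continuous_fst
    unfold RateConstraints
    simp only [ge_iff_le, Set.ofPred_and]
    exact (isClosed_le h1 (hR 0)).inter <| (isClosed_le h2 (hR 1)).inter <|
      (isClosed_le h3 (hR 2)).inter <|
      (isClosed_le (h2.sub continuous_const) (hR 3)).inter <|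
      (isClosed_le (h3.sub continuous_const) (hR 4)).inter <|
      (isClosed_le continuous_const ((hR 0).add (hR 3))).inter <|
      (isClosed_le continuous_const ((hR 0).add (hR 4))).inter <|
      (isClosed_le h2 ((hR 2).add (hR 3))).inter <|
      (isClosed_le h3 ((hR 1).add (hR 4))).inter <|
      (isClosed_le continuous_const (((hR 0).add (hR 2)).add (hR 3))).inter <|
      isClosed_le continuous_const (((hR 0).add (hR 1)).add (hR 4))
  have hrw : singleLetterRegion p = (⋂ i, {R : Fin 5 → ℝ | 0 ≤ R i}) ∩
      ⋃ k ∈ Set.Iic (Fintype.card 𝒳 * Fintype.card 𝒴 + 2), Prod.fst '' {x : (Fin 5 → ℝ) × C k |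
        RateConstraints p (mutualInfo (lawXYU p x.2.1)) (condEntropy (lawXU p x.2.1))
          (condEntropy (lawYU p x.2.1)) x.1} := by
    ext R
    simp only [singleLetterRegion, Set.mem_ofPred_eq, Set.mem_inter_iff, Set.mem_iInter,
      Set.mem_iUnion, Set.mem_image, Set.mem_Iic, exists_prop]
    refine and_congr_right fun _ => ⟨?_, ?_⟩
    · rintro ⟨k, q, hk, hq, h⟩
      exact ⟨k, hk, (R, ⟨q, hq⟩), h, rfl⟩
    · rintro ⟨k, hk, ⟨R', q⟩, h, rfl⟩
      exact ⟨k, q.1, hk, q.2, h⟩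
  rw [hrw]
  refine IsClosed.inter (isClosed_iInter fun i => isClosed_le continuous_const (continuous_apply i))
    ?_
  exact (Set.finite_Iic _).isClosed_biUnion fun k _ => by
    have := hC k
    exact isClosedMap_fst_of_compactSpace _ (hclosed k)

end Region

/-! ### Ingredients of the converse -/

section Converse

lemma condEntropy_le_of_decoder_uniform {Ω A B W : Type*} [Fintype Ω] [Fintype A] [Fintype B]
    [Fintype W] [DecidableEq B] [Nonempty A] (F : Ω → A) (G : Ω → B) {P : Ω → ℝ}
    (hP : P ∈ stdSimplex ℝ Ω) (w : Ω → W) (dec : B → W → A) (good : Ω → Prop) [DecidablePred good]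
    (hdec : ∀ ω, good ω → dec (G ω) (w ω) = F ω) :
    condEntropy (push F (graphLaw G P)) ≤ 1 + Real.logb 2 (Fintype.card W) +
      (∑ ω, if good ω then 0 else P ω) * Real.logb 2 (Fintype.card A) := by
  have hne : Nonempty W := by
    by_contra h
    have hΩ : IsEmpty Ω := ⟨fun ω => h ⟨w ω⟩⟩
    have := hP.2
    simp at this
  have hW : (0 : ℝ) < Fintype.card W := by exact_mod_cast Fintype.card_pos
  have := condEntropy_le_of_decoder F G hP (fun _ : W => 1 / (Fintype.card W : ℝ))
    (fun _ => by positivity) (by simp) w (fun _ _ => by positivity) dec good hdec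
  rw [← Finset.sum_mul, hP.2, one_div, Real.logb_inv] at this
  convert this using 2
  · ring
  · congr 1
    exact Finset.sum_congr rfl fun ω _ => by congr

lemma nonneg_of_index_nonempty {n : ℕ} (hn : 0 < n) {r : ℝ} (m : Index n r) : 0 ≤ r := by
  by_contra h
  push Not at h
  have h1 : (2 : ℝ) ^ ((n : ℝ) * r) < 1 :=
    Real.rpow_lt_one_of_one_lt_of_neg (by norm_num) (mul_neg_of_pos_of_neg (by positivity) h)
  have h2 : ⌊(2 : ℝ) ^ ((n : ℝ) * r)⌋₊ = 0 := Nat.floor_eq_zero.mpr h1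
  exact absurd m.2 (by omega)

lemma logb_card_index_le {n : ℕ} {r : ℝ} (m : Index n r) :
    Real.logb 2 (Fintype.card (Index n r)) ≤ n * r := by
  have h : (0 : ℝ) < Fintype.card (Index n r) := by
    have : Nonempty (Index n r) := ⟨m⟩
    exact_mod_cast Fintype.card_pos
  rw [Real.logb_le_iff_le_rpow (by norm_num) h, Fintype.card_fin]
  exact Nat.floor_le (by positivity)

lemma logb_card_arrow (A : Type*) [Fintype A] (n : ℕ) :
    Real.logb 2 (Fintype.card (Fin n → A)) = n * Real.logb 2 (Fintype.card A) := by
  rw [Fintype.card_fun, Fintype.card_fin]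
  push_cast
  rw [Real.logb_pow]

lemma Code.errorProb_eq {𝒳 𝒴 : Type*} [Fintype 𝒳] [Fintype 𝒴] (p : 𝒳 × 𝒴 → ℝ) {n : ℕ}
    {R : Fin 5 → ℝ} (c : Code 𝒳 𝒴 n R)
    [DecidablePred fun s : Fin n → 𝒳 × 𝒴 => c.Correct (fun i => (s i).1) (fun i => (s i).2)] :
    c.errorProb p = ∑ s : Fin n → 𝒳 × 𝒴,
      if c.Correct (fun i => (s i).1) (fun i => (s i).2) then 0 else ∏ i, p (s i) := by
  rw [sum_arrow_prod, Code.errorProb]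
  exact Finset.sum_congr rfl fun x _ => Finset.sum_congr rfl fun y _ => by congr

lemma condEntropy_push_comp_equiv {Ω A V V' : Type*} [Fintype Ω] [Fintype A] [Fintype V]
    [Fintype V'] (e : V' ≃ V) (F : Ω → A) (P : Ω × V → ℝ) :
    condEntropy (push F fun z : Ω × V' => P (z.1, e z.2)) = condEntropy (push F P) :=
  condEntropy_comp_equiv e (push F P)

universe u v

variable {𝒳 : Type u} {𝒴 : Type v} [Fintype 𝒳] [Fintype 𝒴]

/-- From entropies conditioned on the common message to a single-letter auxiliary variable. -/
lemma exists_aux_of_block {p : 𝒳 × 𝒴 → ℝ} (hp : p ∈ stdSimplex ℝ (𝒳 × 𝒴)) {n : ℕ} (hn : 0 < n)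
    {B : Type} [Fintype B] [DecidableEq B] (G : (Fin n → 𝒳 × 𝒴) → B) :
    ∃ (k : ℕ) (q : 𝒳 × 𝒴 → Fin k → ℝ), k ≤ Fintype.card 𝒳 * Fintype.card 𝒴 + 2 ∧
      (∀ s, q s ∈ stdSimplex ℝ (Fin k)) ∧
      n * mutualInfo (lawXYU p q) ≤ Real.logb 2 (Fintype.card B) ∧
      n * condEntropy (lawXU p q) ≤
        condEntropy (push (fun s i => (s i).1) (graphLaw G fun s => ∏ i, p (s i))) ∧
      n * condEntropy (lawYU p q) ≤
        condEntropy (push (fun s i => (s i).2) (graphLaw G fun s => ∏ i, p (s i))) := by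
  classical
  have hPn := prod_mem_stdSimplex hp n
  generalize hPn' : (fun s : Fin n → 𝒳 × 𝒴 => ∏ i, p (s i)) = Pn at hPn ⊢
  -- `exists_single_letter` wants the message alphabet in the universe of the letters.
  let P : (Fin n → 𝒳 × 𝒴) × ULift.{max u v} B → ℝ := fun z => graphLaw G Pn (z.1, Equiv.ulift z.2)
  obtain ⟨ι, _, μ, hμ, hμp, h1, h2, h3⟩ := exists_single_letter (Prod.fst : 𝒳 × 𝒴 → 𝒳) Prod.snd hp
    n (ULift.{max u v} B) P (fun z => graphLaw_nonneg G hPn.1 _) (fun s => by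
      rw [← show Pn s = ∏ i, p (s i) from hPn' ▸ rfl, ← fstLaw_graphLaw G Pn]
      exact Fintype.sum_equiv Equiv.ulift _ _ fun _ => rfl)
  have hn' : (0 : ℝ) < n := by exact_mod_cast hn
  have e1 : condEntropy P = condEntropy (graphLaw G Pn) :=
    condEntropy_comp_equiv Equiv.ulift (graphLaw G Pn)
  have e2 := condEntropy_push_comp_equiv Equiv.ulift.{max u v}
    (fun (s : Fin n → 𝒳 × 𝒴) i => (s i).1) (graphLaw G Pn)
  have e3 := condEntropy_push_comp_equiv Equiv.ulift.{max u v}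
    (fun (s : Fin n → 𝒳 × 𝒴) i => (s i).2) (graphLaw G Pn)
  have e4 : push Prod.fst μ = margXU μ := by
    funext ⟨x, i⟩
    simp only [push, margXU, Fintype.sum_prod_type]
    rw [Finset.sum_eq_single x (fun a _ ha => by simp [ha]) (by simp)]
    simp
  have e5 : push Prod.snd μ = margYU μ := by
    funext ⟨x, i⟩
    simp only [push, margYU, Fintype.sum_prod_type_right]
    rw [Finset.sum_eq_single x (fun a _ ha => by simp [ha]) (by simp)]
    simp
  -- Dividing the mass n by n makes the time index uniform and restores the marginal p.
  obtain ⟨k, q, hk, hq, g1, g2, g3⟩ := exists_small_alphabet hp (fun z => (n : ℝ)⁻¹ * μ z)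
    (fun z => mul_nonneg (by positivity) (hμ z)) (by
      funext s
      have := hμp s
      simp only [fstLaw] at this ⊢
      rw [← Finset.mul_sum, this, inv_mul_cancel_left₀ hn'.ne'])
  have e6 : margXU (fun z => (n : ℝ)⁻¹ * μ z) = fun z => (n : ℝ)⁻¹ * margXU μ z := by
    funext z; simp only [margXU, Finset.mul_sum]
  have e7 : margYU (fun z => (n : ℝ)⁻¹ * μ z) = fun z => (n : ℝ)⁻¹ * margYU μ z := by
    funext z; simp only [margYU, Finset.mul_sum]
  rw [condEntropy_smul] at g1
  rw [e6, condEntropy_smul] at g2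
  rw [e7, condEntropy_smul] at g3
  -- With this, n H(X,Y|U) ≥ H(Sⁿ|G) ≥ n H(X,Y) - log |B|, which is the bound on n I(X,Y;U).
  have hle := sub_logb_card_le_condEntropy_graphLaw G hPn
  rw [← hPn', entropy_iid hp, hPn'] at hle
  refine ⟨k, q, hk, hq, ?_, ?_, ?_⟩
  · rw [mutualInfo_lawXYU hp.1 hq, g1, mul_sub, mul_inv_cancel_left₀ hn'.ne']
    linarith
  · refine (mul_le_mul_of_nonneg_left g2 hn'.le).trans ?_
    rw [mul_inv_cancel_left₀ hn'.ne', ← e4, ← e2]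
    exact h2
  · rw [g3, mul_inv_cancel_left₀ hn'.ne', ← e5, ← e3]
    exact h3

variable {p : 𝒳 × 𝒴 → ℝ}

lemma sndLaw_mem_stdSimplex (hp : p ∈ stdSimplex ℝ (𝒳 × 𝒴)) : sndLaw p ∈ stdSimplex ℝ 𝒴 := by
  refine ⟨sndLaw_nonneg hp.1, ?_⟩
  rw [← hp.2, Fintype.sum_prod_type_right]
  rfl

lemma fstLaw_mem_stdSimplex (hp : p ∈ stdSimplex ℝ (𝒳 × 𝒴)) : fstLaw p ∈ stdSimplex ℝ 𝒳 := by
  refine ⟨fstLaw_nonneg hp.1, ?_⟩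
  rw [← hp.2, Fintype.sum_prod_type]
  rfl

lemma sum_prod_mul_logb_sndLaw (hp : p ∈ stdSimplex ℝ (𝒳 × 𝒴)) (n : ℕ) :
    ∑ s : Fin n → 𝒳 × 𝒴, (∏ i, p (s i)) * Real.logb 2 (∏ i, sndLaw p (s i).2) =
      -(n * entropy (sndLaw p)) := by
  rw [sum_prod_mul_logb_prod hp (fun s => sndLaw p s.2)
    (fun s hs => (hs.trans_le (le_sndLaw hp.1 s.1 s.2)).ne'), entropy, Fintype.sum_prod_type_right,
    mul_neg, neg_neg]
  congr 1
  exact Finset.sum_congr rfl fun y _ => (Finset.sum_mul Finset.univ (fun x => p (x, y))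
    (Real.logb 2 (sndLaw p y))).symm

lemma sum_prod_mul_logb_fstLaw (hp : p ∈ stdSimplex ℝ (𝒳 × 𝒴)) (n : ℕ) :
    ∑ s : Fin n → 𝒳 × 𝒴, (∏ i, p (s i)) * Real.logb 2 (∏ i, fstLaw p (s i).1) =
      -(n * entropy (fstLaw p)) := by
  rw [sum_prod_mul_logb_prod hp (fun s => fstLaw p s.1)
    (fun s hs => (hs.trans_le (le_fstLaw hp.1 s.1 s.2)).ne'), entropy, Fintype.sum_prod_type,
    mul_neg, neg_neg]
  congr 1
  exact Finset.sum_congr rfl fun x _ => (Finset.sum_mul Finset.univ (fun y => p (x, y))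
    (Real.logb 2 (fstLaw p x))).symm

/-- A bound on a conditional entropy when the decoder also uses a sequence with i.i.d. law `m`. -/
lemma condEntropy_le_of_decoder_side {A B W C S : Type*} [Fintype A] [Fintype B] [Fintype S]
    [Fintype W] [Fintype C] [DecidableEq B] [Nonempty A] {n : ℕ} {p : S → ℝ}
    (hp : p ∈ stdSimplex ℝ S) {m : C → ℝ} (hm : m ∈ stdSimplex ℝ C) (f : S → C)
    (hfm : ∀ s, 0 < p s → 0 < m (f s)) (F : (Fin n → S) → A) (G : (Fin n → S) → B)
    (w : (Fin n → S) → W) (dec : B → W → (Fin n → C) → A) (good : (Fin n → S) → Prop)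
    [DecidablePred good] (hdec : ∀ s, good s → dec (G s) (w s) (fun i => f (s i)) = F s) :
    condEntropy (push F (graphLaw G fun s => ∏ i, p (s i))) ≤
      1 + Real.logb 2 (Fintype.card W)
        - ∑ s : Fin n → S, (∏ i, p (s i)) * Real.logb 2 (∏ i, m (f (s i))) +
      (∑ s : Fin n → S, if good s then 0 else ∏ i, p (s i)) * Real.logb 2 (Fintype.card A) := by
  have hP := prod_mem_stdSimplex hp n
  have hne : Nonempty W := by
    by_contra h
    have hΩ : IsEmpty (Fin n → S) := ⟨fun ω => h ⟨w ω⟩⟩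
    have := hP.2
    simp at this
  have hW : (0 : ℝ) < Fintype.card W := by exact_mod_cast Fintype.card_pos
  have hpos : ∀ s : Fin n → S, 0 < ∏ i, p (s i) → 0 < ∏ i, m (f (s i)) := by
    intro s hs
    refine Finset.prod_pos fun i _ => hfm _ (lt_of_le_of_ne (hp.1 _) fun h => ?_)
    rw [Finset.prod_eq_zero (Finset.mem_univ i) h.symm] at hs
    exact lt_irrefl _ hs
  -- The side sequence is made part of the description, with its i.i.d. weight, next to a uniform
  -- message. It then costs its own cross entropy; in the application this is the H(Y) subtracted
  -- from H(X|U) in the bound on R₃, or the H(X) in that on R₄.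
  have := condEntropy_le_of_decoder F G hP
    (fun z : W × (Fin n → C) => 1 / (Fintype.card W : ℝ) * ∏ i, m (z.2 i))
    (fun z => mul_nonneg (by positivity) (Finset.prod_nonneg fun i _ => hm.1 _)) (by
      rw [Fintype.sum_prod_type]
      simp only [← Finset.mul_sum, sum_prod_eq_one hm]
      simp) (fun s => (w s, fun i => f (s i)))
    (fun s hs => mul_pos (by positivity) (hpos s hs)) (fun b z => dec b z.1 z.2) good hdec
  refine this.trans (le_of_eq ?_)
  have h1 : ∀ s : Fin n → S, (∏ i, p (s i)) *
      Real.logb 2 (1 / (Fintype.card W : ℝ) * ∏ i, m (f (s i))) =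
      (∏ i, p (s i)) * Real.logb 2 (∏ i, m (f (s i)))
        - (∏ i, p (s i)) * Real.logb 2 (Fintype.card W) := by
    intro s
    rcases eq_or_lt_of_le (hP.1 s) with h | h
    · simp only at h; simp [← h]
    · rw [Real.logb_mul (by positivity) (hpos s h).ne', one_div, Real.logb_inv]; ring
  simp only [h1]
  rw [Finset.sum_sub_distrib, ← Finset.sum_mul, hP.2]
  congr 1
  · ring
  · congr 1
    exact Finset.sum_congr rfl fun ω _ => by congr

end Converse

/-! ### The converse -/

section Converse

variable {𝒳 𝒴 : Type*} [Fintype 𝒳] [Fintype 𝒴] {p : 𝒳 × 𝒴 → ℝ}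

lemma nonempty_of_mem_stdSimplex {S : Type*} [Fintype S] {p : S → ℝ} (hp : p ∈ stdSimplex ℝ S) :
    Nonempty S := by
  by_contra h
  rw [not_nonempty_iff] at h
  simpa using hp.2

lemma swap_mem_stdSimplex (hp : p ∈ stdSimplex ℝ (𝒳 × 𝒴)) :
    p ∘ Prod.swap ∈ stdSimplex ℝ (𝒴 × 𝒳) :=
  ⟨fun _ => hp.1 _, by
    rw [← hp.2]
    exact Fintype.sum_equiv (Equiv.prodComm 𝒴 𝒳) _ _ fun _ => rfl⟩

/-- The converse for a fixed block length. -/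
lemma Code.add_mem_singleLetterRegion (hp : p ∈ stdSimplex ℝ (𝒳 × 𝒴)) {n : ℕ} (hn : 0 < n)
    {R : Fin 5 → ℝ} (c : Code 𝒳 𝒴 n R) :
    (fun i => R i + (1 / n + c.errorProb p * (Real.logb 2 (Fintype.card 𝒳) +
      Real.logb 2 (Fintype.card 𝒴)))) ∈ singleLetterRegion p := by
  classical
  obtain ⟨x0, y0⟩ := nonempty_of_mem_stdSimplex hp
  have hX : Nonempty 𝒳 := ⟨x0⟩
  have hY : Nonempty 𝒴 := ⟨y0⟩
  have hn' : (0 : ℝ) < n := by exact_mod_cast hn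
  have hPn := prod_mem_stdSimplex hp n
  let xs : (Fin n → 𝒳 × 𝒴) → Fin n → 𝒳 := fun s i => (s i).1
  let ys : (Fin n → 𝒳 × 𝒴) → Fin n → 𝒴 := fun s i => (s i).2
  let enc : (i : Fin 5) → (Fin n → 𝒳 × 𝒴) → Index n (R i) := fun i s => c.enc (xs s) (ys s) i
  -- The encoder has some output, so no index set is empty; for n > 0 this forces the rates to be
  -- nonnegative.
  have m : (i : Fin 5) → Index n (R i) := fun i => enc i fun _ => (x0, y0)
  have hm : ∀ i, Nonempty (Index n (R i)) := fun i => ⟨m i⟩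
  have hcard : ∀ i, (Fintype.card (Index n (R i)) : ℝ) ≠ 0 := fun i => by
    have := hm i
    exact_mod_cast Fintype.card_ne_zero
  have hlog := fun i => logb_card_index_le (m i)
  let good : (Fin n → 𝒳 × 𝒴) → Prop := fun s => c.Correct (xs s) (ys s)
  set e := c.errorProb p with he
  have he' : ∑ s : Fin n → 𝒳 × 𝒴, (if good s then 0 else ∏ i, p (s i)) = e :=
    (Code.errorProb_eq p c).symm
  have he0 : 0 ≤ e := he' ▸ Finset.sum_nonneg fun s _ => by
    split_ifs; exacts [le_rfl, hPn.1 s]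
  set KX := Real.logb 2 (Fintype.card 𝒳) with hKX
  set KY := Real.logb 2 (Fintype.card 𝒴) with hKY
  have hKX0 : 0 ≤ KX := Real.logb_nonneg (by norm_num) (by exact_mod_cast Fintype.card_pos)
  have hKY0 : 0 ≤ KY := Real.logb_nonneg (by norm_num) (by exact_mod_cast Fintype.card_pos)
  have hlX : Real.logb 2 (Fintype.card (Fin n → 𝒳)) = n * KX := logb_card_arrow _ _
  have hlY : Real.logb 2 (Fintype.card (Fin n → 𝒴)) = n * KY := logb_card_arrow _ _
  have hlS : Real.logb 2 (Fintype.card (Fin n → 𝒳 × 𝒴)) = n * (KX + KY) := by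
    rw [logb_card_arrow, Fintype.card_prod]
    push_cast
    rw [Real.logb_mul (by exact_mod_cast Fintype.card_ne_zero)
      (by exact_mod_cast Fintype.card_ne_zero)]
  obtain ⟨k, q, hk, hq, hI, hHX, hHY⟩ := exists_aux_of_block hp hn (enc 0)
  set I := mutualInfo (lawXYU p q)
  set a := condEntropy (lawXU p q)
  set b := condEntropy (lawYU p q)
  have c1 := condEntropy_le_of_decoder_uniform xs (enc 0) hPn (enc 1) c.dec1 good fun s h => h.1
  have c2 := condEntropy_le_of_decoder_uniform ys (enc 0) hPn (enc 2) c.dec2 good fun s h => h.2.1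
  have c3 := condEntropy_le_of_decoder_side hp (sndLaw_mem_stdSimplex hp) Prod.snd
    (fun s hs => hs.trans_le (le_sndLaw hp.1 s.1 s.2)) xs (enc 0) (enc 3) c.dec3 good
    fun s h => h.2.2.1
  have c4 := condEntropy_le_of_decoder_side hp (fstLaw_mem_stdSimplex hp) Prod.fst
    (fun s hs => hs.trans_le (le_fstLaw hp.1 s.1 s.2)) ys (enc 0) (enc 4) c.dec4 good
    fun s h => h.2.2.2
  -- Decoder 2 supplies the side sequence of decoder 3, so M₂ and M₃ together describe Xⁿ given the
  -- common message.
  have c23 := condEntropy_le_of_decoder_uniform xs (enc 0) hPn (fun s => (enc 2 s, enc 3 s))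
    (fun m z => c.dec3 m z.2 (c.dec2 m z.1)) good
    (fun s h => by simp only [enc]; rw [h.2.1]; exact h.2.2.1)
  have c14 := condEntropy_le_of_decoder_uniform ys (enc 0) hPn (fun s => (enc 1 s, enc 4 s))
    (fun m z => c.dec4 m z.2 (c.dec1 m z.1)) good
    (fun s h => by simp only [enc]; rw [h.1]; exact h.2.2.2)
  -- Here the conditioning is on the side sequence, and the common message moves into the
  -- description.
  have c03 := condEntropy_le_of_decoder_uniform xs ys hPn (fun s => (enc 0 s, enc 3 s))
    (fun y z => c.dec3 z.1 z.2 y) good (fun s h => h.2.2.1)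
  have c04 := condEntropy_le_of_decoder_uniform ys xs hPn (fun s => (enc 0 s, enc 4 s))
    (fun y z => c.dec4 z.1 z.2 y) good (fun s h => h.2.2.2)
  have c023 := condEntropy_le_of_decoder_uniform id (fun _ => ()) hPn
    (fun s => (enc 0 s, enc 2 s, enc 3 s))
    (fun _ z i => (c.dec3 z.1 z.2.2 (c.dec2 z.1 z.2.1) i, c.dec2 z.1 z.2.1 i)) good (fun s h => by
      simp only [enc]; rw [h.2.1, h.2.2.1]; rfl)
  have c014 := condEntropy_le_of_decoder_uniform id (fun _ => ()) hPn
    (fun s => (enc 0 s, enc 1 s, enc 4 s))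
    (fun _ z i => (c.dec1 z.1 z.2.1 i, c.dec4 z.1 z.2.2 (c.dec1 z.1 z.2.1) i)) good (fun s h => by
      simp only [enc]; rw [h.1, h.2.2.2]; rfl)
  rw [sum_prod_mul_logb_sndLaw hp] at c3
  rw [sum_prod_mul_logb_fstLaw hp] at c4
  rw [push_fst_graphLaw_snd, condEntropy_iid hp] at c03
  rw [push_snd_graphLaw_fst, condEntropy_iid (swap_mem_stdSimplex hp)] at c04
  rw [condEntropy_push_id_const hPn, entropy_iid hp] at c023 c014
  simp only [Fintype.card_prod, Nat.cast_mul] at c23 c14 c03 c04 c023 c014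
  rw [Real.logb_mul (hcard _) (hcard _)] at c23 c14 c03 c04
  rw [Real.logb_mul (hcard _) (mul_ne_zero (hcard _) (hcard _)),
    Real.logb_mul (hcard _) (hcard _)] at c023 c014
  rw [he', hlX] at c1 c3 c23 c03
  rw [he', hlY] at c2 c4 c14 c04
  rw [he', hlS] at c023 c014
  have heX : 0 ≤ e * (n * KX) := by positivity
  have heY : 0 ≤ e * (n * KY) := by positivity
  -- One slack serves all constraints: n δ is 1 plus the largest Fano term, that for the pair
  -- (Xⁿ,Yⁿ).
  set δ := 1 / (n : ℝ) + e * (KX + KY) with hδ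
  have hδ0 : 0 ≤ δ := by positivity
  have hnδ : n * δ = 1 + e * (n * KX) + e * (n * KY) := by rw [hδ]; field_simp; ring
  have h0 := hlog 0
  have h1 := hlog 1
  have h2 := hlog 2
  have h3 := hlog 3
  have h4 := hlog 4
  have hnδ0 : 0 ≤ n * δ := by positivity
  have hn1 : ∀ {u v : ℝ}, n * u ≤ n * v → u ≤ v := fun h => le_of_mul_le_mul_left h hn'
  refine ⟨fun i => add_nonneg (nonneg_of_index_nonempty hn (m i)) hδ0, k, q, hk, hq,
    hn1 ?_, hn1 ?_, hn1 ?_, hn1 ?_, hn1 ?_, hn1 ?_, hn1 ?_, hn1 ?_, hn1 ?_, hn1 ?_, hn1 ?_⟩ <;>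
  linarith

lemma mem_singleLetterRegion_of_achievable (hp : p ∈ stdSimplex ℝ (𝒳 × 𝒴)) {R : Fin 5 → ℝ}
    (hR : Achievable p R) : R ∈ singleLetterRegion p := by
  obtain ⟨c, hc⟩ := hR
  refine (isClosed_singleLetterRegion hp).mem_of_tendsto (b := Filter.atTop)
    (f := fun n i => R i + (1 / n + (c n).errorProb p * (Real.logb 2 (Fintype.card 𝒳) +
      Real.logb 2 (Fintype.card 𝒴)))) ?_ ?_
  · rw [tendsto_pi_nhds]
    intro i
    have h := (tendsto_one_div_atTop_nhds_zero_nat (𝕜 := ℝ)).add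
      (hc.mul_const (Real.logb 2 (Fintype.card 𝒳) + Real.logb 2 (Fintype.card 𝒴)))
    simpa using tendsto_const_nhds.add h
  · filter_upwards [Filter.eventually_gt_atTop 0] with n hn
    exact (c n).add_mem_singleLetterRegion hp hn

lemma rateRegion_subset (hp : p ∈ stdSimplex ℝ (𝒳 × 𝒴)) :
    rateRegion p ⊆ singleLetterRegion p :=
  closure_minimal (fun _ hR => mem_singleLetterRegion_of_achievable hp hR)
    (isClosed_singleLetterRegion hp)

end Converse

/-! ### A one-sided weak law of large numbers -/

section LargeNumbers

variable {S : Type*} [Fintype S] {p : S → ℝ}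

/-- The cross terms vanish by centring; this is the variance for Chebyshev's inequality. -/
lemma sum_prod_mul_sum_sq (hp : p ∈ stdSimplex ℝ S) (g : S → ℝ) (hg : ∑ a, p a * g a = 0) (n : ℕ) :
    ∑ s : Fin n → S, (∏ i, p (s i)) * (∑ i, g (s i)) ^ 2 = n * ∑ a, p a * g a ^ 2 := by
  induction n with
  | zero => simp
  | succ n ih =>
    rw [sum_cons_eq]
    simp only [Fin.prod_univ_succ, Fin.sum_univ_succ, Fin.cons_zero, Fin.cons_succ]
    have h : ∀ a, ∑ s : Fin n → S, (p a * ∏ i, p (s i)) * (g a + ∑ i, g (s i)) ^ 2 =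
        p a * g a ^ 2 + p a * (n * ∑ a, p a * g a ^ 2) := by
      intro a
      have h1 := sum_prod_mul_sum hp g n
      rw [hg, mul_zero] at h1
      have h2 : ∀ s : Fin n → S, (p a * ∏ i, p (s i)) * (g a + ∑ i, g (s i)) ^ 2 =
          p a * g a ^ 2 * (∏ i, p (s i)) + 2 * p a * g a * ((∏ i, p (s i)) * ∑ i, g (s i)) +
            p a * ((∏ i, p (s i)) * (∑ i, g (s i)) ^ 2) := fun s => by ring
      simp only [h2, Finset.sum_add_distrib, ← Finset.mul_sum, h1, ih, sum_prod_eq_one hp]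
      ring
    simp only [h, Finset.sum_add_distrib, ← Finset.sum_mul, hp.2]
    push_cast; ring

open Classical in
/-- One-sided weak law of large numbers for products of weights. -/
lemma eventually_sum_atypical_le (hp : p ∈ stdSimplex ℝ S) (w : S → ℝ)
    (hw : ∀ a, 0 < p a → 0 < w a) {E : ℝ} (hE : ∑ a, p a * Real.logb 2 (w a) = E) {η δ : ℝ}
    (hη : 0 < η) (hδ : 0 < δ) :
    ∀ᶠ n : ℕ in Filter.atTop, ∑ s : Fin n → S,
      (if (2 : ℝ) ^ ((n : ℝ) * (E - η)) ≤ ∏ i, w (s i) then 0 else ∏ i, p (s i)) ≤ δ := by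
  set V := ∑ a, p a * (Real.logb 2 (w a) - E) ^ 2 with hV
  filter_upwards [Filter.eventually_gt_atTop 0,
    Filter.eventually_ge_atTop ⌈V / (η ^ 2 * δ)⌉₊] with n hn hnV
  have hn' : (0 : ℝ) < n := by exact_mod_cast hn
  have hnV' : V ≤ n * (η ^ 2 * δ) := by
    rw [← div_le_iff₀ (by positivity)]
    exact (Nat.le_ceil _).trans (by exact_mod_cast hnV)
  have hmean : ∑ a, p a * (Real.logb 2 (w a) - E) = 0 := by
    simp only [mul_sub, Finset.sum_sub_distrib, hE, ← Finset.sum_mul, hp.2]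
    ring
  have hsq := sum_prod_mul_sum_sq hp _ hmean n
  -- Chebyshev: on an atypical block of positive mass the centred sum is below -nη, so its square
  -- exceeds (nη)².
  have key : ∀ s : Fin n → S,
      (n * η) ^ 2 * (if (2 : ℝ) ^ ((n : ℝ) * (E - η)) ≤ ∏ i, w (s i) then 0 else ∏ i, p (s i)) ≤
        (∏ i, p (s i)) * (∑ i, (Real.logb 2 (w (s i)) - E)) ^ 2 := by
    intro s
    have hs0 : 0 ≤ ∏ i, p (s i) := Finset.prod_nonneg fun i _ => hp.1 _
    split_ifs with h
    · rw [mul_zero]; positivity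
    · rcases eq_or_lt_of_le hs0 with h0 | h0
      · simp [← h0]
      have hpi : ∀ i, 0 < w (s i) := fun i => hw _ <| lt_of_le_of_ne (hp.1 _) fun h1 => by
        rw [Finset.prod_eq_zero (Finset.mem_univ i) h1.symm] at h0
        exact lt_irrefl _ h0
      have hlt : ∑ i, (Real.logb 2 (w (s i)) - E) < -(n * η) := by
        push Not at h
        have h2 := Real.logb_lt_logb (b := 2) (by norm_num) (Finset.prod_pos fun i _ => hpi i) h
        rw [Real.logb_rpow (by norm_num) (by norm_num),
          Real.logb_prod Finset.univ _ fun i _ => (hpi i).ne'] at h2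
        rw [Finset.sum_sub_distrib]
        simp only [Finset.sum_const, Finset.card_univ, Fintype.card_fin, nsmul_eq_mul]
        linarith
      rw [mul_comm]
      refine mul_le_mul_of_nonneg_left ?_ hs0
      have : 0 < n * η := by positivity
      nlinarith
  have h := Finset.sum_le_sum fun s (_ : s ∈ Finset.univ) => key s
  rw [hsq, ← Finset.mul_sum] at h
  have h2 : (n * η) ^ 2 * (∑ s : Fin n → S,
      (if (2 : ℝ) ^ ((n : ℝ) * (E - η)) ≤ ∏ i, w (s i) then 0 else ∏ i, p (s i))) ≤
      (n * η) ^ 2 * δ := by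
    refine h.trans ?_
    nlinarith
  exact le_of_mul_le_mul_left h2 (by positivity)

end LargeNumbers

/-! ### Greedy covering and counting -/

section Covering

open Classical in
/-- Greedy covering: if a random `u` covers each good point with probability at least `d`, then
some `N` choices leave at most a fraction `(1 - d) ^ N` of the mass of the good points uncovered. -/
lemma exists_cover {Ω U : Type*} [Fintype Ω] [Fintype U] {m : Ω → ℝ} (hm : m ∈ stdSimplex ℝ Ω)
    {ν : U → ℝ} (hν : ν ∈ stdSimplex ℝ U) (T : Ω → U → Prop) (G : Finset Ω) {d : ℝ}
    (hd : ∀ ω ∈ G, d ≤ ∑ u, if T ω u then ν u else 0) (hd1 : d ≤ 1) (N : ℕ) :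
    ∃ u : Fin N → U, ∑ ω ∈ G.filter (fun ω => ∀ l, ¬ T ω (u l)), m ω ≤ (1 - d) ^ N := by
  induction N with
  | zero =>
    refine ⟨Fin.elim0, ?_⟩
    rw [pow_zero, ← hm.2]
    exact Finset.sum_le_sum_of_subset_of_nonneg (Finset.subset_univ _) fun _ _ _ => hm.1 _
  | succ N ih =>
    obtain ⟨u, hu⟩ := ih
    set B := G.filter (fun ω => ∀ l, ¬ T ω (u l)) with hB
    -- One more random choice leaves on average at most the fraction 1 - d of the uncovered mass, so
    -- some choice does too.
    have havg : ∑ v, ν v * ∑ ω ∈ B.filter (fun ω => ¬ T ω v), m ω ≤ (1 - d) * ∑ ω ∈ B, m ω := by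
      have h1 : ∀ ω ∈ B, ∑ v, ν v * (if ¬ T ω v then m ω else 0) ≤ (1 - d) * m ω := by
        intro ω hω
        have h2 := hd ω (Finset.mem_of_mem_filter ω hω)
        have h3 : ∀ v, ν v * (if ¬ T ω v then m ω else 0) =
            m ω * (ν v - if T ω v then ν v else 0) := by
          intro v; by_cases h : T ω v <;> simp [h, mul_comm]
        simp only [h3]
        rw [← Finset.mul_sum, Finset.sum_sub_distrib, hν.2, mul_comm]
        exact mul_le_mul_of_nonneg_right (by linarith) (hm.1 ω)
      calc ∑ v, ν v * ∑ ω ∈ B.filter (fun ω => ¬ T ω v), m ω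
          = ∑ ω ∈ B, ∑ v, ν v * (if ¬ T ω v then m ω else 0) := by
            rw [Finset.sum_comm]
            exact Finset.sum_congr rfl fun v _ => by rw [Finset.sum_filter, Finset.mul_sum]
        _ ≤ ∑ ω ∈ B, (1 - d) * m ω := Finset.sum_le_sum h1
        _ = _ := by rw [Finset.mul_sum]
    obtain ⟨v, hv⟩ : ∃ v, ∑ ω ∈ B.filter (fun ω => ¬ T ω v), m ω ≤ (1 - d) * ∑ ω ∈ B, m ω := by
      by_contra! hcon
      obtain ⟨v0⟩ := nonempty_of_mem_stdSimplex hν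
      obtain ⟨v1, hv1⟩ : ∃ v, 0 < ν v := by
        by_contra! h
        have : ∑ v, ν v ≤ 0 := Finset.sum_nonpos fun v _ => h v
        rw [hν.2] at this
        linarith
      have hlt : ∑ v, ν v * ((1 - d) * ∑ ω ∈ B, m ω) <
          ∑ v, ν v * ∑ ω ∈ B.filter (fun ω => ¬ T ω v), m ω :=
        Finset.sum_lt_sum (fun v _ => mul_le_mul_of_nonneg_left (hcon v).le (hν.1 v))
          ⟨v1, Finset.mem_univ _, mul_lt_mul_of_pos_left (hcon v1) hv1⟩
      rw [← Finset.sum_mul, hν.2, one_mul] at hlt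
      linarith
    refine ⟨Fin.cons v u, ?_⟩
    have hset : G.filter (fun ω => ∀ l, ¬ T ω ((Fin.cons v u : Fin (N + 1) → U) l)) =
        B.filter (fun ω => ¬ T ω v) := by
      ext ω
      simp only [hB, Finset.mem_filter, Fin.forall_fin_succ, Fin.cons_zero, Fin.cons_succ]
      tauto
    rw [hset, pow_succ, mul_comm]
    exact hv.trans (mul_le_mul_of_nonneg_left hu (by linarith))

/-- The products sum to at most 1 over all sequences, so at most 2^(nr) of them can reach 2^(-nr).
Mass at most 1 is allowed because J/`sndLaw` J is identically 0 where the marginal vanishes. -/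
lemma card_le_of_le_prod {A B : Type*} [Fintype A] {W : A → B → ℝ} (hW : ∀ a b, 0 ≤ W a b) (hW1 : ∀ b, ∑ a, W a b ≤ 1)
    {n : ℕ} (b : Fin n → B) (r : ℝ) (K : Finset (Fin n → A))
    (hK : ∀ a ∈ K, (2 : ℝ) ^ ((n : ℝ) * -r) ≤ ∏ i, W (a i) (b i)) :
    (K.card : ℝ) ≤ (2 : ℝ) ^ ((n : ℝ) * r) := by
  have h1 : (K.card : ℝ) * (2 : ℝ) ^ ((n : ℝ) * -r) ≤ 1 := by
    calc (K.card : ℝ) * (2 : ℝ) ^ ((n : ℝ) * -r) = ∑ a ∈ K, (2 : ℝ) ^ ((n : ℝ) * -r) := by simp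
      _ ≤ ∑ a ∈ K, ∏ i, W (a i) (b i) := Finset.sum_le_sum hK
      _ ≤ ∑ a : Fin n → A, ∏ i, W (a i) (b i) :=
        Finset.sum_le_sum_of_subset_of_nonneg (Finset.subset_univ _) fun a _ _ =>
          Finset.prod_nonneg fun i _ => hW _ _
      _ = ∏ i, ∑ a, W a (b i) := (Fintype.prod_sum fun i a => W a (b i)).symm
      _ ≤ 1 := Finset.prod_le_one (fun i _ => Finset.sum_nonneg fun a _ => hW _ _) fun i _ => hW1 _
  rw [mul_neg, Real.rpow_neg (by norm_num), ← div_eq_mul_inv,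
    div_le_one (by positivity)] at h1
  exact h1

/-- Number of sequences of large conditional probability. -/
lemma card_le_of_le_prod_div {A B : Type*} [Fintype A] {J : A × B → ℝ} (hJ : ∀ z, 0 ≤ J z) {n : ℕ} (b : Fin n → B) (r : ℝ)
    (K : Finset (Fin n → A))
    (hK : ∀ a ∈ K, (2 : ℝ) ^ ((n : ℝ) * -r) ≤ ∏ i, J (a i, b i) / sndLaw J (b i)) :
    (K.card : ℝ) ≤ (2 : ℝ) ^ ((n : ℝ) * r) := by
  refine card_le_of_le_prod (W := fun a b => J (a, b) / sndLaw J b)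
    (fun a b => div_nonneg (hJ _) (sndLaw_nonneg hJ _)) (fun b => ?_) b r K hK
  rw [← Finset.sum_div]
  exact div_self_le_one _

variable {A B Z : Type*} [Fintype A] [Fintype B] [Fintype Z]

/-- The conditional probability of `f z` given `g z`. -/
noncomputable def condWeight [DecidableEq B] (f : Z → A) (g : Z → B) (P : Z → ℝ) (z : Z) : ℝ :=
  push f (graphLaw g P) (f z, g z) / sndLaw (push f (graphLaw g P)) (g z)

lemma condWeight_pos {A B Z : Type*} [Fintype A] [Fintype Z] [DecidableEq B] (f : Z → A) (g : Z → B) {P : Z → ℝ} (hP : ∀ z, 0 ≤ P z)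
    {z : Z} (hz : 0 < P z) : 0 < condWeight f g P z := by
  classical
  have h0 := push_nonneg f (graphLaw_nonneg g hP)
  have h1 : 0 < push f (graphLaw g P) (f z, g z) := by
    refine hz.trans_le ?_
    have := Finset.single_le_sum
      (f := fun ω => if f ω = f z then graphLaw g P (ω, g z) else 0)
      (fun ω _ => by split_ifs; exacts [graphLaw_nonneg g hP _, le_rfl]) (Finset.mem_univ z)
    simpa [graphLaw, push] using this
  exact div_pos h1 (h1.trans_le (le_sndLaw h0 _ _))

lemma sum_mul_logb_condWeight [DecidableEq B] (f : Z → A) (g : Z → B) (P : Z → ℝ) :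
    ∑ z, P z * Real.logb 2 (condWeight f g P z) = -condEntropy (push f (graphLaw g P)) := by
  rw [condEntropy, neg_neg]
  exact (sum_push_graphLaw_mul f g P fun a b => Real.logb 2 (push f (graphLaw g P) (a, b) /
    sndLaw (push f (graphLaw g P)) b)).symm

end Covering

/-! ### Covering by change of measure -/

section OneShotCover

open Classical in
-- Call ω good if κ(ω,·) gives the compatible u mass at least 1/2. The density bound on T turns this
-- into ν-mass at least c/2, so greedy covering applies; by Markov's inequality the other ω weigh at
-- most 2ε.
lemma exists_cover_of_kernel {Ω U : Type*} [Fintype Ω] [Fintype U] {m : Ω → ℝ}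
    (hm : m ∈ stdSimplex ℝ Ω) {ν : U → ℝ} (hν : ν ∈ stdSimplex ℝ U) {κ : Ω → U → ℝ}
    (hκ : ∀ ω, κ ω ∈ stdSimplex ℝ U) (T : Ω → U → Prop) {c ε : ℝ} (hc : 0 < c) (hc1 : c ≤ 1)
    (hT : ∀ ω u, T ω u → c * κ ω u ≤ ν u)
    (hε : ∑ ω, ∑ u, (if T ω u then 0 else m ω * κ ω u) ≤ ε) (N : ℕ) :
    ∃ u : Fin N → U, (∑ ω, if ∃ l, T ω (u l) then 0 else m ω) ≤ (1 - c / 2) ^ N + 2 * ε := by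
  let G : Finset Ω := Finset.univ.filter fun ω => 1 / 2 ≤ ∑ u, if T ω u then κ ω u else 0
  obtain ⟨u, hu⟩ := exists_cover hm hν T G (d := c / 2) (fun ω hω => by
    have h1 : 1 / 2 ≤ ∑ u, if T ω u then κ ω u else 0 := by simpa [G] using hω
    have h2 : c * (∑ u, if T ω u then κ ω u else 0) ≤ ∑ u, if T ω u then ν u else 0 := by
      rw [Finset.mul_sum]
      refine Finset.sum_le_sum fun u _ => ?_
      split_ifs with h
      exacts [hT ω u h, by simp]
    nlinarith) (by linarith) N
  refine ⟨u, ?_⟩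
  have hbad : ∀ ω, (if ∃ l, T ω (u l) then 0 else m ω) ≤
      (if ω ∈ G.filter (fun ω => ∀ l, ¬ T ω (u l)) then m ω else 0) +
        2 * ∑ v, (if T ω v then 0 else m ω * κ ω v) := by
    intro ω
    have h0 : 0 ≤ ∑ v, (if T ω v then 0 else m ω * κ ω v) := Finset.sum_nonneg fun v _ => by
      split_ifs; exacts [le_rfl, mul_nonneg (hm.1 _) ((hκ ω).1 _)]
    have h00 := hm.1 ω
    by_cases h1 : ∃ l, T ω (u l)
    · rw [if_pos h1]
      split_ifs <;> linarith
    · rw [if_neg h1]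
      by_cases h2 : ω ∈ G
      · rw [if_pos (Finset.mem_filter.mpr ⟨h2, by simpa using h1⟩)]
        linarith
      · have h3 : ∑ v, (if T ω v then κ ω v else 0) < 1 / 2 := by simpa [G] using h2
        have h4 : ∑ v, (if T ω v then 0 else m ω * κ ω v) =
            m ω * (1 - ∑ v, (if T ω v then κ ω v else 0)) := by
          rw [← (hκ ω).2, ← Finset.sum_sub_distrib, Finset.mul_sum]
          exact Finset.sum_congr rfl fun v _ => by split_ifs <;> simp
        rw [if_neg fun h => h2 (Finset.mem_of_mem_filter ω h), h4]
        nlinarith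
  refine (Finset.sum_le_sum fun ω _ => hbad ω).trans ?_
  rw [Finset.sum_add_distrib, ← Finset.mul_sum, Finset.sum_ite_mem, Finset.univ_inter]
  exact add_le_add hu (by linarith)

end OneShotCover

/-! ### Typicality and the quantizer -/

section Typical

open Classical in
lemma eventually_sum_not_typical_le {J Z : Type*} [Fintype J] [Fintype Z] {P : Z → ℝ}
    (hP : P ∈ stdSimplex ℝ Z) (w : J → Z → ℝ) (hw : ∀ j z, 0 < P z → 0 < w j z) (E : J → ℝ)
    (hE : ∀ j, ∑ z, P z * Real.logb 2 (w j z) = E j) {η δ : ℝ} (hη : 0 < η) (hδ : 0 < δ) :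
    ∀ᶠ n : ℕ in Filter.atTop, ∑ s : Fin n → Z,
      (if ∀ j, (2 : ℝ) ^ ((n : ℝ) * (E j - η)) ≤ ∏ i, w j (s i) then 0 else ∏ i, P (s i)) ≤ δ := by
  -- Each weight gets the error budget δ/(|J| + 1); the added 1 covers empty J.
  have hJ : (0 : ℝ) < Fintype.card J + 1 := by positivity
  have h := Filter.eventually_all.mpr fun j =>
    eventually_sum_atypical_le hP (w j) (hw j) (hE j) hη (div_pos hδ hJ)
  filter_upwards [h] with n hn
  have h1 : ∀ s : Fin n → Z,
      (if ∀ j, (2 : ℝ) ^ ((n : ℝ) * (E j - η)) ≤ ∏ i, w j (s i) then 0 else ∏ i, P (s i)) ≤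
      ∑ j, (if (2 : ℝ) ^ ((n : ℝ) * (E j - η)) ≤ ∏ i, w j (s i) then 0 else ∏ i, P (s i)) := by
    intro s
    have h0 : ∀ j, 0 ≤ (if (2 : ℝ) ^ ((n : ℝ) * (E j - η)) ≤ ∏ i, w j (s i) then 0
        else ∏ i, P (s i)) := fun j => by
      split_ifs; exacts [le_rfl, Finset.prod_nonneg fun i _ => hP.1 _]
    split_ifs with hs
    · exact Finset.sum_nonneg fun j _ => h0 j
    · push Not at hs
      obtain ⟨j, hj⟩ := hs
      have := Finset.single_le_sum (fun j _ => h0 j) (Finset.mem_univ j)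
      rwa [if_neg (not_le.mpr hj)] at this
  refine (Finset.sum_le_sum fun s _ => h1 s).trans ?_
  rw [Finset.sum_comm]
  refine (Finset.sum_le_sum fun j _ => hn j).trans ?_
  rw [Finset.sum_const, Finset.card_univ, nsmul_eq_mul, mul_div_assoc', div_le_iff₀ hJ]
  nlinarith

variable {𝒳 𝒴 ι : Type*} [Fintype 𝒳] [Fintype 𝒴] [Fintype ι] {p : 𝒳 × 𝒴 → ℝ}
  {q : 𝒳 × 𝒴 → ι → ℝ}

lemma lawXYU_mem_stdSimplex (hp : p ∈ stdSimplex ℝ (𝒳 × 𝒴)) (hq : ∀ s, q s ∈ stdSimplex ℝ ι) :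
    lawXYU p q ∈ stdSimplex ℝ ((𝒳 × 𝒴) × ι) := by
  refine ⟨lawXYU_nonneg hp.1 hq, ?_⟩
  rw [Fintype.sum_prod_type, ← hp.2]
  exact Finset.sum_congr rfl fun s _ => congrFun (fstLaw_lawXYU hq) s

lemma mutualInfo_lawXYU_nonneg (hp : p ∈ stdSimplex ℝ (𝒳 × 𝒴)) (hq : ∀ s, q s ∈ stdSimplex ℝ ι) :
    0 ≤ mutualInfo (lawXYU p q) := by
  rw [mutualInfo_lawXYU hp.1 hq, sub_nonneg]
  refine (condEntropy_le_of_map (lawXYU_nonneg hp.1 hq) fun _ => ()).trans_eq ?_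
  have h : ∀ s, ∑ u, lawXYU p q (s, u) = p s := fun s => congrFun (fstLaw_lawXYU hq) s
  simp [condEntropy, sndLaw, h, hp.2, entropy]

lemma sum_mul_logb_sndLaw_div (hq : ∀ s, q s ∈ stdSimplex ℝ ι) :
    ∑ z, lawXYU p q z * Real.logb 2 (sndLaw (lawXYU p q) z.2 / q z.1 z.2) =
      -mutualInfo (lawXYU p q) := by
  rw [mutualInfo, fstLaw_lawXYU hq, Fintype.sum_prod_type, ← Finset.sum_neg_distrib]
  refine Finset.sum_congr rfl fun s _ => ?_
  rw [← Finset.sum_neg_distrib]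
  refine Finset.sum_congr rfl fun u _ => ?_
  rcases eq_or_ne (p s) 0 with h | h
  · simp [lawXYU, h]
  · rw [← mul_neg, ← Real.logb_inv, inv_div]
    congr 2
    simp only [lawXYU]
    rw [mul_div_mul_left _ _ h]

/-- Entropy of `f(Z)` given `g(Z)`. -/
noncomputable def condEnt {A B Z : Type*} [Fintype A] [Fintype B] [Fintype Z] [DecidableEq B]
    (f : Z → A) (g : Z → B) (P : Z → ℝ) : ℝ := condEntropy (push f (graphLaw g P))

lemma card_le_of_condEnt {A B Z : Type*} [Fintype A] [Fintype B] [Fintype Z] [DecidableEq B]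
    (f : Z → A) (g : Z → B) {P : Z → ℝ} (hP : ∀ z, 0 ≤ P z) {n : ℕ} (b : Fin n → B) {ζ η : ℝ}
    (h : ζ ≤ η) (K : Finset (Fin n → A)) (hK : ∀ a ∈ K, (2 : ℝ) ^ ((n : ℝ) * (-condEnt f g P - ζ)) ≤
      ∏ i, push f (graphLaw g P) (a i, b i) / sndLaw (push f (graphLaw g P)) (b i)) :
    (K.card : ℝ) ≤ 2 ^ ((n : ℝ) * (condEnt f g P + η)) := by
  refine (card_le_of_le_prod_div (push_nonneg f (graphLaw_nonneg g hP)) b (condEnt f g P + ζ) K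
    fun a ha => ?_).trans ?_
  · rw [show (n : ℝ) * -(condEnt f g P + ζ) = n * (-condEnt f g P - ζ) by ring]
    exact hK a ha
  · refine Real.rpow_le_rpow_of_exponent_le (by norm_num) ?_
    exact mul_le_mul_of_nonneg_left (by linarith) (by positivity)

open Classical in
/-- A map `φ` from the pairs of sequences to `≈ 2 ^ (n I(X,Y;U))` indices, which is defined with high
probability and such that few sequences are compatible with an index. -/
lemma eventually_exists_quantizer (hp : p ∈ stdSimplex ℝ (𝒳 × 𝒴))
    (hq : ∀ s, q s ∈ stdSimplex ℝ ι) {η δ : ℝ} (hη : 0 < η) (hδ : 0 < δ) :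
    ∀ᶠ n : ℕ in Filter.atTop, ∃ (N : ℕ) (φ : (Fin n → 𝒳) → (Fin n → 𝒴) → Option (Fin N)),
      (N : ℝ) ≤ 2 ^ ((n : ℝ) * (mutualInfo (lawXYU p q) + η)) ∧
      (∑ x : Fin n → 𝒳, ∑ y : Fin n → 𝒴,
        (if (φ x y).isSome then 0 else ∏ i, p (x i, y i))) ≤ δ ∧
      (∀ l, ((Finset.univ.filter fun x => ∃ y, φ x y = some l).card : ℝ) ≤
        2 ^ ((n : ℝ) * (condEnt (fun z => z.1.1) (fun z => z.2) (lawXYU p q) + η))) ∧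
      (∀ l, ((Finset.univ.filter fun y => ∃ x, φ x y = some l).card : ℝ) ≤
        2 ^ ((n : ℝ) * (condEnt (fun z => z.1.2) (fun z => z.2) (lawXYU p q) + η))) ∧
      (∀ l y, ((Finset.univ.filter fun x => φ x y = some l).card : ℝ) ≤
        2 ^ ((n : ℝ) * (condEnt (fun z => z.1.1) (fun z => (z.1.2, z.2)) (lawXYU p q) + η))) ∧
      (∀ l x, ((Finset.univ.filter fun y => φ x y = some l).card : ℝ) ≤
        2 ^ ((n : ℝ) * (condEnt (fun z => z.1.2) (fun z => (z.1.1, z.2)) (lawXYU p q) + η))) ∧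
      (∀ y, ((Finset.univ.filter fun x => (φ x y).isSome).card : ℝ) ≤
        2 ^ ((n : ℝ) * (condEnt (fun z => z.1.1) (fun z => z.1.2) (lawXYU p q) + η))) ∧
      (∀ x, ((Finset.univ.filter fun y => (φ x y).isSome).card : ℝ) ≤
        2 ^ ((n : ℝ) * (condEnt (fun z => z.1.2) (fun z => z.1.1) (lawXYU p q) + η))) := by
  have hP := lawXYU_mem_stdSimplex hp hq
  have hI : 0 ≤ mutualInfo (lawXYU p q) := mutualInfo_lawXYU_nonneg hp hq
  have hsum := sum_mul_logb_sndLaw_div (p := p) hq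
  generalize hPdef : lawXYU p q = P at hP hI hsum ⊢
  set I := mutualInfo P with hIdef
  set ζ := η / 4 with hζ
  have hζ0 : 0 < ζ := by positivity
  -- Six conditional probabilities, for the six cardinality bounds, and the density of P_U with
  -- respect to P_{U|XY}, for the covering. Only lower bounds on their products are ever needed, so
  -- one-sided typicality suffices.
  let w : Fin 7 → (𝒳 × 𝒴) × ι → ℝ := ![
    condWeight (fun z => z.1.1) (fun z => z.2) P, condWeight (fun z => z.1.2) (fun z => z.2) P,
    condWeight (fun z => z.1.1) (fun z => (z.1.2, z.2)) P,
    condWeight (fun z => z.1.2) (fun z => (z.1.1, z.2)) P,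
    condWeight (fun z => z.1.1) (fun z => z.1.2) P, condWeight (fun z => z.1.2) (fun z => z.1.1) P,
    fun z => sndLaw P z.2 / q z.1 z.2]
  let E : Fin 7 → ℝ := ![
    -condEnt (fun z => z.1.1) (fun z => z.2) P, -condEnt (fun z => z.1.2) (fun z => z.2) P,
    -condEnt (fun z => z.1.1) (fun z => (z.1.2, z.2)) P,
    -condEnt (fun z => z.1.2) (fun z => (z.1.1, z.2)) P,
    -condEnt (fun z => z.1.1) (fun z => z.1.2) P, -condEnt (fun z => z.1.2) (fun z => z.1.1) P, -I]
  have hw : ∀ j z, 0 < P z → 0 < w j z := by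
    intro j z hz
    have h7 : 0 < sndLaw P z.2 / q z.1 z.2 := by
      refine div_pos (hz.trans_le (le_sndLaw hP.1 z.1 z.2)) (lt_of_le_of_ne ((hq _).1 _) fun h => ?_)
      rw [← hPdef, lawXYU, ← h, mul_zero] at hz
      exact lt_irrefl _ hz
    fin_cases j
    exacts [condWeight_pos _ _ hP.1 hz, condWeight_pos _ _ hP.1 hz, condWeight_pos _ _ hP.1 hz,
      condWeight_pos _ _ hP.1 hz, condWeight_pos _ _ hP.1 hz, condWeight_pos _ _ hP.1 hz, h7]
  have hE : ∀ j, ∑ z, P z * Real.logb 2 (w j z) = E j := by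
    intro j
    fin_cases j
    exacts [sum_mul_logb_condWeight _ _ P, sum_mul_logb_condWeight _ _ P,
      sum_mul_logb_condWeight _ _ P, sum_mul_logb_condWeight _ _ P, sum_mul_logb_condWeight _ _ P,
      sum_mul_logb_condWeight _ _ P, hsum]
  have hexp : ∀ᶠ n : ℕ in Filter.atTop, Real.exp (-((2 : ℝ) ^ ((n : ℝ) * ζ) / 2)) ≤ δ / 2 := by
    have h1 : Filter.Tendsto (fun n : ℕ => (2 : ℝ) ^ ((n : ℝ) * ζ)) Filter.atTop Filter.atTop :=
      (tendsto_rpow_atTop_of_base_gt_one 2 (by norm_num)).comp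
        (tendsto_natCast_atTop_atTop.atTop_mul_const hζ0)
    have h2 := Real.tendsto_exp_neg_atTop_nhds_zero.comp (h1.atTop_div_const two_pos)
    exact (h2.eventually (ge_mem_nhds (half_pos hδ)))
  have hlarge : ∀ᶠ n : ℕ in Filter.atTop, 1 ≤ (n : ℝ) * ζ :=
    (tendsto_natCast_atTop_atTop.atTop_mul_const hζ0).eventually_ge_atTop 1
  filter_upwards [eventually_sum_not_typical_le hP w hw E hE hζ0 (δ := δ / 4) (by positivity),
    hexp, hlarge] with n hn hn1 hn2
  let T : (Fin n → 𝒳 × 𝒴) → (Fin n → ι) → Prop := fun s u =>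
    ∀ j, (2 : ℝ) ^ ((n : ℝ) * (E j - ζ)) ≤ ∏ i, w j (s i, u i)
  -- With c = 2^(-n(I+ζ)) this gives Nc ≥ 2^(nζ), hence (1 - c/2)^N ≤ exp(-2^(nζ)/2). Rounding up
  -- costs at most a factor 2, absorbed by η = 4ζ once nζ ≥ 1.
  set N := ⌈(2 : ℝ) ^ ((n : ℝ) * (I + 2 * ζ))⌉₊ with hN
  obtain ⟨u, hu⟩ := exists_cover_of_kernel (prod_mem_stdSimplex hp n)
    (prod_mem_stdSimplex (sndLaw_mem_stdSimplex hP) n)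
    (κ := fun s u => ∏ i, q (s i) (u i))
    (fun s => ⟨fun u => Finset.prod_nonneg fun i _ => (hq _).1 _, by
      rw [← Fintype.prod_sum fun i u => q (s i) u]
      exact Finset.prod_eq_one fun i _ => (hq _).2⟩) T
    (c := (2 : ℝ) ^ ((n : ℝ) * (-I - ζ))) (ε := δ / 4) (by positivity)
    (Real.rpow_le_one_of_one_le_of_nonpos (by norm_num)
      (mul_nonpos_of_nonneg_of_nonpos (by positivity) (by linarith)))
    (fun s u hT => by
      have h7 : (2 : ℝ) ^ ((n : ℝ) * (-I - ζ)) ≤ ∏ i, sndLaw P (u i) / q (s i) (u i) := hT 6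
      refine (mul_le_mul_of_nonneg_right h7
        (Finset.prod_nonneg fun i _ => (hq _).1 _)).trans ?_
      rw [← Finset.prod_mul_distrib]
      refine Finset.prod_le_prod (fun i _ => mul_nonneg (div_nonneg (sndLaw_nonneg hP.1 _)
        ((hq _).1 _)) ((hq _).1 _)) fun i _ => ?_
      rcases eq_or_ne (q (s i) (u i)) 0 with h | h
      · rw [h, mul_zero]; exact sndLaw_nonneg hP.1 _
      · rw [div_mul_cancel₀ _ h])
    (by
      rw [sum_arrow_prod] at hn
      refine le_trans (le_of_eq ?_) hn
      refine Finset.sum_congr rfl fun s _ => Finset.sum_congr rfl fun u _ => ?_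
      simp only [T]
      congr 1
      rw [← Finset.prod_mul_distrib]
      exact Finset.prod_congr rfl fun i _ => by rw [← hPdef, lawXYU]) N
  have hNle : (N : ℝ) ≤ 2 ^ ((n : ℝ) * (I + η)) := by
    have h1 : (1 : ℝ) ≤ 2 ^ ((n : ℝ) * (I + 2 * ζ)) :=
      Real.one_le_rpow (by norm_num) (by positivity)
    have h2 : (N : ℝ) ≤ 2 ^ ((n : ℝ) * (I + 2 * ζ)) * 2 := by
      have := (Nat.ceil_lt_add_one (zero_le_one.trans h1)).le
      rw [← hN] at this
      linarith
    refine h2.trans ?_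
    rw [← Real.rpow_add_one (by norm_num)]
    refine Real.rpow_le_rpow_of_exponent_le (by norm_num) ?_
    have : η = 4 * ζ := by rw [hζ]; ring
    rw [this]
    nlinarith
  have hpow : (1 - (2 : ℝ) ^ ((n : ℝ) * (-I - ζ)) / 2) ^ N ≤ δ / 2 := by
    refine le_trans ?_ hn1
    set c := (2 : ℝ) ^ ((n : ℝ) * (-I - ζ)) with hc
    have hc1 : c ≤ 1 := Real.rpow_le_one_of_one_le_of_nonpos (by norm_num)
      (mul_nonpos_of_nonneg_of_nonpos (by positivity) (by linarith))
    have hc0 : 0 < c := by positivity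
    have h1 : (2 : ℝ) ^ ((n : ℝ) * ζ) ≤ N * c := by
      calc (2 : ℝ) ^ ((n : ℝ) * ζ) = 2 ^ ((n : ℝ) * (I + 2 * ζ)) * c := by
            rw [hc, ← Real.rpow_add (by norm_num)]; ring_nf
        _ ≤ N * c := mul_le_mul_of_nonneg_right (Nat.le_ceil _) hc0.le
    calc (1 - c / 2) ^ N ≤ Real.exp (-(c / 2)) ^ N :=
          pow_le_pow_left₀ (by linarith) (Real.one_sub_le_exp_neg _) N
      _ = Real.exp (-(N * c / 2)) := by rw [← Real.exp_nat_mul]; ring_nf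
      _ ≤ _ := by gcongr
  let zip : (Fin n → 𝒳) → (Fin n → 𝒴) → Fin n → 𝒳 × 𝒴 := fun x y i => (x i, y i)
  let φ : (Fin n → 𝒳) → (Fin n → 𝒴) → Option (Fin N) := fun x y =>
    if h : ∃ l, T (zip x y) (u l) then some h.choose else none
  have hφ : ∀ {x y l}, φ x y = some l → T (zip x y) (u l) := by
    intro x y l h
    simp only [φ] at h
    split_ifs at h with h1
    rw [← Option.some.inj h]
    exact h1.choose_spec
  have hφT : ∀ {x y}, (φ x y).isSome → ∃ l, T (zip x y) (u l) := by
    intro x y h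
    obtain ⟨l, hl⟩ := Option.isSome_iff_exists.mp h
    exact ⟨l, hφ hl⟩
  have hζη : ζ ≤ η := by rw [hζ]; linarith
  refine ⟨N, φ, hNle, ?_, ?_, ?_, ?_, ?_, ?_, ?_⟩
  · have h1 : (∑ s : Fin n → 𝒳 × 𝒴, if ∃ l, T s (u l) then 0 else ∏ i, p (s i)) ≤ δ := by
      refine le_trans (le_of_eq ?_) (hu.trans (by linarith))
      exact Finset.sum_congr rfl fun s _ => by congr
    rw [sum_arrow_prod] at h1
    refine le_trans (le_of_eq ?_) h1
    refine Finset.sum_congr rfl fun x _ => Finset.sum_congr rfl fun y _ => ?_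
    by_cases h : ∃ l, T (zip x y) (u l)
    · rw [if_pos h, if_pos (by simp [φ, h])]
    · rw [if_neg h, if_neg (by simp [φ, h])]
  · intro l
    refine card_le_of_condEnt (P := P) (fun z : (𝒳 × 𝒴) × ι => z.1.1) (fun z => z.2)
      hP.1 (u l) hζη _ ?_
    intro x hx
    obtain ⟨y, hy⟩ := (Finset.mem_filter.mp hx).2
    exact hφ hy 0
  · intro l
    refine card_le_of_condEnt (P := P) (fun z : (𝒳 × 𝒴) × ι => z.1.2) (fun z => z.2)
      hP.1 (u l) hζη _ ?_
    intro x hx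
    obtain ⟨y, hy⟩ := (Finset.mem_filter.mp hx).2
    exact hφ hy 1
  · intro l y
    refine card_le_of_condEnt (P := P) (fun z : (𝒳 × 𝒴) × ι => z.1.1) (fun z => (z.1.2, z.2))
      hP.1 (fun i => (y i, u l i)) hζη _ ?_
    intro x hx
    exact hφ (Finset.mem_filter.mp hx).2 2
  · intro l x
    refine card_le_of_condEnt (P := P) (fun z : (𝒳 × 𝒴) × ι => z.1.2) (fun z => (z.1.1, z.2))
      hP.1 (fun i => (x i, u l i)) hζη _ ?_
    intro y hy
    exact hφ (Finset.mem_filter.mp hy).2 3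
  · intro y
    refine card_le_of_condEnt (P := P) (fun z : (𝒳 × 𝒴) × ι => z.1.1) (fun z => z.1.2)
      hP.1 y hζη _ ?_
    intro x hx
    obtain ⟨l, hl⟩ := hφT (Finset.mem_filter.mp hx).2
    exact hl 4
  · intro x
    refine card_le_of_condEnt (P := P) (fun z : (𝒳 × 𝒴) × ι => z.1.2) (fun z => z.1.1)
      hP.1 x hζη _ ?_
    intro y hy
    obtain ⟨l, hl⟩ := hφT (Finset.mem_filter.mp hy).2
    exact hl 5

end Typical

/-! ### Collisions of independent random hash functions -/

section Hashing

/-- A colliding function together with a free value for f(k) is the same as an arbitrary function: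
f(k) is recovered from f(k'). -/
lemma card_collision {K : Type*} [Fintype K] [DecidableEq K] {m : ℕ} {k k' : K} (h : k ≠ k') :
    (Finset.univ.filter fun f : K → Fin m => f k = f k').card * m =
      Fintype.card (K → Fin m) := by
  let e : {f : K → Fin m // f k = f k'} × Fin m ≃ (K → Fin m) :=
    { toFun := fun z => Function.update z.1.1 k z.2
      invFun := fun f => (⟨Function.update f k (f k'), by simp [h.symm]⟩, f k)
      left_inv := by
        rintro ⟨⟨f, hf⟩, c⟩
        ext1
        · simp [h.symm, ← hf]
        · simp
      right_inv := fun f => by simp }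
  rw [← Fintype.card_congr e, Fintype.card_prod, Fintype.card_fin, Fintype.card_subtype]

variable {ι K : Type*} [Fintype ι] [DecidableEq ι] [Fintype K] [DecidableEq K] {m : ι → ℕ}

/-- Independence: the sum over families of functions factors into one collision count for each j. -/
lemma sum_collision (hm : ∀ j, 0 < m j) (J : Finset ι) (k k' : ι → K)
    (hk : ∀ j ∈ J, k j ≠ k' j) :
    ∑ ω : (j : ι) → K → Fin (m j), (if ∀ j ∈ J, ω j (k j) = ω j (k' j) then (1 : ℝ) else 0) =
      Fintype.card ((j : ι) → K → Fin (m j)) * ∏ j ∈ J, (m j : ℝ)⁻¹ := by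
  have h1 : ∀ ω : (j : ι) → K → Fin (m j),
      (if ∀ j ∈ J, ω j (k j) = ω j (k' j) then (1 : ℝ) else 0) =
        ∏ j, (if j ∈ J → ω j (k j) = ω j (k' j) then (1 : ℝ) else 0) := by
    intro ω
    rw [Fintype.prod_ite_zero]
    simp
  simp only [h1]
  rw [← Fintype.prod_sum fun j (f : K → Fin (m j)) =>
    if j ∈ J → f (k j) = f (k' j) then (1 : ℝ) else 0]
  have h2 : ∀ j, ∑ f : K → Fin (m j), (if j ∈ J → f (k j) = f (k' j) then (1 : ℝ) else 0) =
      Fintype.card (K → Fin (m j)) * if j ∈ J then (m j : ℝ)⁻¹ else 1 := by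
    intro j
    by_cases hj : j ∈ J
    · have h3 := card_collision (m := m j) (hk j hj)
      have h4 : (m j : ℝ) ≠ 0 := by exact_mod_cast (hm j).ne'
      simp only [hj, true_imp_iff, if_true, Finset.sum_boole]
      rw [← h3]
      push_cast
      field_simp
    · simp [hj]
  simp only [h2, Finset.prod_mul_distrib]
  rw [Fintype.card_pi]
  push_cast
  congr 1
  rw [Finset.prod_ite_mem, Finset.univ_inter]

open Classical in
/-- The indicator of a proposition. -/
noncomputable def ind (P : Prop) : ℝ := if P then 1 else 0

lemma ind_of_true {P : Prop} (h : P) : ind P = 1 := if_pos h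

lemma ind_of_false {P : Prop} (h : ¬ P) : ind P = 0 := if_neg h

lemma ind_nonneg (P : Prop) : 0 ≤ ind P := by
  rw [ind]; positivity

lemma ind_le_add {P Q R : Prop} (h : P → Q ∨ R) : ind P ≤ ind Q + ind R := by
  by_cases hP : P
  · rw [ind_of_true hP]
    rcases h hP with hQ | hR
    · rw [ind_of_true hQ]; linarith [ind_nonneg R]
    · rw [ind_of_true hR]; linarith [ind_nonneg Q]
  · rw [ind_of_false hP]
    exact add_nonneg (ind_nonneg Q) (ind_nonneg R)

lemma ind_exists_le {κ : Type*} (C : Finset κ) (P : κ → Prop) :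
    ind (∃ c ∈ C, P c) ≤ ∑ c ∈ C, ind (P c) := by
  by_cases h : ∃ c ∈ C, P c
  · obtain ⟨c, hc, hcc⟩ := h
    have := Finset.single_le_sum (f := fun c => ind (P c)) (fun c _ => ind_nonneg _) hc
    rw [ind_of_true ⟨c, hc, hcc⟩, ← ind_of_true hcc]
    exact this
  · rw [ind_of_false h]
    exact Finset.sum_nonneg fun c _ => ind_nonneg _

/-- Union bound over competing keys for random hash functions. -/
lemma sum_exists_collision_le (hm : ∀ j, 0 < m j) {κ : Type*} (C : Finset κ) (J : Finset ι)
    (k : ι → K) (k' : κ → ι → K) (hk : ∀ c ∈ C, ∀ j ∈ J, k j ≠ k' c j) {b : ℝ}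
    (hC : (C.card : ℝ) ≤ b) :
    ∑ ω : (j : ι) → K → Fin (m j), ind (∃ c ∈ C, ∀ j ∈ J, ω j (k j) = ω j (k' c j)) ≤
      Fintype.card ((j : ι) → K → Fin (m j)) * (b * ∏ j ∈ J, (m j : ℝ)⁻¹) := by
  calc _ ≤ ∑ ω : (j : ι) → K → Fin (m j), ∑ c ∈ C, ind (∀ j ∈ J, ω j (k j) = ω j (k' c j)) :=
        Finset.sum_le_sum fun ω _ => ind_exists_le C _
    _ = ∑ c ∈ C, Fintype.card ((j : ι) → K → Fin (m j)) * ∏ j ∈ J, (m j : ℝ)⁻¹ := by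
        rw [Finset.sum_comm]
        refine Finset.sum_congr rfl fun c hc => ?_
        rw [← sum_collision hm J k (k' c) (hk c hc)]
        exact Finset.sum_congr rfl fun ω _ => by rw [ind]; congr
    _ = Fintype.card ((j : ι) → K → Fin (m j)) * (C.card * ∏ j ∈ J, (m j : ℝ)⁻¹) := by
        rw [Finset.sum_const, nsmul_eq_mul]; ring
    _ ≤ _ := by
        have : 0 ≤ ∏ j ∈ J, (m j : ℝ)⁻¹ := Finset.prod_nonneg fun j _ => by positivity
        gcongr

end Hashing

/-! ### The one-shot hashing code -/

section HashCode

variable {A B L : Type*}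

/-- The part of `(l, a, b)` that is hashed by each of the eight hash functions: the first four make
up the common message, the others the private messages. -/
def hashKey (l : Option L) (a : A) (b : B) : Fin 8 → Option L × Option A × Option B :=
  ![(l, none, none), (l, some a, none), (l, none, some b), (none, some a, some b),
    (none, some a, none), (none, none, some b), (none, some a, none), (none, none, some b)]

variable (φ : A → B → Option L) {m : Fin 8 → ℕ}
  (ω : (j : Fin 8) → Option L × Option A × Option B → Fin (m j))

/-- Some `a' ≠ a` is confused with `a` by the first decoder. -/
def Confused1 (a : A) (b : B) : Prop :=
  ∃ a' b', (φ a' b').isSome ∧ a' ≠ a ∧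
    ∀ j ∈ ({0, 1, 4} : Finset (Fin 8)), ω j (hashKey (φ a b) a b j) = ω j (hashKey (φ a' b') a' b' j)

/-- Some `b' ≠ b` is confused with `b` by the second decoder. -/
def Confused2 (a : A) (b : B) : Prop :=
  ∃ a' b', (φ a' b').isSome ∧ b' ≠ b ∧
    ∀ j ∈ ({0, 2, 5} : Finset (Fin 8)), ω j (hashKey (φ a b) a b j) = ω j (hashKey (φ a' b') a' b' j)

/-- Some `a' ≠ a` is confused with `a` by the third decoder. -/
def Confused3 (a : A) (b : B) : Prop :=
  ∃ a', (φ a' b).isSome ∧ a' ≠ a ∧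
    ∀ j ∈ ({0, 1, 2, 3, 6} : Finset (Fin 8)),
      ω j (hashKey (φ a b) a b j) = ω j (hashKey (φ a' b) a' b j)

/-- Some `b' ≠ b` is confused with `b` by the fourth decoder. -/
def Confused4 (a : A) (b : B) : Prop :=
  ∃ b', (φ a b').isSome ∧ b' ≠ b ∧
    ∀ j ∈ ({0, 1, 2, 3, 7} : Finset (Fin 8)),
      ω j (hashKey (φ a b) a b j) = ω j (hashKey (φ a b') a b' j)

variable [Fintype A] [Fintype B] [Fintype L]

open Classical in
-- A competitor with another index l' has three fresh hashes, and there are at most |L| c such pairs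
-- (l',a'). One with the same index agrees in hash 0 for free, so only hashes 1 and 4 help, but
-- there are at most c of them. Ambiguity in l or b alone is no error.
lemma sum_confused1_le (hm : ∀ j, 0 < m j) {c : ℝ}
    (hc : ∀ l, ((Finset.univ.filter fun a => ∃ b, φ a b = some l).card : ℝ) ≤ c) {a : A} {b : B}
    (hab : (φ a b).isSome) :
    ∑ ω : (j : Fin 8) → Option L × Option A × Option B → Fin (m j),
      ind (Confused1 φ ω a b) ≤
      Fintype.card ((j : Fin 8) → Option L × Option A × Option B → Fin (m j)) *
        (Fintype.card L * c * ∏ j ∈ {0, 1, 4}, (m j : ℝ)⁻¹ + c * ∏ j ∈ {1, 4}, (m j : ℝ)⁻¹) := by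
  obtain ⟨l, hl⟩ := Option.isSome_iff_exists.mp hab
  let D : Finset (L × A) := Finset.univ.filter fun z => (∃ b, φ z.2 b = some z.1) ∧ z.1 ≠ l ∧ z.2 ≠ a
  let D' : Finset A := Finset.univ.filter fun a' => (∃ b, φ a' b = some l) ∧ a' ≠ a
  have hD : (D.card : ℝ) ≤ Fintype.card L * c := by
    have h1 : D.card ≤ ∑ l : L, (Finset.univ.filter fun a => ∃ b, φ a b = some l).card := by
      rw [← Finset.card_sigma]
      refine Finset.card_le_card_of_injOn (fun z => ⟨z.1, z.2⟩) ?_ ?_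
      · intro z hz
        simp only [D, Finset.coe_filter, Finset.mem_univ, true_and, Set.mem_ofPred_eq] at hz
        simp [hz.1]
      · rintro ⟨z, z'⟩ _ ⟨y, y'⟩ _ h
        simpa using h
    calc (D.card : ℝ) ≤ ∑ l : L, ((Finset.univ.filter fun a => ∃ b, φ a b = some l).card : ℝ) := by
          exact_mod_cast h1
      _ ≤ ∑ l : L, c := Finset.sum_le_sum fun l _ => hc l
      _ = _ := by simp
  have hD' : (D'.card : ℝ) ≤ c := by
    refine le_trans ?_ (hc l)
    refine Nat.cast_le.mpr (Finset.card_le_card fun a' ha' => ?_)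
    exact Finset.mem_filter.mpr ⟨Finset.mem_univ _, (Finset.mem_filter.mp ha').2.1⟩
  have h1 := sum_exists_collision_le hm D {0, 1, 4} (hashKey (some l) a b)
    (fun z => hashKey (some z.1) z.2 b) (fun z hz j hj => by
      obtain ⟨-, h2, h3⟩ := (Finset.mem_filter.mp hz).2
      simp only [Finset.mem_insert, Finset.mem_singleton] at hj
      rcases hj with rfl | rfl | rfl <;> simp [hashKey, h2.symm, h3.symm]) hD
  have h2 := sum_exists_collision_le hm D' {1, 4} (hashKey (some l) a b)
    (fun z => hashKey (some l) z b) (fun z hz j hj => by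
      obtain ⟨-, h3⟩ := (Finset.mem_filter.mp hz).2
      simp only [Finset.mem_insert, Finset.mem_singleton] at hj
      rcases hj with rfl | rfl <;> simp [hashKey, h3.symm]) hD'
  rw [mul_add]
  refine le_trans ?_ (add_le_add h1 h2)
  rw [← Finset.sum_add_distrib]
  refine Finset.sum_le_sum fun ω _ => ind_le_add ?_
  rintro ⟨a', b', hs, hne, hj⟩
  obtain ⟨l', hl'⟩ := Option.isSome_iff_exists.mp hs
  rw [hl, hl'] at hj
  -- None of these keys involves b, so b' may be replaced by b and competitors counted as pairs
  -- (l',a').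
  have hj' : ∀ j ∈ ({0, 1, 4} : Finset (Fin 8)),
      ω j (hashKey (some l) a b j) = ω j (hashKey (some l') a' b j) := by
    intro j hjm
    rw [hj j hjm]
    simp only [Finset.mem_insert, Finset.mem_singleton] at hjm
    rcases hjm with rfl | rfl | rfl <;> simp [hashKey]
  by_cases hll : l' = l
  · subst hll
    refine Or.inr ⟨a', Finset.mem_filter.mpr ⟨Finset.mem_univ _, ⟨b', hl'⟩, hne⟩, fun j hjm => ?_⟩
    refine hj' j ?_
    simp only [Finset.mem_insert, Finset.mem_singleton] at hjm ⊢
    tauto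
  · exact Or.inl
      ⟨(l', a'), Finset.mem_filter.mpr ⟨Finset.mem_univ _, ⟨b', hl'⟩, hll, hne⟩, hj'⟩

open Classical in
lemma sum_confused2_le (hm : ∀ j, 0 < m j) {c : ℝ}
    (hc : ∀ l, ((Finset.univ.filter fun b => ∃ a, φ a b = some l).card : ℝ) ≤ c) {a : A} {b : B}
    (hab : (φ a b).isSome) :
    ∑ ω : (j : Fin 8) → Option L × Option A × Option B → Fin (m j),
      ind (Confused2 φ ω a b) ≤
      Fintype.card ((j : Fin 8) → Option L × Option A × Option B → Fin (m j)) *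
        (Fintype.card L * c * ∏ j ∈ {0, 2, 5}, (m j : ℝ)⁻¹ + c * ∏ j ∈ {2, 5}, (m j : ℝ)⁻¹) := by
  obtain ⟨l, hl⟩ := Option.isSome_iff_exists.mp hab
  let D : Finset (L × B) := Finset.univ.filter fun z => (∃ a, φ a z.2 = some z.1) ∧ z.1 ≠ l ∧ z.2 ≠ b
  let D' : Finset B := Finset.univ.filter fun b' => (∃ a, φ a b' = some l) ∧ b' ≠ b
  have hD : (D.card : ℝ) ≤ Fintype.card L * c := by
    have h1 : D.card ≤ ∑ l : L, (Finset.univ.filter fun b => ∃ a, φ a b = some l).card := by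
      rw [← Finset.card_sigma]
      refine Finset.card_le_card_of_injOn (fun z => ⟨z.1, z.2⟩) ?_ ?_
      · intro z hz
        simp only [D, Finset.coe_filter, Finset.mem_univ, true_and, Set.mem_ofPred_eq] at hz
        simp [hz.1]
      · rintro ⟨z, z'⟩ _ ⟨y, y'⟩ _ h
        simpa using h
    calc (D.card : ℝ) ≤ ∑ l : L, ((Finset.univ.filter fun b => ∃ a, φ a b = some l).card : ℝ) := by
          exact_mod_cast h1
      _ ≤ ∑ l : L, c := Finset.sum_le_sum fun l _ => hc l
      _ = _ := by simp
  have hD' : (D'.card : ℝ) ≤ c := by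
    refine le_trans ?_ (hc l)
    refine Nat.cast_le.mpr (Finset.card_le_card fun a' ha' => ?_)
    exact Finset.mem_filter.mpr ⟨Finset.mem_univ _, (Finset.mem_filter.mp ha').2.1⟩
  have h1 := sum_exists_collision_le hm D {0, 2, 5} (hashKey (some l) a b)
    (fun z => hashKey (some z.1) a z.2) (fun z hz j hj => by
      obtain ⟨-, h2, h3⟩ := (Finset.mem_filter.mp hz).2
      simp only [Finset.mem_insert, Finset.mem_singleton] at hj
      rcases hj with rfl | rfl | rfl <;> simp [hashKey, h2.symm, h3.symm]) hD
  have h2 := sum_exists_collision_le hm D' {2, 5} (hashKey (some l) a b)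
    (fun z => hashKey (some l) a z) (fun z hz j hj => by
      obtain ⟨-, h3⟩ := (Finset.mem_filter.mp hz).2
      simp only [Finset.mem_insert, Finset.mem_singleton] at hj
      rcases hj with rfl | rfl <;> simp [hashKey, h3.symm]) hD'
  rw [mul_add]
  refine le_trans ?_ (add_le_add h1 h2)
  rw [← Finset.sum_add_distrib]
  refine Finset.sum_le_sum fun ω _ => ind_le_add ?_
  rintro ⟨a', b', hs, hne, hj⟩
  obtain ⟨l', hl'⟩ := Option.isSome_iff_exists.mp hs
  rw [hl, hl'] at hj
  have hj' : ∀ j ∈ ({0, 2, 5} : Finset (Fin 8)),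
      ω j (hashKey (some l) a b j) = ω j (hashKey (some l') a b' j) := by
    intro j hjm
    rw [hj j hjm]
    simp only [Finset.mem_insert, Finset.mem_singleton] at hjm
    rcases hjm with rfl | rfl | rfl <;> simp [hashKey]
  by_cases hll : l' = l
  · subst hll
    refine Or.inr ⟨b', Finset.mem_filter.mpr ⟨Finset.mem_univ _, ⟨a', hl'⟩, hne⟩, fun j hjm => ?_⟩
    refine hj' j ?_
    simp only [Finset.mem_insert, Finset.mem_singleton] at hjm ⊢
    tauto
  · exact Or.inl
      ⟨(l', b'), Finset.mem_filter.mpr ⟨Finset.mem_univ _, ⟨a', hl'⟩, hll, hne⟩, hj'⟩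

open Classical in
-- As b is known, a' determines its index φ(a',b). If that differs from l, all five hashes are
-- fresh. If it equals l, the keys (l) and (l,b) of hashes 0 and 2 agree for free, leaving hashes 1,
-- 3 and 6.
lemma sum_confused3_le (hm : ∀ j, 0 < m j) {c c' : ℝ}
    (hc : ∀ b, ((Finset.univ.filter fun a => (φ a b).isSome).card : ℝ) ≤ c)
    (hc' : ∀ l b, ((Finset.univ.filter fun a => φ a b = some l).card : ℝ) ≤ c') {a : A} {b : B}
    (hab : (φ a b).isSome) :
    ∑ ω : (j : Fin 8) → Option L × Option A × Option B → Fin (m j),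
      ind (Confused3 φ ω a b) ≤
      Fintype.card ((j : Fin 8) → Option L × Option A × Option B → Fin (m j)) *
        (c * ∏ j ∈ {0, 1, 2, 3, 6}, (m j : ℝ)⁻¹ + c' * ∏ j ∈ {1, 3, 6}, (m j : ℝ)⁻¹) := by
  obtain ⟨l, hl⟩ := Option.isSome_iff_exists.mp hab
  let D : Finset A := Finset.univ.filter fun a' => (φ a' b).isSome ∧ φ a' b ≠ some l ∧ a' ≠ a
  let D' : Finset A := Finset.univ.filter fun a' => φ a' b = some l ∧ a' ≠ a
  have hD : (D.card : ℝ) ≤ c := by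
    refine le_trans ?_ (hc b)
    refine Nat.cast_le.mpr (Finset.card_le_card fun a' ha' => ?_)
    exact       Finset.mem_filter.mpr ⟨Finset.mem_univ _, (Finset.mem_filter.mp ha').2.1⟩
  have hD' : (D'.card : ℝ) ≤ c' := by
    refine le_trans ?_ (hc' l b)
    refine Nat.cast_le.mpr (Finset.card_le_card fun a' ha' => ?_)
    exact       Finset.mem_filter.mpr ⟨Finset.mem_univ _, (Finset.mem_filter.mp ha').2.1⟩
  have h1 := sum_exists_collision_le hm D {0, 1, 2, 3, 6} (hashKey (some l) a b)
    (fun z => hashKey (φ z b) z b) (fun z hz j hj => by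
      obtain ⟨-, h2, h3⟩ := (Finset.mem_filter.mp hz).2
      simp only [Finset.mem_insert, Finset.mem_singleton] at hj
      rcases hj with rfl | rfl | rfl | rfl | rfl <;> simp [hashKey, h2.symm, h3.symm]) hD
  have h2 := sum_exists_collision_le hm D' {1, 3, 6} (hashKey (some l) a b)
    (fun z => hashKey (φ z b) z b) (fun z hz j hj => by
      obtain ⟨-, h3⟩ := (Finset.mem_filter.mp hz).2
      simp only [Finset.mem_insert, Finset.mem_singleton] at hj
      rcases hj with rfl | rfl | rfl <;> simp [hashKey, h3.symm]) hD'
  rw [mul_add]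
  refine le_trans ?_ (add_le_add h1 h2)
  rw [← Finset.sum_add_distrib]
  refine Finset.sum_le_sum fun ω _ => ind_le_add ?_
  rintro ⟨a', hs, hne, hj⟩
  rw [hl] at hj
  by_cases hll : φ a' b = some l
  · refine Or.inr ⟨a', Finset.mem_filter.mpr ⟨Finset.mem_univ _, hll, hne⟩, fun j hjm => ?_⟩
    refine hj j ?_
    simp only [Finset.mem_insert, Finset.mem_singleton] at hjm ⊢
    tauto
  · exact Or.inl ⟨a', Finset.mem_filter.mpr ⟨Finset.mem_univ _, hs, hll, hne⟩, hj⟩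

open Classical in
lemma sum_confused4_le (hm : ∀ j, 0 < m j) {c c' : ℝ}
    (hc : ∀ a, ((Finset.univ.filter fun b => (φ a b).isSome).card : ℝ) ≤ c)
    (hc' : ∀ l a, ((Finset.univ.filter fun b => φ a b = some l).card : ℝ) ≤ c') {a : A} {b : B}
    (hab : (φ a b).isSome) :
    ∑ ω : (j : Fin 8) → Option L × Option A × Option B → Fin (m j),
      ind (Confused4 φ ω a b) ≤
      Fintype.card ((j : Fin 8) → Option L × Option A × Option B → Fin (m j)) *
        (c * ∏ j ∈ {0, 1, 2, 3, 7}, (m j : ℝ)⁻¹ + c' * ∏ j ∈ {2, 3, 7}, (m j : ℝ)⁻¹) := by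
  obtain ⟨l, hl⟩ := Option.isSome_iff_exists.mp hab
  let D : Finset B := Finset.univ.filter fun b' => (φ a b').isSome ∧ φ a b' ≠ some l ∧ b' ≠ b
  let D' : Finset B := Finset.univ.filter fun b' => φ a b' = some l ∧ b' ≠ b
  have hD : (D.card : ℝ) ≤ c := by
    refine le_trans ?_ (hc a)
    refine Nat.cast_le.mpr (Finset.card_le_card fun a' ha' => ?_)
    exact       Finset.mem_filter.mpr ⟨Finset.mem_univ _, (Finset.mem_filter.mp ha').2.1⟩
  have hD' : (D'.card : ℝ) ≤ c' := by
    refine le_trans ?_ (hc' l a)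
    refine Nat.cast_le.mpr (Finset.card_le_card fun a' ha' => ?_)
    exact       Finset.mem_filter.mpr ⟨Finset.mem_univ _, (Finset.mem_filter.mp ha').2.1⟩
  have h1 := sum_exists_collision_le hm D {0, 1, 2, 3, 7} (hashKey (some l) a b)
    (fun z => hashKey (φ a z) a z) (fun z hz j hj => by
      obtain ⟨-, h2, h3⟩ := (Finset.mem_filter.mp hz).2
      simp only [Finset.mem_insert, Finset.mem_singleton] at hj
      rcases hj with rfl | rfl | rfl | rfl | rfl <;> simp [hashKey, h2.symm, h3.symm]) hD
  have h2 := sum_exists_collision_le hm D' {2, 3, 7} (hashKey (some l) a b)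
    (fun z => hashKey (φ a z) a z) (fun z hz j hj => by
      obtain ⟨-, h3⟩ := (Finset.mem_filter.mp hz).2
      simp only [Finset.mem_insert, Finset.mem_singleton] at hj
      rcases hj with rfl | rfl | rfl <;> simp [hashKey, h3.symm]) hD'
  rw [mul_add]
  refine le_trans ?_ (add_le_add h1 h2)
  rw [← Finset.sum_add_distrib]
  refine Finset.sum_le_sum fun ω _ => ind_le_add ?_
  rintro ⟨b', hs, hne, hj⟩
  rw [hl] at hj
  by_cases hll : φ a b' = some l
  · refine Or.inr ⟨b', Finset.mem_filter.mpr ⟨Finset.mem_univ _, hll, hne⟩, fun j hjm => ?_⟩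
    refine hj j ?_
    simp only [Finset.mem_insert, Finset.mem_singleton] at hjm ⊢
    tauto
  · exact Or.inl ⟨b', Finset.mem_filter.mpr ⟨Finset.mem_univ _, hs, hll, hne⟩, hj⟩

/-- Any admissible x' compatible with the observation is picked; it is enough that all of them share
the target t, so x itself need not be determined. -/
lemma exists_decoder {X W A : Type*} [Nonempty A] (S : X → Prop) (c : X → W) (t : X → A) :
    ∃ dec : W → A, ∀ x, S x → (∀ x', S x' → c x' = c x → t x' = t x) → dec (c x) = t x := by
  classical
  refine ⟨fun w => if h : ∃ x, S x ∧ c x = w then t h.choose else Classical.arbitrary A,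
    fun x hx hu => ?_⟩
  have h : ∃ x', S x' ∧ c x' = c x := ⟨x, hx, rfl⟩
  simp only [dif_pos h]
  exact hu _ h.choose_spec.1 h.choose_spec.2

open Classical in
/-- A one-shot code obtained by random hashing. -/
lemma exists_oneShot_code [Nonempty A] [Nonempty B] (φ : A → B → Option L) {m : Fin 8 → ℕ}
    (hm : ∀ j, 0 < m j) {P : A → B → ℝ} (hP : ∀ a b, 0 ≤ P a b) (hP1 : ∑ a, ∑ b, P a b ≤ 1)
    {δ ε c₁ c₂ c₃ c₄ c₃' c₄' : ℝ}
    (hε0 : 0 ≤ ε) (hδ : ∑ a, ∑ b, (if (φ a b).isSome then 0 else P a b) ≤ δ)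
    (h₁ : ∀ l, ((Finset.univ.filter fun a => ∃ b, φ a b = some l).card : ℝ) ≤ c₁)
    (h₂ : ∀ l, ((Finset.univ.filter fun b => ∃ a, φ a b = some l).card : ℝ) ≤ c₂)
    (h₃ : ∀ b, ((Finset.univ.filter fun a => (φ a b).isSome).card : ℝ) ≤ c₃)
    (h₃' : ∀ l b, ((Finset.univ.filter fun a => φ a b = some l).card : ℝ) ≤ c₃')
    (h₄ : ∀ a, ((Finset.univ.filter fun b => (φ a b).isSome).card : ℝ) ≤ c₄)
    (h₄' : ∀ l a, ((Finset.univ.filter fun b => φ a b = some l).card : ℝ) ≤ c₄')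
    (hε₁ : Fintype.card L * c₁ * ∏ j ∈ {0, 1, 4}, (m j : ℝ)⁻¹ + c₁ * ∏ j ∈ {1, 4}, (m j : ℝ)⁻¹ ≤ ε)
    (hε₂ : Fintype.card L * c₂ * ∏ j ∈ {0, 2, 5}, (m j : ℝ)⁻¹ + c₂ * ∏ j ∈ {2, 5}, (m j : ℝ)⁻¹ ≤ ε)
    (hε₃ : c₃ * ∏ j ∈ {0, 1, 2, 3, 6}, (m j : ℝ)⁻¹ + c₃' * ∏ j ∈ {1, 3, 6}, (m j : ℝ)⁻¹ ≤ ε)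
    (hε₄ : c₄ * ∏ j ∈ {0, 1, 2, 3, 7}, (m j : ℝ)⁻¹ + c₄' * ∏ j ∈ {2, 3, 7}, (m j : ℝ)⁻¹ ≤ ε) :
    ∃ (e₀ : A → B → Fin (m 0) × Fin (m 1) × Fin (m 2) × Fin (m 3)) (e₁ : A → B → Fin (m 4))
      (e₂ : A → B → Fin (m 5)) (e₃ : A → B → Fin (m 6)) (e₄ : A → B → Fin (m 7))
      (d₁ : Fin (m 0) × Fin (m 1) × Fin (m 2) × Fin (m 3) → Fin (m 4) → A)
      (d₂ : Fin (m 0) × Fin (m 1) × Fin (m 2) × Fin (m 3) → Fin (m 5) → B)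
      (d₃ : Fin (m 0) × Fin (m 1) × Fin (m 2) × Fin (m 3) → Fin (m 6) → B → A)
      (d₄ : Fin (m 0) × Fin (m 1) × Fin (m 2) × Fin (m 3) → Fin (m 7) → A → B),
      ∑ a, ∑ b, (if d₁ (e₀ a b) (e₁ a b) = a ∧ d₂ (e₀ a b) (e₂ a b) = b ∧
        d₃ (e₀ a b) (e₃ a b) b = a ∧ d₄ (e₀ a b) (e₄ a b) a = b then 0 else P a b) ≤
        δ + 4 * ε := by
  set Ω := (j : Fin 8) → Option L × Option A × Option B → Fin (m j)
  have hne : Nonempty Ω := ⟨fun j _ => ⟨0, hm j⟩⟩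
  have hcard : (0 : ℝ) < Fintype.card Ω := by exact_mod_cast Fintype.card_pos
  let bad : Ω → A → B → ℝ := fun ω a b => ind (Confused1 φ ω a b) + ind (Confused2 φ ω a b) +
    ind (Confused3 φ ω a b) + ind (Confused4 φ ω a b)
  have hbad : ∀ a b, (φ a b).isSome → ∑ ω, bad ω a b ≤ Fintype.card Ω * (4 * ε) := by
    intro a b hab
    have g1 := (sum_confused1_le φ hm h₁ hab).trans (mul_le_mul_of_nonneg_left hε₁ hcard.le)
    have g2 := (sum_confused2_le φ hm h₂ hab).trans (mul_le_mul_of_nonneg_left hε₂ hcard.le)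
    have g3 := (sum_confused3_le φ hm h₃ h₃' hab).trans (mul_le_mul_of_nonneg_left hε₃ hcard.le)
    have g4 := (sum_confused4_le φ hm h₄ h₄' hab).trans (mul_le_mul_of_nonneg_left hε₄ hcard.le)
    simp only [bad, Finset.sum_add_distrib]
    linarith
  -- Some choice of hash functions does no worse than their average.
  obtain ⟨ω, hω⟩ : ∃ ω : Ω, ∑ a, ∑ b, (if (φ a b).isSome then P a b * bad ω a b else 0) ≤
      4 * ε := by
    have h : ∑ ω : Ω, ∑ a, ∑ b, (if (φ a b).isSome then P a b * bad ω a b else 0) ≤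
        ∑ ω : Ω, 4 * ε := by
      rw [Finset.sum_comm]
      calc _ ≤ ∑ a, ∑ b, P a b * (Fintype.card Ω * (4 * ε)) := by
            refine Finset.sum_le_sum fun a _ => ?_
            rw [Finset.sum_comm]
            refine Finset.sum_le_sum fun b _ => ?_
            by_cases hab : (φ a b).isSome
            · simp only [hab, if_true, ← Finset.mul_sum]
              exact mul_le_mul_of_nonneg_left (hbad a b hab) (hP a b)
            · simp only [hab]
              simpa using mul_nonneg (hP a b) (by positivity)
        _ = (∑ a, ∑ b, P a b) * (Fintype.card Ω * (4 * ε)) := by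
            simp only [Finset.sum_mul]
        _ ≤ 1 * (Fintype.card Ω * (4 * ε)) := mul_le_mul_of_nonneg_right hP1 (by positivity)
        _ = _ := by simp
    obtain ⟨ω, -, hω⟩ := Finset.exists_le_of_sum_le Finset.univ_nonempty h
    exact ⟨ω, hω⟩
  let e : (j : Fin 8) → A → B → Fin (m j) := fun j a b => ω j (hashKey (φ a b) a b j)
  let e₀ : A → B → Fin (m 0) × Fin (m 1) × Fin (m 2) × Fin (m 3) := fun a b =>
    (e 0 a b, e 1 a b, e 2 a b, e 3 a b)
  let S : A × B → Prop := fun z => (φ z.1 z.2).isSome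
  obtain ⟨d₁, hd₁⟩ := exists_decoder S (fun z => (e₀ z.1 z.2, e 4 z.1 z.2)) Prod.fst
  obtain ⟨d₂, hd₂⟩ := exists_decoder S (fun z => (e₀ z.1 z.2, e 5 z.1 z.2)) Prod.snd
  obtain ⟨d₃, hd₃⟩ := exists_decoder S (fun z => (e₀ z.1 z.2, e 6 z.1 z.2, z.2)) Prod.fst
  obtain ⟨d₄, hd₄⟩ := exists_decoder S (fun z => (e₀ z.1 z.2, e 7 z.1 z.2, z.1)) Prod.snd
  refine ⟨e₀, e 4, e 5, e 6, e 7, fun w v => d₁ (w, v), fun w v => d₂ (w, v),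
    fun w v b => d₃ (w, v, b), fun w v a => d₄ (w, v, a), ?_⟩
  refine le_trans ?_ (add_le_add hδ hω)
  rw [← Finset.sum_add_distrib]
  refine Finset.sum_le_sum fun a _ => ?_
  rw [← Finset.sum_add_distrib]
  refine Finset.sum_le_sum fun b _ => ?_
  have i1 := ind_nonneg (Confused1 φ ω a b)
  have i2 := ind_nonneg (Confused2 φ ω a b)
  have i3 := ind_nonneg (Confused3 φ ω a b)
  have i4 := ind_nonneg (Confused4 φ ω a b)
  have hPab := hP a b
  by_cases hab : (φ a b).isSome
  swap
  · rw [if_neg hab, if_neg hab, add_zero]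
    split_ifs
    exacts [hPab, le_rfl]
  simp only [hab, if_true, zero_add]
  have hb0 : 0 ≤ bad ω a b := by simp only [bad]; positivity
  -- `bad` counts the confused decoders: either it is at least 1 and pays for the mass of (a,b), or
  -- no decoder is confused and all succeed.
  by_cases hgood : 1 ≤ bad ω a b
  · split_ifs
    · positivity
    · nlinarith
  have hnot : ∀ {Q : Prop}, ind Q ≤ bad ω a b → ¬ Q := fun h hQ => by
    rw [ind_of_true hQ] at h; exact hgood h
  have n1 : ¬ Confused1 φ ω a b := hnot (by simp only [bad]; linarith)
  have n2 : ¬ Confused2 φ ω a b := hnot (by simp only [bad]; linarith)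
  have n3 : ¬ Confused3 φ ω a b := hnot (by simp only [bad]; linarith)
  have n4 : ¬ Confused4 φ ω a b := hnot (by simp only [bad]; linarith)
  rw [if_pos]
  · exact mul_nonneg hPab hb0
  refine ⟨?_, ?_, ?_, ?_⟩
  · refine hd₁ (a, b) hab fun z hz h => ?_
    by_contra hne
    simp only [e₀, e, Prod.mk.injEq] at h
    refine n1 ⟨z.1, z.2, hz, hne, fun j hj => ?_⟩
    simp only [Finset.mem_insert, Finset.mem_singleton] at hj
    rcases hj with rfl | rfl | rfl
    exacts [h.1.1.symm, h.1.2.1.symm, h.2.symm]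
  · refine hd₂ (a, b) hab fun z hz h => ?_
    by_contra hne
    simp only [e₀, e, Prod.mk.injEq] at h
    refine n2 ⟨z.1, z.2, hz, hne, fun j hj => ?_⟩
    simp only [Finset.mem_insert, Finset.mem_singleton] at hj
    rcases hj with rfl | rfl | rfl
    exacts [h.1.1.symm, h.1.2.2.1.symm, h.2.symm]
  · refine hd₃ (a, b) hab fun z hz h => ?_
    by_contra hne
    obtain ⟨a', b'⟩ := z
    simp only [e₀, e, Prod.mk.injEq] at h
    obtain ⟨⟨g0, g1, g2, g3⟩, g6, rfl⟩ := h
    refine n3 ⟨a', hz, hne, fun j hj => ?_⟩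
    simp only [Finset.mem_insert, Finset.mem_singleton] at hj
    rcases hj with rfl | rfl | rfl | rfl | rfl
    exacts [g0.symm, g1.symm, g2.symm, g3.symm, g6.symm]
  · refine hd₄ (a, b) hab fun z hz h => ?_
    by_contra hne
    obtain ⟨a', b'⟩ := z
    simp only [e₀, e, Prod.mk.injEq] at h
    obtain ⟨⟨g0, g1, g2, g3⟩, g7, rfl⟩ := h
    refine n4 ⟨b', hz, hne, fun j hj => ?_⟩
    simp only [Finset.mem_insert, Finset.mem_singleton] at hj
    rcases hj with rfl | rfl | rfl | rfl | rfl
    exacts [g0.symm, g1.symm, g2.symm, g3.symm, g7.symm]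

end HashCode

/-! ### Exponents of the quantizer in terms of the region -/

section Identities

lemma push_graphLaw_apply {A B Z : Type*} [Fintype Z] [DecidableEq A] [DecidableEq B]
    (f : Z → A) (g : Z → B) (P : Z → ℝ) (a : A) (b : B) :
    push f (graphLaw g P) (a, b) = ∑ z, if f z = a then if g z = b then P z else 0 else 0 := by
  simp only [push, graphLaw]
  exact Finset.sum_congr rfl fun z _ => by congr

lemma condEnt_fst_aux {𝒳 𝒴 ι : Type*} [Fintype 𝒳] [Fintype 𝒴] [Fintype ι] [DecidableEq 𝒳]
    [DecidableEq ι] (p : 𝒳 × 𝒴 → ℝ) (q : 𝒳 × 𝒴 → ι → ℝ) :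
    condEnt (fun z => z.1.1) (fun z => z.2) (lawXYU p q) = condEntropy (lawXU p q) := by
  rw [condEnt]
  congr 1
  funext ⟨x, u⟩
  rw [push_graphLaw_apply, Fintype.sum_prod_type_right, lawXU]
  simp only [Fintype.sum_prod_type]
  rw [Finset.sum_eq_single u (fun v _ hv => by simp [hv]) (by simp), Finset.sum_comm]
  simp

lemma condEnt_snd_aux {𝒳 𝒴 ι : Type*} [Fintype 𝒳] [Fintype 𝒴] [Fintype ι] [DecidableEq 𝒴]
    [DecidableEq ι] (p : 𝒳 × 𝒴 → ℝ) (q : 𝒳 × 𝒴 → ι → ℝ) :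
    condEnt (fun z => z.1.2) (fun z => z.2) (lawXYU p q) = condEntropy (lawYU p q) := by
  rw [condEnt]
  congr 1
  funext ⟨x, u⟩
  simp [push_graphLaw_apply, Fintype.sum_prod_type, lawYU, lawXYU]

lemma condEnt_fst_snd {𝒳 𝒴 ι : Type*} [Fintype 𝒳] [Fintype 𝒴] [Fintype ι] [DecidableEq 𝒳]
    [DecidableEq 𝒴] {p : 𝒳 × 𝒴 → ℝ} {q : 𝒳 × 𝒴 → ι → ℝ} (hq : ∀ s, q s ∈ stdSimplex ℝ ι) :
    condEnt (fun z => z.1.1) (fun z => z.1.2) (lawXYU p q) = condEntropy p := by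
  rw [condEnt]
  congr 1
  funext ⟨x, y⟩
  rw [← congrFun (fstLaw_lawXYU (p := p) hq) (x, y)]
  simp only [push_graphLaw_apply, Fintype.sum_prod_type, fstLaw]
  rw [Finset.sum_eq_single x (fun v _ hv => by simp [hv]) (by simp),
    Finset.sum_eq_single y (fun v _ hv => by simp [hv]) (by simp)]
  simp

lemma condEnt_snd_fst {𝒳 𝒴 ι : Type*} [Fintype 𝒳] [Fintype 𝒴] [Fintype ι] [DecidableEq 𝒳]
    [DecidableEq 𝒴] {p : 𝒳 × 𝒴 → ℝ} {q : 𝒳 × 𝒴 → ι → ℝ} (hq : ∀ s, q s ∈ stdSimplex ℝ ι) :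
    condEnt (fun z => z.1.2) (fun z => z.1.1) (lawXYU p q) = condEntropy (p ∘ Prod.swap) := by
  rw [condEnt]
  congr 1
  funext ⟨y, x⟩
  rw [Function.comp_apply, Prod.swap_prod_mk, ← congrFun (fstLaw_lawXYU (p := p) hq) (x, y)]
  simp only [push_graphLaw_apply, Fintype.sum_prod_type, fstLaw]
  rw [Finset.sum_eq_single x (fun v _ hv => by simp [hv]) (by simp),
    Finset.sum_eq_single y (fun v _ hv => by simp [hv]) (by simp)]
  simp

variable {𝒳 𝒴 ι : Type*} [Fintype 𝒳] [Fintype 𝒴] [Fintype ι] [DecidableEq 𝒳] [DecidableEq 𝒴]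
  [DecidableEq ι] {p : 𝒳 × 𝒴 → ℝ} {q : 𝒳 × 𝒴 → ι → ℝ}

lemma condEntropy_lawXU_add (hp : ∀ s, 0 ≤ p s) (hq : ∀ s, q s ∈ stdSimplex ℝ ι) :
    condEntropy (lawXU p q) +
      condEnt (fun z => z.1.2) (fun z => (z.1.1, z.2)) (lawXYU p q) =
      condEntropy (lawXYU p q) := by
  rw [condEntropy_chain (lawXYU_nonneg hp hq)]
  congr 1
  rw [condEnt, ← condEntropy_comp_equiv (Equiv.prodComm ι 𝒳)]
  congr 1
  funext ⟨y, u, x⟩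
  simp [push_graphLaw_apply, Fintype.sum_prod_type, ite_and]

lemma condEntropy_lawYU_add (hp : ∀ s, 0 ≤ p s) (hq : ∀ s, q s ∈ stdSimplex ℝ ι) :
    condEntropy (lawYU p q) +
      condEnt (fun z => z.1.1) (fun z => (z.1.2, z.2)) (lawXYU p q) =
      condEntropy (lawXYU p q) := by
  rw [← condEntropy_comp_equiv_left (Equiv.prodComm 𝒴 𝒳) (lawXYU p q),
    condEntropy_chain fun z => lawXYU_nonneg hp hq _]
  congr 1
  rw [condEnt, ← condEntropy_comp_equiv (Equiv.prodComm ι 𝒴)]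
  congr 1
  funext ⟨x, u, y⟩
  simp [push_graphLaw_apply, Fintype.sum_prod_type, ite_and]

end Identities

/-! ### From exponents to rates and codes -/

section Rates

lemma inv_floor_le {x : ℝ} (hx : 0 ≤ x) : (⌊(2 : ℝ) ^ x⌋₊ : ℝ)⁻¹ ≤ 2 * 2 ^ (-x) := by
  have h1 : (1 : ℝ) ≤ 2 ^ x := Real.one_le_rpow (by norm_num) hx
  have h2 : (2 : ℝ) ^ x / 2 ≤ ⌊(2 : ℝ) ^ x⌋₊ := by
    have h3 := Nat.lt_floor_add_one ((2 : ℝ) ^ x)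
    have h4 : (1 : ℝ) ≤ ⌊(2 : ℝ) ^ x⌋₊ := by
      exact_mod_cast Nat.le_floor (by exact_mod_cast h1)
    linarith
  calc (⌊(2 : ℝ) ^ x⌋₊ : ℝ)⁻¹ ≤ ((2 : ℝ) ^ x / 2)⁻¹ := inv_anti₀ (by positivity) h2
    _ = 2 * 2 ^ (-x) := by rw [Real.rpow_neg (by norm_num), inv_div, div_eq_mul_inv]

/-- Each of at most eight floors loses a factor 2, whence 256 = 2⁸. Since J is nonempty, the hashes
have at least η to spare, which beats the η/2 in the count. -/
lemma mul_prod_inv_floor_le {n : ℕ} {s : Fin 8 → ℝ} (hs : ∀ j, 0 ≤ s j) {η : ℝ} (hη : 0 ≤ η)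
    {J : Finset (Fin 8)} (hJ : J.Nonempty) {c H : ℝ}
    (hc : c ≤ 2 ^ ((n : ℝ) * (H + η / 2))) (hH : H ≤ ∑ j ∈ J, s j) :
    c * ∏ j ∈ J, (⌊(2 : ℝ) ^ ((n : ℝ) * (s j + η))⌋₊ : ℝ)⁻¹ ≤ 256 * 2 ^ (-(n * (η / 2))) := by
  have h1 : ∏ j ∈ J, (⌊(2 : ℝ) ^ ((n : ℝ) * (s j + η))⌋₊ : ℝ)⁻¹ ≤
      256 * 2 ^ (-(n * (∑ j ∈ J, s j + η))) := by
    calc _ ≤ ∏ j ∈ J, (2 * (2 : ℝ) ^ (-((n : ℝ) * (s j + η)))) :=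
          Finset.prod_le_prod (fun j _ => by positivity) fun j _ =>
            inv_floor_le (mul_nonneg (by positivity) (add_nonneg (hs j) hη))
      _ = 2 ^ J.card * 2 ^ (∑ j ∈ J, -((n : ℝ) * (s j + η))) := by
          rw [Finset.prod_mul_distrib, Finset.prod_const, Real.rpow_sum_of_pos (by norm_num)]
      _ ≤ 2 ^ 8 * 2 ^ (-(n * (∑ j ∈ J, s j + η))) := by
          refine mul_le_mul (pow_le_pow_right₀ (by norm_num) (by simpa using J.card_le_univ))
            (Real.rpow_le_rpow_of_exponent_le (by norm_num) ?_) (by positivity) (by positivity)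
          rw [Finset.sum_neg_distrib, ← Finset.mul_sum, Finset.sum_add_distrib, Finset.sum_const,
            nsmul_eq_mul, neg_le_neg_iff]
          have h2 : (1 : ℝ) ≤ J.card := by exact_mod_cast hJ.card_pos
          refine mul_le_mul_of_nonneg_left ?_ (by positivity)
          nlinarith
      _ = _ := by norm_num
  calc _ ≤ 2 ^ ((n : ℝ) * (H + η / 2)) * (256 * 2 ^ (-(n * (∑ j ∈ J, s j + η)))) :=
        mul_le_mul hc h1 (Finset.prod_nonneg fun j _ => by positivity) (by positivity)
    _ = 256 * 2 ^ ((n : ℝ) * (H + η / 2) + -(n * (∑ j ∈ J, s j + η))) := by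
        rw [Real.rpow_add (by norm_num)]; ring
    _ ≤ _ := by
        refine mul_le_mul_of_nonneg_left ?_ (by norm_num)
        refine Real.rpow_le_rpow_of_exponent_le (by norm_num) ?_
        have : (n : ℝ) * H ≤ n * ∑ j ∈ J, s j := mul_le_mul_of_nonneg_left hH (by positivity)
        nlinarith

lemma exists_index_embedding {W : Type*} [Fintype W] [Nonempty W] {n : ℕ} {r : ℝ}
    (h : (Fintype.card W : ℝ) ≤ 2 ^ ((n : ℝ) * r)) :
    ∃ (i : W → Index n r) (d : Index n r → W), ∀ w, d (i w) = w := by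
  have h1 : Fintype.card W ≤ Fintype.card (Index n r) := by
    rw [Fintype.card_fin]
    exact Nat.le_floor h
  obtain ⟨i⟩ := Function.Embedding.nonempty_of_card_le h1
  exact ⟨i, Function.invFun i, Function.leftInverse_invFun i.injective⟩

lemma nonempty_index {n : ℕ} {r : ℝ} (hr : 0 ≤ r) : Nonempty (Index n r) :=
  ⟨⟨0, Nat.floor_pos.mpr (Real.one_le_rpow (by norm_num) (by positivity))⟩⟩

variable {𝒳 𝒴 : Type*} [Fintype 𝒳] [Fintype 𝒴] {p : 𝒳 × 𝒴 → ℝ}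

lemma Code.errorProb_nonneg (hp : ∀ s, 0 ≤ p s) {n : ℕ} {R : Fin 5 → ℝ} (c : Code 𝒳 𝒴 n R) :
    0 ≤ c.errorProb p :=
  Finset.sum_nonneg fun x _ => Finset.sum_nonneg fun y _ => by
    split_ifs
    exacts [le_rfl, Finset.prod_nonneg fun i _ => hp _]

/-- At each length a code within 1/(n+1) of the optimal error is taken, so one sequence serves all
δ. Nonnegative rates ensure that codes exist at every length. -/
lemma achievable_of_eventually (hp : p ∈ stdSimplex ℝ (𝒳 × 𝒴)) {R : Fin 5 → ℝ}
    (hR : ∀ i, 0 ≤ R i)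
    (h : ∀ δ : ℝ, 0 < δ → ∀ᶠ n : ℕ in Filter.atTop, ∃ c : Code 𝒳 𝒴 n R, c.errorProb p ≤ δ) :
    Achievable p R := by
  obtain ⟨x0, y0⟩ := nonempty_of_mem_stdSimplex hp
  have hne : ∀ n, Nonempty (Code 𝒳 𝒴 n R) := fun n => by
    have m : (i : Fin 5) → Index n (R i) := fun i => (nonempty_index (hR i)).some
    exact ⟨⟨fun _ _ => m, fun _ _ _ => x0, fun _ _ _ => y0, fun _ _ _ _ => x0, fun _ _ _ _ => y0⟩⟩
  have hbdd : ∀ n, BddBelow (Set.range fun c : Code 𝒳 𝒴 n R => c.errorProb p) := fun n =>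
    ⟨0, by rintro _ ⟨c, rfl⟩; exact c.errorProb_nonneg hp.1⟩
  have hex : ∀ n : ℕ, ∃ c : Code 𝒳 𝒴 n R,
      c.errorProb p < (⨅ c : Code 𝒳 𝒴 n R, c.errorProb p) + 1 / ((n : ℝ) + 1) := fun n => by
    have := hne n
    exact exists_lt_of_ciInf_lt (lt_add_of_pos_right _ (by positivity))
  choose c hc using hex
  refine ⟨c, ?_⟩
  rw [Metric.tendsto_atTop']
  intro δ hδ
  have h1 := h (δ / 2) (by positivity)
  have h2 : ∀ᶠ n : ℕ in Filter.atTop, 1 / ((n : ℝ) + 1) < δ / 2 :=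
    tendsto_one_div_add_atTop_nhds_zero_nat.eventually (gt_mem_nhds (by positivity))
  obtain ⟨N, hN⟩ := Filter.eventually_atTop.mp (h1.and h2)
  refine ⟨N, fun n hn => ?_⟩
  obtain ⟨⟨c', hc'⟩, h3⟩ := hN n hn.le
  have h4 := ciInf_le (hbdd n) c'
  rw [Real.dist_eq, sub_zero, abs_of_nonneg ((c n).errorProb_nonneg hp.1)]
  linarith [hc n]

end Rates

lemma exists_code_of_oneShot {𝒳 𝒴 : Type*} {n : ℕ} {R : Fin 5 → ℝ}
    {W₀ W₁ W₂ W₃ W₄ : Type*}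
    [Fintype W₀] [Fintype W₁] [Fintype W₂] [Fintype W₃] [Fintype W₄]
    [Nonempty W₀] [Nonempty W₁] [Nonempty W₂] [Nonempty W₃] [Nonempty W₄]
    (h₀ : (Fintype.card W₀ : ℝ) ≤ 2 ^ ((n : ℝ) * R 0))
    (h₁ : (Fintype.card W₁ : ℝ) ≤ 2 ^ ((n : ℝ) * R 1))
    (h₂ : (Fintype.card W₂ : ℝ) ≤ 2 ^ ((n : ℝ) * R 2))
    (h₃ : (Fintype.card W₃ : ℝ) ≤ 2 ^ ((n : ℝ) * R 3))
    (h₄ : (Fintype.card W₄ : ℝ) ≤ 2 ^ ((n : ℝ) * R 4))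
    (e₀ : (Fin n → 𝒳) → (Fin n → 𝒴) → W₀) (e₁ : (Fin n → 𝒳) → (Fin n → 𝒴) → W₁)
    (e₂ : (Fin n → 𝒳) → (Fin n → 𝒴) → W₂) (e₃ : (Fin n → 𝒳) → (Fin n → 𝒴) → W₃)
    (e₄ : (Fin n → 𝒳) → (Fin n → 𝒴) → W₄)
    (d₁ : W₀ → W₁ → Fin n → 𝒳) (d₂ : W₀ → W₂ → Fin n → 𝒴)
    (d₃ : W₀ → W₃ → (Fin n → 𝒴) → Fin n → 𝒳) (d₄ : W₀ → W₄ → (Fin n → 𝒳) → Fin n → 𝒴) :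
    ∃ c : Code 𝒳 𝒴 n R, ∀ x y, c.Correct x y ↔ d₁ (e₀ x y) (e₁ x y) = x ∧
      d₂ (e₀ x y) (e₂ x y) = y ∧ d₃ (e₀ x y) (e₃ x y) y = x ∧ d₄ (e₀ x y) (e₄ x y) x = y := by
  obtain ⟨i₀, r₀, hr₀⟩ := exists_index_embedding h₀
  obtain ⟨i₁, r₁, hr₁⟩ := exists_index_embedding h₁
  obtain ⟨i₂, r₂, hr₂⟩ := exists_index_embedding h₂
  obtain ⟨i₃, r₃, hr₃⟩ := exists_index_embedding h₃
  obtain ⟨i₄, r₄, hr₄⟩ := exists_index_embedding h₄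
  refine ⟨{ enc := fun x y i => match i with
              | 0 => i₀ (e₀ x y)
              | 1 => i₁ (e₁ x y)
              | 2 => i₂ (e₂ x y)
              | 3 => i₃ (e₃ x y)
              | 4 => i₄ (e₄ x y)
            dec1 := fun w v => d₁ (r₀ w) (r₁ v)
            dec2 := fun w v => d₂ (r₀ w) (r₂ v)
            dec3 := fun w v => d₃ (r₀ w) (r₃ v)
            dec4 := fun w v => d₄ (r₀ w) (r₄ v) }, fun x y => ?_⟩
  simp only [Code.Correct, hr₀, hr₁, hr₂, hr₃, hr₄]

/-! ### Splitting the rates, and achievability -/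

section Achievability

variable {𝒳 𝒴 ι : Type*} [Fintype 𝒳] [Fintype 𝒴] [Fintype ι] {p : 𝒳 × 𝒴 → ℝ}
  {q : 𝒳 × 𝒴 → ι → ℝ}

lemma achievable_add_of_constraints (hp : p ∈ stdSimplex ℝ (𝒳 × 𝒴))
    (hq : ∀ s, q s ∈ stdSimplex ℝ ι) {R : Fin 5 → ℝ} (hR : ∀ i, 0 ≤ R i)
    (h0 : mutualInfo (lawXYU p q) ≤ R 0) (h1 : condEntropy (lawXU p q) ≤ R 1)
    (h2 : condEntropy (lawYU p q) ≤ R 2) (h03 : condEntropy p ≤ R 0 + R 3)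
    (h04 : condEntropy (p ∘ Prod.swap) ≤ R 0 + R 4) (h023 : entropy p ≤ R 0 + R 2 + R 3)
    (h014 : entropy p ≤ R 0 + R 1 + R 4) {ε : ℝ} (hε : 0 < ε) :
    Achievable p fun i => R i + ε := by
  classical
  refine achievable_of_eventually hp (fun i => add_nonneg (hR i) hε.le) fun δ hδ => ?_
  obtain ⟨x0, y0⟩ := nonempty_of_mem_stdSimplex hp
  have hX : Nonempty 𝒳 := ⟨x0⟩
  have hY : Nonempty 𝒴 := ⟨y0⟩
  -- The common message consists of four hashes, each exceeding its rate by η, for a total of ε.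
  set η := ε / 4 with hη
  have hη0 : 0 < η := by positivity
  have hI := mutualInfo_lawXYU_nonneg hp hq
  have hIeq := mutualInfo_lawXYU hp.1 hq
  have hXadd := condEntropy_lawXU_add hp.1 hq
  have hYadd := condEntropy_lawYU_add hp.1 hq
  have hquant := eventually_exists_quantizer hp hq (η := η / 4) (δ := δ / 2) (by positivity)
    (by positivity)
  rw [condEnt_fst_aux, condEnt_snd_aux, condEnt_fst_snd hq, condEnt_snd_fst hq] at hquant
  set I := mutualInfo (lawXYU p q) with hIdef
  set a := condEntropy (lawXU p q)
  set b := condEntropy (lawYU p q)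
  set a' := condEnt (fun z => z.1.1) (fun z => (z.1.2, z.2)) (lawXYU p q)
  set b' := condEnt (fun z => z.1.2) (fun z => (z.1.1, z.2)) (lawXYU p q)
  -- The surplus of the private rate over H(X|U), as far as it can replace common bits describing
  -- the index.
  set ρ₁ := min (R 1 - a) I with hρ₁
  set ρ₂ := min (R 2 - b) I with hρ₂
  have hρ₁0 : 0 ≤ ρ₁ := le_min (by linarith) hI
  have hρ₂0 : 0 ≤ ρ₂ := le_min (by linarith) hI
  have hρ₁I : ρ₁ ≤ I := min_le_right _ _
  have hρ₂I : ρ₂ ≤ I := min_le_right _ _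
  have hρ₁R : ρ₁ ≤ R 1 - a := min_le_left _ _
  have hρ₂R : ρ₂ ≤ R 2 - b := min_le_left _ _
  -- Decoder 1 still needs I - ρ₁ common bits and decoder 2 needs I - ρ₂. Sharing as many of them as
  -- possible in s₀ leaves s₁ or s₂ equal to 0, and s₃ takes up the rest of R₀.
  obtain ⟨s0, s1, s2, s3, hs0, hs1, hs2, hs3, e01, e02, e13, e23⟩ : ∃ s0 s1 s2 s3 : ℝ,
      0 ≤ s0 ∧ 0 ≤ s1 ∧ 0 ≤ s2 ∧ 0 ≤ s3 ∧ s0 + s1 = I - ρ₁ ∧ s0 + s2 = I - ρ₂ ∧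
      s1 + s3 = ρ₂ + (R 0 - I) ∧ s2 + s3 = ρ₁ + (R 0 - I) := by
    rcases le_total ρ₁ ρ₂ with h | h
    · exact ⟨I - ρ₂, ρ₂ - ρ₁, 0, ρ₁ + (R 0 - I), by linarith, by linarith, le_rfl, by linarith,
        by ring, by ring, by ring, by ring⟩
    · exact ⟨I - ρ₁, 0, ρ₁ - ρ₂, ρ₂ + (R 0 - I), by linarith, le_rfl, by linarith, by linarith,
        by ring, by ring, by ring, by ring⟩
  obtain ⟨s, t0, t1, t2, t3, t4, t5, t6, t7⟩ : ∃ s : Fin 8 → ℝ, s 0 = s0 ∧ s 1 = s1 ∧ s 2 = s2 ∧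
      s 3 = s3 ∧ s 4 = R 1 ∧ s 5 = R 2 ∧ s 6 = R 3 ∧ s 7 = R 4 :=
    ⟨![s0, s1, s2, s3, R 1, R 2, R 3, R 4], rfl, rfl, rfl, rfl, rfl, rfl, rfl, rfl⟩
  have hs : ∀ j, 0 ≤ s j := by
    simp only [Fin.forall_fin_succ, IsEmpty.forall_iff, and_true]
    refine ⟨t0.symm ▸ hs0, t1.symm ▸ hs1, t2.symm ▸ hs2, t3.symm ▸ hs3, t4.symm ▸ hR 1,
      t5.symm ▸ hR 2, t6.symm ▸ hR 3, t7.symm ▸ hR 4⟩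
  have hdecay : ∀ᶠ n : ℕ in Filter.atTop,
      4 * (2 * (256 * (2 : ℝ) ^ (-((n : ℝ) * (η / 2))))) ≤ δ / 2 := by
    have h1 : Filter.Tendsto (fun n : ℕ => (2 : ℝ) ^ (-((n : ℝ) * (η / 2)))) Filter.atTop
        (nhds 0) := by
      have h2 : Filter.Tendsto (fun n : ℕ => (2 : ℝ) ^ ((n : ℝ) * (η / 2))) Filter.atTop
          Filter.atTop := (tendsto_rpow_atTop_of_base_gt_one 2 (by norm_num)).comp
        (tendsto_natCast_atTop_atTop.atTop_mul_const (by positivity))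
      refine h2.inv_tendsto_atTop.congr fun n => ?_
      rw [Pi.inv_apply, Real.rpow_neg (by norm_num)]
    have h3 := ((h1.const_mul 256).const_mul 2).const_mul 4
    simp only [mul_zero] at h3
    exact h3.eventually (ge_mem_nhds (by positivity))
  filter_upwards [hquant, hdecay] with n hn hdec
  obtain ⟨N, φ, hN, hφδ, k1, k2, k3', k4', k3, k4⟩ := hn
  obtain ⟨m, hmdef⟩ : ∃ m : Fin 8 → ℕ, ∀ j, m j = ⌊(2 : ℝ) ^ ((n : ℝ) * (s j + η))⌋₊ :=
    ⟨_, fun _ => rfl⟩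
  have hm : ∀ j, 0 < m j := fun j => by
    rw [hmdef]
    exact Nat.floor_pos.mpr (Real.one_le_rpow (by norm_num)
      (mul_nonneg (by positivity) (add_nonneg (hs j) hη0.le)))
  have hmono : ∀ {H : ℝ}, (2 : ℝ) ^ ((n : ℝ) * (H + η / 4)) ≤ 2 ^ ((n : ℝ) * (H + η / 2)) :=
    fun {H} => Real.rpow_le_rpow_of_exponent_le (by norm_num)
      (mul_le_mul_of_nonneg_left (by linarith) (by positivity))
  have hmul : ∀ {H : ℝ}, (Fintype.card (Fin N) : ℝ) * 2 ^ ((n : ℝ) * (H + η / 4)) ≤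
      2 ^ ((n : ℝ) * ((I + H) + η / 2)) := by
    intro H
    rw [Fintype.card_fin]
    refine (mul_le_mul_of_nonneg_right hN (by positivity)).trans_eq ?_
    rw [← Real.rpow_add (by norm_num)]
    ring_nf
  have hbound : ∀ {J : Finset (Fin 8)} {c H : ℝ}, J.Nonempty → c ≤ 2 ^ ((n : ℝ) * (H + η / 2)) →
      H ≤ ∑ j ∈ J, s j → c * ∏ j ∈ J, (m j : ℝ)⁻¹ ≤ 256 * 2 ^ (-((n : ℝ) * (η / 2))) := by
    intro J c H hJ hc hH
    simp only [hmdef]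
    exact mul_prod_inv_floor_le hs hη0.le hJ hc hH
  have k3m : ∀ l y, ((Finset.univ.filter fun x => φ x y = some l).card : ℝ) ≤
      2 ^ ((n : ℝ) * (min a' (condEntropy p) + η / 4)) := by
    intro l y
    rcases le_total a' (condEntropy p) with h | h
    · rw [min_eq_left h]; exact k3' l y
    · rw [min_eq_right h]
      refine le_trans (Nat.cast_le.mpr (Finset.card_le_card fun x hx => ?_)) (k3 y)
      have := (Finset.mem_filter.mp hx).2
      simp [this]
  have k4m : ∀ l x, ((Finset.univ.filter fun y => φ x y = some l).card : ℝ) ≤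
      2 ^ ((n : ℝ) * (min b' (condEntropy (p ∘ Prod.swap)) + η / 4)) := by
    intro l x
    rcases le_total b' (condEntropy (p ∘ Prod.swap)) with h | h
    · rw [min_eq_left h]; exact k4' l x
    · rw [min_eq_right h]
      refine le_trans (Nat.cast_le.mpr (Finset.card_le_card fun y hy => ?_)) (k4 x)
      have := (Finset.mem_filter.mp hy).2
      simp [this]
  -- If ρ₂ = R₂ - H(Y|U), then s₁+s₃+R₃ = R₀+R₂+R₃ - I - H(Y|U) ≥ H(X|Y,U), by R₀+R₂+R₃ ≥ H(X,Y). If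
  -- ρ₂ = I, the sum is R₀+R₃ ≥ H(X|Y).
  have hmin3 : min a' (condEntropy p) ≤ s1 + s3 + R 3 := by
    rcases min_choice (R 2 - b) I with h | h
    · refine (min_le_left _ _).trans ?_
      rw [e13, hρ₂, h]; linarith
    · refine (min_le_right _ _).trans ?_
      rw [e13, hρ₂, h]; linarith
  have hmin4 : min b' (condEntropy (p ∘ Prod.swap)) ≤ s2 + s3 + R 4 := by
    rcases min_choice (R 1 - a) I with h | h
    · refine (min_le_left _ _).trans ?_
      rw [e23, hρ₁, h]; linarith
    · refine (min_le_right _ _).trans ?_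
      rw [e23, hρ₁, h]; linarith
  have hsums : (∑ j ∈ {0, 1, 4}, s j = s0 + (s1 + R 1)) ∧ (∑ j ∈ {1, 4}, s j = s1 + R 1) ∧
      (∑ j ∈ {0, 2, 5}, s j = s0 + (s2 + R 2)) ∧ (∑ j ∈ {2, 5}, s j = s2 + R 2) ∧
      (∑ j ∈ {0, 1, 2, 3, 6}, s j = s0 + (s1 + (s2 + (s3 + R 3)))) ∧
      (∑ j ∈ {1, 3, 6}, s j = s1 + (s3 + R 3)) ∧
      (∑ j ∈ {0, 1, 2, 3, 7}, s j = s0 + (s1 + (s2 + (s3 + R 4)))) ∧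
      (∑ j ∈ {2, 3, 7}, s j = s2 + (s3 + R 4)) := by
    refine ⟨?_, ?_, ?_, ?_, ?_, ?_, ?_, ?_⟩ <;> simp [t0, t1, t2, t3, t4, t5, t6, t7]
  obtain ⟨u1, u1', u2, u2', u3, u3', u4, u4'⟩ := hsums
  obtain ⟨e₀, e₁, e₂, e₃, e₄, d₁, d₂, d₃, d₄, herr⟩ := exists_oneShot_code φ hm
    (P := fun x y => ∏ i, p (x i, y i)) (δ := δ / 2)
    (ε := 2 * (256 * (2 : ℝ) ^ (-((n : ℝ) * (η / 2)))))
    (fun x y => Finset.prod_nonneg fun i _ => hp.1 _)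
    (by rw [← sum_arrow_prod (fun s : Fin n → 𝒳 × 𝒴 => ∏ i, p (s i)), sum_prod_eq_one hp])
    (by positivity) hφδ (c₁ := 2 ^ ((n : ℝ) * (a + η / 4))) (c₂ := 2 ^ ((n : ℝ) * (b + η / 4)))
    (c₃ := 2 ^ ((n : ℝ) * (condEntropy p + η / 4)))
    (c₃' := 2 ^ ((n : ℝ) * (min a' (condEntropy p) + η / 4)))
    (c₄ := 2 ^ ((n : ℝ) * (condEntropy (p ∘ Prod.swap) + η / 4)))
    (c₄' := 2 ^ ((n : ℝ) * (min b' (condEntropy (p ∘ Prod.swap)) + η / 4)))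
    (fun l => by convert k1 l) (fun l => by convert k2 l) (fun y => by convert k3 y)
    (fun l y => by convert k3m l y) (fun x => by convert k4 x) (fun l x => by convert k4m l x)
    ((add_le_add (hbound (Finset.insert_nonempty _ _) hmul (by rw [u1]; linarith))
      (hbound (Finset.insert_nonempty _ _) hmono (by rw [u1']; linarith))).trans_eq
        (two_mul _).symm)
    ((add_le_add (hbound (Finset.insert_nonempty _ _) hmul (by rw [u2]; linarith))
      (hbound (Finset.insert_nonempty _ _) hmono (by rw [u2']; linarith))).trans_eq
        (two_mul _).symm)
    ((add_le_add (hbound (Finset.insert_nonempty _ _) hmono (by rw [u3]; linarith))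
      (hbound (Finset.insert_nonempty _ _) hmono (by rw [u3']; linarith))).trans_eq
        (two_mul _).symm)
    ((add_le_add (hbound (Finset.insert_nonempty _ _) hmono (by rw [u4]; linarith))
      (hbound (Finset.insert_nonempty _ _) hmono (by rw [u4']; linarith))).trans_eq
        (two_mul _).symm)
  have hmle : ∀ j, (m j : ℝ) ≤ 2 ^ ((n : ℝ) * (s j + η)) := fun j => by
    rw [hmdef]
    exact Nat.floor_le (by positivity)
  have hne : ∀ j, Nonempty (Fin (m j)) := fun j => ⟨⟨0, hm j⟩⟩
  have hpriv : ∀ (j : Fin 8) (i : Fin 5), s j = R i →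
      (Fintype.card (Fin (m j)) : ℝ) ≤ 2 ^ ((n : ℝ) * (R i + ε)) := by
    intro j i hji
    rw [Fintype.card_fin]
    refine (hmle j).trans (Real.rpow_le_rpow_of_exponent_le (by norm_num)
      (mul_le_mul_of_nonneg_left ?_ (by positivity)))
    rw [hji, hη]; linarith
  have hcommon : (Fintype.card (Fin (m 0) × Fin (m 1) × Fin (m 2) × Fin (m 3)) : ℝ) ≤
      2 ^ ((n : ℝ) * (R 0 + ε)) := by
    simp only [Fintype.card_prod, Fintype.card_fin, Nat.cast_mul]
    calc (m 0 : ℝ) * (m 1 * (m 2 * m 3)) ≤ 2 ^ ((n : ℝ) * (s0 + η)) * (2 ^ ((n : ℝ) * (s1 + η)) *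
          (2 ^ ((n : ℝ) * (s2 + η)) * 2 ^ ((n : ℝ) * (s3 + η)))) := by
          have g0 := t0 ▸ hmle 0
          have g1 := t1 ▸ hmle 1
          have g2 := t2 ▸ hmle 2
          have g3 := t3 ▸ hmle 3
          exact mul_le_mul g0 (mul_le_mul g1 (mul_le_mul g2 g3 (by positivity) (by positivity))
            (by positivity) (by positivity)) (by positivity) (by positivity)
      _ = 2 ^ ((n : ℝ) * (R 0 + ε)) := by
          simp only [← Real.rpow_add (two_pos : (0 : ℝ) < 2)]
          congr 1
          rw [show R 0 = s0 + s1 + s2 + s3 by linarith, show ε = 4 * η by rw [hη]; ring]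
          ring
  have n0 := hne 0
  have n1 := hne 1
  have n2 := hne 2
  have n3 := hne 3
  have n4 := hne 4
  have n5 := hne 5
  have n6 := hne 6
  have n7 := hne 7
  obtain ⟨c, hc⟩ := exists_code_of_oneShot (R := fun i => R i + ε) hcommon (hpriv 4 1 t4)
    (hpriv 5 2 t5) (hpriv 6 3 t6) (hpriv 7 4 t7) e₀ e₁ e₂ e₃ e₄ d₁ d₂ d₃ d₄
  refine ⟨c, le_trans (le_of_eq ?_) (herr.trans (by linarith))⟩
  rw [Code.errorProb]
  refine Finset.sum_congr rfl fun x _ => Finset.sum_congr rfl fun y _ => ?_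
  by_cases h : c.Correct x y
  · rw [if_pos h, if_pos ((hc x y).1 h)]
  · rw [if_neg h, if_neg fun h' => h ((hc x y).2 h')]

/-- Four constraints are discarded. By the converse they hold again for some U, possibly a different
one, so they do not shrink the union over U. -/
lemma singleLetterRegion_subset (hp : p ∈ stdSimplex ℝ (𝒳 × 𝒴)) :
    singleLetterRegion p ⊆ rateRegion p := by
  rintro R ⟨hR, k, q, -, hq, h0, h1, h2, -, -, h03, h04, -, -, h023, h014⟩
  refine mem_closure_of_tendsto (b := Filter.atTop)
    (f := fun (n : ℕ) i => R i + 1 / ((n : ℝ) + 1)) ?_ (Filter.Eventually.of_forall fun n => ?_)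
  · rw [tendsto_pi_nhds]
    intro i
    simpa using tendsto_const_nhds.add (tendsto_one_div_add_atTop_nhds_zero_nat (𝕜 := ℝ))
  · exact achievable_add_of_constraints hp hq hR h0 h1 h2 h03 h04 h023 h014 (by positivity)

end Achievability

end EGW

theorem theorem2 {𝒳 𝒴 : Type*} [Fintype 𝒳] [Fintype 𝒴]
    (p : 𝒳 × 𝒴 → ℝ) (hp : p ∈ stdSimplex ℝ (𝒳 × 𝒴)) :
    EGW.rateRegion p =
      {R : Fin 5 → ℝ | (∀ i, 0 ≤ R i) ∧
        ∃ (k : ℕ) (q : 𝒳 × 𝒴 → Fin k → ℝ),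
          k ≤ Fintype.card 𝒳 * Fintype.card 𝒴 + 2 ∧
          (∀ s, q s ∈ stdSimplex ℝ (Fin k)) ∧
          R 0 ≥ EGW.mutualInfo (EGW.lawXYU p q) ∧
          R 1 ≥ EGW.condEntropy (EGW.lawXU p q) ∧
          R 2 ≥ EGW.condEntropy (EGW.lawYU p q) ∧
          R 3 ≥ EGW.condEntropy (EGW.lawXU p q) - EGW.entropy (EGW.sndLaw p) ∧
          R 4 ≥ EGW.condEntropy (EGW.lawYU p q) - EGW.entropy (EGW.fstLaw p) ∧
          R 0 + R 3 ≥ EGW.condEntropy p ∧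
          R 0 + R 4 ≥ EGW.condEntropy (p ∘ Prod.swap) ∧
          R 2 + R 3 ≥ EGW.condEntropy (EGW.lawXU p q) ∧
          R 1 + R 4 ≥ EGW.condEntropy (EGW.lawYU p q) ∧
          R 0 + R 2 + R 3 ≥ EGW.entropy p ∧
          R 0 + R 1 + R 4 ≥ EGW.entropy p} :=
  (EGW.rateRegion_subset hp).antisymm (EGW.singleLetterRegion_subset hp)
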